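/- Let $I=(a,b)$ with $-\infty\le a<b\le\infty$, let $m\ge 0$, let $q_{\rm sc},q_{\rm el},q_{\rm am}\in L^1_{\rm loc}(I)$ be real-valued, and let $\tau=\frac1{\mathrm i}\sigma_2\frac{d}{dx}+q_{\rm el}\mathbb 1+q_{\rm am}\sigma_1+(m+q_{\rm sc})\sigma_3$. Write $W_x(f,g)=f_1(x)g_2(x)-f_2(x)g_1(x)$. Let $H$ be the operator in $\mathfrak H=L^2(I,\mathbb C^2)$ given by $Hf=\tau f$ on all $f\in\mathfrak H\cap AC_{\rm loc}(I,\mathbb{C}^2)$ with $\tau f\in\mathfrak H$ that satisfy $W_a(u_-,f)=0$ if $\tau$ is limit circle at $a$ and $W_b(u_+,f)=0$ if $\tau$ is limit circle at $b$; here $u_\pm$ are fixed non-trivial real solutions of $\tau u=0$ (needed only at limit circle end points). A function $f\in AC_{\rm loc}(I,\mathbb{C}^2)$ is in the domain of $H$ near an end point if $f$ and $\tau f$ are square integrable near it and $f$ satisfies the boundary condition there, if there is one. For $c\in I$ let $H^D_{(a,c)}$ be the restriction of $H$ to $(a,c)$ with the Dirichlet condition $f_1(c)=0$. Assume that the spectrum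 of $H^D_{(a,c)}$ is purely discrete (isolated eigenvalues of finite multiplicity) for some $c\in I$. Let $\Phi(z,x)$, $\Theta(z,x)$ be real entire solutions of $\tau u=zu$ (entire in $z$ for each $x$, real for real $z$) with $W(\Theta(z),\Phi(z))=1$ and such that, for every $z\in\mathbb C$, $\Phi(z,\cdot)$ is non-trivial and in the domain of $H$ near $a$. A Weyl solution at $b$ (respectively $a$) is a non-trivial solution of $\tau u=zu$ that is in the domain of $H$ near $b$ (respectively $a$). Let $M$ be the singular Weyl function of $H$ with respect to $\Theta,\Phi$: $M(z)=-W(\Theta(z),u_+(z))/W(\Phi(z),u_+(z))$ for every $z\in\mathbb C$ for which a Weyl solution $u_+(z)$ at $b$ exists and $W(\Phi(z),u_+(z))\neq0$. Put $\Psi(z,x)=\Theta(z,x)+M(z)\Phi(z,x)$. Let $\lambda\in\mathbb R$; if $\Phi(\lambda,\cdot)\in\mathfrak H$, assume that $\lambda$ is an eigenvalue of $H$. Put $c_\infty(x)=\int_a^x\Phi(\lambda,y)^\top\Phi(\lambda,y)\,dy$ and $\widetilde\Phi_\infty(\lambda,x)=\Phi(\lambda,x)/c_\infty(x)$. Let $$\tau_\infty=\tau+\frac{\Phi_1(\lambda,x)^2-\Phi_2(\lambda,x)^2}{c_\infty(x)}\,\sigma_1-2\,\frac{\Phi_1(\lambda,x)\Phi_2(\lambda,x)}{c_\infty(x)}\,\sigma_3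 ,$$ and let $H_\infty$ be the operator given by $\tau_\infty$ in $\mathfrak H$ in the same way as $H$ is given by $\tau$, now with the boundary condition $W(\widetilde\Phi_\infty(\lambda),f)=0$ at each end point at which $\tau_\infty$ is limit circle. Weyl solutions, the singular Weyl function and $H^D_{\infty,(a,c)}$ are defined for $H_\infty$ as for $H$. Then the following hold. (1) $H_\infty$ has real entire solutions $\Phi_\infty,\Theta_\infty$ of $\tau_\infty u=zu$ with $$\Phi_\infty(z,x)=\frac1{z-\lambda}\Big(\Phi(z,x)-\widetilde\Phi_\infty(\lambda,x)\int_a^x\Phi(\lambda,y)^\top\Phi(z,y)\,dy\Big)\quad(z\ne\lambda),$$ $$\Theta_\infty(z,x)=(z-\lambda)\Theta(z,x)+\widetilde\Phi_\infty(\lambda,x)\,W_x(\Phi(\lambda),\Theta(z))\quad(z\in\mathbb C),$$ and $W(\Theta_\infty(z),\Phi_\infty(z))=1$ for all $z\in\mathbb C$. Moreover, with the dot denoting $\partial/\partial z$, $$\Phi_\infty(\lambda,x)=\dot\Phi(\lambda,x)-\widetilde\Phi_\infty(\lambda,x)\int_a^x\Phi(\lambda,y)^\top\dot\Phi(\lambda,y)\,dy,\qquad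 \Theta_\infty(\lambda,x)=-\widetilde\Phi_\infty(\lambda,x),$$ where the last integral converges absolutely. (2) The spectrum of $H^D_{\infty,(a,c)}$ is purely discrete for every $c\in I$. (3) For every $z\in\mathbb C$, $\Phi_\infty(z,\cdot)$ is a Weyl solution of $H_\infty$ at $a$. With $M_\infty(z)=(z-\lambda)^2M(z)$, $$\Psi_\infty(z,x):=(z-\lambda)\Psi(z,x)+\widetilde\Phi_\infty(\lambda,x)W_x(\Phi(\lambda),\Psi(z))=\Theta_\infty(z,x)+M_\infty(z)\Phi_\infty(z,x),$$ and $\Psi_\infty(z,\cdot)$ is a Weyl solution of $H_\infty$ at $b$ for every $z$ for which a Weyl solution $u_+(z)$ of $H$ at $b$ exists and $W(\Phi(z),u_+(z))\ne0$. (4) $M_\infty(z)=(z-\lambda)^2M(z)$ is the singular Weyl function of $H_\infty$ with respect to $\Theta_\infty,\Phi_\infty$. (At $z=\lambda$ this value is read as $0$, whether or not $M(\lambda)$ is defined.) -/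

import Mathlib

open MeasureTheory Filter Topology

noncomputable section

/-- The space `ℂ²` with its Euclidean norm. -/
abbrev CC2 : Type := EuclideanSpace ℂ (Fin 2)

/-- The bilinear product `fᵀ g` (no complex conjugation). -/
def dotT (f g : CC2) : ℂ := f 0 * g 0 + f 1 * g 1

/-- The Wronskian `W(f, g) = f₁ g₂ - f₂ g₁`, pointwise. -/
def wronsk (f g : CC2) : ℂ := f 0 * g 1 - f 1 * g 0

/-- The data of a one-dimensional Dirac operator on `(a, b)`: the end points, the mass and the
scalar, electrostatic and anomalous magnetic potentials, and the functions `uL`, `uR` that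
generate the boundary conditions at `a` and `b` (they are used only at limit circle end points). -/
structure DiracData where
  a : EReal
  b : EReal
  m : ℝ
  qsc : ℝ → ℝ
  qel : ℝ → ℝ
  qam : ℝ → ℝ
  uL : ℝ → CC2
  uR : ℝ → CC2

namespace DiracData

variable (S : DiracData)

/-- The interval `I = (a, b) ⊆ ℝ`. -/
def I : Set ℝ := {x : ℝ | S.a < (x : EReal) ∧ (x : EReal) < S.b}

/-- The filter of points of `I` tending to the left end point `a`. -/
def atLeft : Filter ℝ := Filter.comap (fun x : ℝ => (x : EReal)) (𝓝[>] S.a)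

/-- The filter of points of `I` tending to the right end point `b`. -/
def atRight : Filter ℝ := Filter.comap (fun x : ℝ => (x : EReal)) (𝓝[<] S.b)

/-- The differential expression `τ = (1/i) σ₂ d/dx + q_el 1 + q_am σ₁ + (m + q_sc) σ₃`,
where `(1/i) σ₂ = !![0, -1; 1, 0]`. -/
def tau (f : ℝ → CC2) (x : ℝ) : CC2 :=
  !₂[-(deriv f x 1) + ((S.qel x + (S.m + S.qsc x) : ℝ) : ℂ) * f x 0 + (S.qam x : ℂ) * f x 1,
     deriv f x 0 + (S.qam x : ℂ) * f x 0 + ((S.qel x - (S.m + S.qsc x) : ℝ) : ℂ) * f x 1]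

/-- `f ∈ AC_loc(I, ℂ²)`. -/
def ACLoc (f : ℝ → CC2) : Prop :=
  ∀ c ∈ S.I, ∀ d ∈ S.I, AbsolutelyContinuousOnInterval f c d

/-- `f` is a solution of `τ f = z f` on `I`. -/
def IsSolution (z : ℂ) (f : ℝ → CC2) : Prop :=
  S.ACLoc f ∧ ∀ᵐ x ∂(volume.restrict S.I), S.tau f x = z • f x

/-- `f` is square integrable near `a`. -/
def L2Left (f : ℝ → CC2) : Prop :=
  ∃ c ∈ S.I, MemLp f 2 (volume.restrict {x ∈ S.I | x < c})

/-- `f` is square integrable near `b`. -/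
def L2Right (f : ℝ → CC2) : Prop :=
  ∃ c ∈ S.I, MemLp f 2 (volume.restrict {x ∈ S.I | c < x})

/-- `τ` is in the limit circle case at `a` (otherwise it is in the limit point case). -/
def LimitCircleLeft : Prop := ∀ (z : ℂ) (f : ℝ → CC2), S.IsSolution z f → S.L2Left f

/-- `τ` is in the limit circle case at `b` (otherwise it is in the limit point case). -/
def LimitCircleRight : Prop := ∀ (z : ℂ) (f : ℝ → CC2), S.IsSolution z f → S.L2Right f

/-- The boundary condition `W_a(u_-, f) = 0`, imposed only in the limit circle case. -/
def BCLeft (f : ℝ → CC2) : Prop :=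
  S.LimitCircleLeft → Tendsto (fun x => wronsk (S.uL x) (f x)) S.atLeft (𝓝 0)

/-- The boundary condition `W_b(u_+, f) = 0`, imposed only in the limit circle case. -/
def BCRight (f : ℝ → CC2) : Prop :=
  S.LimitCircleRight → Tendsto (fun x => wronsk (S.uR x) (f x)) S.atRight (𝓝 0)

/-- `f` lies in the domain of `H` near `a`. -/
def InDomLeft (f : ℝ → CC2) : Prop :=
  S.ACLoc f ∧ S.L2Left f ∧ S.L2Left (S.tau f) ∧ S.BCLeft f

/-- `f` lies in the domain of `H` near `b`. -/
def InDomRight (f : ℝ → CC2) : Prop :=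
  S.ACLoc f ∧ S.L2Right f ∧ S.L2Right (S.tau f) ∧ S.BCRight f

/-- Standing assumptions on a Dirac operator: `a < b`, `m ≥ 0`, locally integrable real potentials,
and at each limit circle end point the boundary condition is generated by a non-trivial real
solution of `τ u = 0`. -/
structure IsStandard : Prop where
  a_lt_b : S.a < S.b
  m_nonneg : 0 ≤ S.m
  qsc_loc : LocallyIntegrableOn S.qsc S.I
  qel_loc : LocallyIntegrableOn S.qel S.I
  qam_loc : LocallyIntegrableOn S.qam S.I
  bc_left : S.LimitCircleLeft → S.IsSolution 0 S.uL ∧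
    (∀ x ∈ S.I, ∀ i, (S.uL x i).im = 0) ∧ ∃ x ∈ S.I, S.uL x ≠ 0
  bc_right : S.LimitCircleRight → S.IsSolution 0 S.uR ∧
    (∀ x ∈ S.I, ∀ i, (S.uR x i).im = 0) ∧ ∃ x ∈ S.I, S.uR x ≠ 0

/-- The Hilbert space `L²(I, ℂ²)`. -/
abbrev L2 : Type := Lp CC2 2 (volume.restrict S.I)

/-- The graph of the operator `H` in `L²(I, ℂ²)`: the pairs `(f, H f)`, `f` in the domain of `H`. -/
def graph : Set (S.L2 × S.L2) :=
  {p | ∃ F : ℝ → CC2, S.ACLoc F ∧ S.BCLeft F ∧ S.BCRight F ∧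
    (p.1 : ℝ → CC2) =ᵐ[volume.restrict S.I] F ∧
    (p.2 : ℝ → CC2) =ᵐ[volume.restrict S.I] S.tau F}

/-- `z` belongs to the resolvent set: `H - z` has an everywhere defined bounded inverse `R`. -/
def InResolventSet (z : ℂ) : Prop :=
  ∃ R : S.L2 →L[ℂ] S.L2, ∀ f g : S.L2, R g = f ↔ (f, g + z • f) ∈ S.graph

/-- The spectrum `σ(H)`. -/
def spec : Set ℂ := {z | ¬ S.InResolventSet z}

/-- `z ∈ σ_p(H)`. -/
def IsEigenvalue (z : ℂ) : Prop := ∃ f : S.L2, f ≠ 0 ∧ (f, z • f) ∈ S.graph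

/-- The spectrum is purely discrete: it consists of isolated eigenvalues of finite multiplicity. -/
def PurelyDiscrete : Prop :=
  ∀ z ∈ S.spec, (∃ U ∈ 𝓝 z, U ∩ S.spec = {z}) ∧ S.IsEigenvalue z ∧
    FiniteDimensional ℂ (Submodule.span ℂ {f : S.L2 | (f, z • f) ∈ S.graph})

/-- The operator `H^D_{(a, c)}`: restriction to `(a, c)` with the Dirichlet condition `f₁(c) = 0`
(the constant function `u = (0, 1)` satisfies `W(u, f) = -f₁`, and `c` is a regular end point). -/
def dirichletLeft (c : ℝ) : DiracData :=
  { S with b := (c : EReal), uR := fun _ => !₂[0, 1] }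

/-- `Φ` is a real entire solution: `Φ(z, ·)` solves `τ u = z u` for every `z ∈ ℂ`, `Φ(·, x)` is
entire for every `x ∈ I`, and `Φ(z, x)` is real for real `z`. -/
def IsRealEntireSolution (Φ : ℂ → ℝ → CC2) : Prop :=
  (∀ z, S.IsSolution z (Φ z)) ∧ (∀ x ∈ S.I, Differentiable ℂ (fun z => Φ z x)) ∧
    ∀ t : ℝ, ∀ x ∈ S.I, ∀ i, (Φ (t : ℂ) x i).im = 0

/-- `u` is a Weyl solution at `a`: non-trivial, `τ u = z u`, in the domain of `H` near `a`. -/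
def IsWeylLeft (z : ℂ) (u : ℝ → CC2) : Prop :=
  S.IsSolution z u ∧ (∃ x ∈ S.I, u x ≠ 0) ∧ S.InDomLeft u

/-- `u` is a Weyl solution at `b`: non-trivial, `τ u = z u`, in the domain of `H` near `b`. -/
def IsWeylRight (z : ℂ) (u : ℝ → CC2) : Prop :=
  S.IsSolution z u ∧ (∃ x ∈ S.I, u x ≠ 0) ∧ S.InDomRight u

/-- `M` is the singular Weyl function of `H` with respect to the system `Θ, Φ`:
`M(z) = -W(Θ(z), u_+(z)) / W(Φ(z), u_+(z))` at every `z` at which the Weyl solution `u_+(z)` at `b`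
exists and the denominator (which does not depend on `x`) is not zero. -/
def IsSingularWeylFunction (Θ Φ : ℂ → ℝ → CC2) (M : ℂ → ℂ) : Prop :=
  ∀ (z : ℂ) (u : ℝ → CC2), S.IsWeylRight z u → ∀ x ∈ S.I, wronsk (Φ z x) (u x) ≠ 0 →
    M z = -wronsk (Θ z x) (u x) / wronsk (Φ z x) (u x)

/-- `∫_a^x f(y)ᵀ g(y) dy`. -/
def intLeft (f g : ℝ → CC2) (x : ℝ) : ℂ := ∫ y in {y ∈ S.I | y < x}, dotT (f y) (g y)

/-- `u_∞(x) = u(x) / c_∞(x)` with `c_∞(x) = ∫_a^x u(y)ᵀ u(y) dy`. -/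
def uInf (u : ℝ → CC2) (x : ℝ) : CC2 := (S.intLeft u u x)⁻¹ • u x

/-- The doubly commuted operator `H_∞` constructed from `u` with `γ = ∞`. Its potential is
`Q + (u₁² - u₂²)/c_∞ σ₁ - 2 u₁ u₂/c_∞ σ₃`, and its boundary conditions are generated by
`u_∞ = u / c_∞` (at limit circle end points). It is used only for `u` real valued, so that taking
real parts below loses nothing. -/
def commInf (u : ℝ → CC2) : DiracData :=
  { S with
    qsc := fun x => S.qsc x + (-2 * (u x 0 * u x 1) / S.intLeft u u x).re
    qam := fun x => S.qam x + (((u x 0) ^ 2 - (u x 1) ^ 2) / S.intLeft u u x).re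
    uL := S.uInf u
    uR := S.uInf u }

end DiracData

end

noncomputable section

/-! ### Locally absolutely continuous functions on an open interval -/

/-! Write `u = Φ(λ)`, `c = c_∞`, so that `c' = |u|²`, and `u_∞ = u/c`. The proof rests on one
identity: if `g' = uᵀf`, then `(|g|²/c)' = |f|² - |f - g u_∞|²` (`Seed.aDeriv_sq`). Passing from `f`
to `f - g u_∞` changes square integrals only by a boundary term, which has a favourable sign at `b`
and is controlled at `a` by Cauchy–Schwarz when `g = ∫_a^x uᵀf`. For `f = 0`, `g = 1` it reads
`|u_∞|² = -(1/c)'`: `u_∞` is square integrable near `b` but not near `a`, where `1/c → ∞`. As `τ_∞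
u_∞ = λ u_∞`, the new expression is limit point at `a` (`Seed.not_limitCircle`) and no boundary
condition survives there.

The map `f ↦ (z-λ) f + W(u,f) u_∞` sends solutions for `τ` to solutions for `τ_∞` with the same `z`.
Green's formula at `a` gives `W(u,Φ(z)) = (λ-z) ∫_a^x uᵀΦ(z)`, so `Φ(z)` goes to `(z-λ)² Φ_∞(z)`
while `Θ(z)` goes to `Θ_∞(z)`; this is the factor in `M_∞`. The singularity of `Φ_∞` at `λ` is
removable once `∫_a^x uᵀΦ(z)` is known to be entire. That needs a locally uniform `L²` majorant: for
non-real `z`, reflection and Green's formula turn `∫|Φ(z)|²` into boundary Wronskians of `Φ(z)` and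
`Φ(z̄)` divided by `z - z̄`, which stay bounded because `W` vanishes on the diagonal, and averaging
over a circle carries the bound to real points (`exists_dominating`).

Boundary behaviour is governed by `limitCircle_of_wronsk`: a Wronskian of two functions of the
maximal domain can have a non-zero limit only at a limit circle end. At `b`, the Wronskian of `u_∞`
with the transform of a Weyl solution `f` is `(z-λ) W(u,f)/c`. It tends to zero: if `u` is square
integrable near `b`, the eigenvalue hypothesis puts `u` into the domain there; otherwise `c → ∞`
while `W(u,f) = O(1 + √c)`. Conversely, for `z ≠ λ`, Green's formula between `x` and `b` shows that
Weyl solutions of `H_∞` come from Weyl solutions of `H`. At `z = λ` the Wronskian of `u_∞` with any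
Weyl solution at `b` is zero, which gives the value `0`.

For discreteness, the spectrum of the Dirichlet restriction lies in the zero set of the entire
function `z ↦ Φ_∞(z,c)₁`, which has no non-real zeros by symmetry. Off the zeros Green's operator
solves the equation for data vanishing near `a`, a dense set, and closedness of the graph extends
this to all data once the bound is uniform. At real points the bound comes from
`norm_le_of_resolvent_family`: the norms of iterated resolvents are log-convex by symmetry and at
most geometric by Cauchy-type estimates, so already the first step obeys the geometric rate. -/

theorem AbsolutelyContinuousOnInterval.of_dist_le {X Y : Type*} [PseudoMetricSpace X]
    [PseudoMetricSpace Y] {f : ℝ → X} {g : ℝ → Y} {c d C : ℝ}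
    (hf : AbsolutelyContinuousOnInterval f c d)
    (h : ∀ x ∈ Set.uIcc c d, ∀ y ∈ Set.uIcc c d, dist (g x) (g y) ≤ C * dist (f x) (f y)) :
    AbsolutelyContinuousOnInterval g c d := by
  rw [absolutelyContinuousOnInterval_iff] at hf ⊢
  intro ε hε
  obtain ⟨δ, hδ, H⟩ := hf (ε / (|C| + 1)) (by positivity)
  refine ⟨δ, hδ, fun E hE hlt => ?_⟩
  have h1 := H E hE hlt
  have h2 : ∑ i ∈ Finset.range E.1, dist (g (E.2 i).1) (g (E.2 i).2) ≤
      (|C| + 1) * ∑ i ∈ Finset.range E.1, dist (f (E.2 i).1) (f (E.2 i).2) := by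
    rw [Finset.mul_sum]
    refine Finset.sum_le_sum fun i hi => ?_
    refine (h _ (hE.1 i hi).1 _ (hE.1 i hi).2).trans ?_
    exact mul_le_mul_of_nonneg_right (by linarith [le_abs_self C]) dist_nonneg
  refine h2.trans_lt ?_
  rwa [lt_div_iff₀' (by positivity)] at h1

theorem AbsolutelyContinuousOnInterval.congr' {X : Type*} [PseudoMetricSpace X]
    {f g : ℝ → X} {c d : ℝ} (hf : AbsolutelyContinuousOnInterval f c d)
    (h : ∀ x ∈ Set.uIcc c d, f x = g x) : AbsolutelyContinuousOnInterval g c d :=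
  hf.of_dist_le (C := 1) fun x hx y hy => by rw [h x hx, h y hy, one_mul]

/-- Countably many intervals with rational end points cover an open set, so the exceptional null
sets can be united. -/
theorem ae_restrict_of_forall_uIcc {I : Set ℝ} (hI : IsOpen I) {P : ℝ → Prop}
    (h : ∀ c ∈ I, ∀ d ∈ I, ∀ᵐ x, x ∈ Set.uIcc c d → P x) : ∀ᵐ x ∂volume.restrict I, P x := by
  have h1 : ∀ᵐ x, ∀ p q : ℚ, (p : ℝ) ∈ I → (q : ℝ) ∈ I → x ∈ Set.uIcc (p : ℝ) q → P x := by
    rw [ae_all_iff]; intro p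
    rw [ae_all_iff]; intro q
    by_cases hp : (p : ℝ) ∈ I
    · by_cases hq : (q : ℝ) ∈ I
      · filter_upwards [h p hp q hq] with x hx _ _ using hx
      · exact Eventually.of_forall fun x _ h => absurd h hq
    · exact Eventually.of_forall fun x h => absurd h hp
  rw [ae_restrict_iff' hI.measurableSet]
  filter_upwards [h1] with x hx hxI
  obtain ⟨ε, hε, hb⟩ := Metric.isOpen_iff.1 hI x hxI
  obtain ⟨p, hp1, hp2⟩ := exists_rat_btwn (show x - ε < x by linarith)
  obtain ⟨q, hq1, hq2⟩ := exists_rat_btwn (show x < x + ε by linarith)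
  refine hx p q (hb ?_) (hb ?_) ?_
  · rw [Metric.mem_ball, Real.dist_eq, abs_lt]; constructor <;> linarith
  · rw [Metric.mem_ball, Real.dist_eq, abs_lt]; constructor <;> linarith
  · rw [Set.uIcc_of_le (by linarith)]; exact ⟨hp2.le, hq1.le⟩

/-- `f` is absolutely continuous on the compact subintervals of `I`, with derivative `f'` almost
everywhere. -/
def ADeriv (I : Set ℝ) (f f' : ℝ → ℂ) : Prop :=
  (∀ c ∈ I, ∀ d ∈ I, AbsolutelyContinuousOnInterval f c d) ∧
    ∀ᵐ x ∂volume.restrict I, HasDerivAt f (f' x) x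

namespace ADeriv

variable {I : Set ℝ} {f f' g g' : ℝ → ℂ}

theorem congr_deriv (hf : ADeriv I f f') (h : f' =ᵐ[volume.restrict I] g') : ADeriv I f g' :=
  ⟨hf.1, by filter_upwards [hf.2, h] with x hx h; rwa [← h]⟩

theorem congr (hI : IsOpen I) [hc : I.OrdConnected] (hf : ADeriv I f f')
    (h : ∀ x ∈ I, f x = g x) (h' : ∀ x ∈ I, f' x = g' x) : ADeriv I g g' := by
  refine ⟨fun c hc' d hd => (hf.1 c hc' d hd).congr' fun x hx => h x (hc.uIcc_subset hc' hd hx), ?_⟩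
  filter_upwards [hf.2, ae_restrict_mem hI.measurableSet] with x hx hxI
  rw [← h' x hxI]
  refine hx.congr_of_eventuallyEq ?_
  filter_upwards [hI.mem_nhds hxI] with y hy using (h y hy).symm

theorem const (k : ℂ) : ADeriv I (fun _ => k) (fun _ => 0) :=
  ⟨fun _ _ _ _ => (LipschitzWith.const k).lipschitzOnWith.absolutelyContinuousOnInterval,
    Eventually.of_forall fun x => hasDerivAt_const x k⟩

theorem add (hf : ADeriv I f f') (hg : ADeriv I g g') :
    ADeriv I (fun x => f x + g x) (fun x => f' x + g' x) :=
  ⟨fun c hc d hd => (hf.1 c hc d hd).add (hg.1 c hc d hd),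
    by filter_upwards [hf.2, hg.2] with x hx hy using hx.add hy⟩

theorem sub (hf : ADeriv I f f') (hg : ADeriv I g g') :
    ADeriv I (fun x => f x - g x) (fun x => f' x - g' x) :=
  ⟨fun c hc d hd => (hf.1 c hc d hd).sub (hg.1 c hc d hd),
    by filter_upwards [hf.2, hg.2] with x hx hy using hx.sub hy⟩

theorem neg (hf : ADeriv I f f') : ADeriv I (fun x => -f x) (fun x => -f' x) :=
  ⟨fun c hc d hd => (hf.1 c hc d hd).neg, by filter_upwards [hf.2] with x hx using hx.neg⟩

theorem mul (hf : ADeriv I f f') (hg : ADeriv I g g') :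
    ADeriv I (fun x => f x * g x) (fun x => f' x * g x + f x * g' x) :=
  ⟨fun c hc d hd => (hf.1 c hc d hd).smul (hg.1 c hc d hd),
    by filter_upwards [hf.2, hg.2] with x hx hy using hx.mul hy⟩

theorem const_mul (k : ℂ) (hf : ADeriv I f f') :
    ADeriv I (fun x => k * f x) (fun x => k * f' x) :=
  ⟨fun c hc d hd => (hf.1 c hc d hd).const_smul k,
    by filter_upwards [hf.2] with x hx using hx.const_mul k⟩

theorem star (hf : ADeriv I f f') :
    ADeriv I (fun x => starRingEnd ℂ (f x)) (fun x => starRingEnd ℂ (f' x)) :=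
  ⟨fun c hc d hd => (hf.1 c hc d hd).of_dist_le (C := 1) fun x _ y _ => by
      rw [one_mul, Complex.dist_conj_conj],
    by filter_upwards [hf.2] with x hx using hx.star⟩

theorem continuousOn (hI : IsOpen I) (hf : ADeriv I f f') : ContinuousOn f I := by
  intro x hx
  obtain ⟨ε, hε, hb⟩ := Metric.isOpen_iff.1 hI x hx
  have h1 : x - ε / 2 ∈ I := hb (by rw [Metric.mem_ball, Real.dist_eq, abs_lt]; constructor <;> linarith)
  have h2 : x + ε / 2 ∈ I := hb (by rw [Metric.mem_ball, Real.dist_eq, abs_lt]; constructor <;> linarith)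
  have h3 := (hf.1 _ h1 _ h2).continuousOn
  rw [Set.uIcc_of_le (by linarith)] at h3
  exact (h3.continuousAt (Icc_mem_nhds (by linarith) (by linarith))).continuousWithinAt

/-- On a compact subinterval `1/f` is bounded by some `K`, so its increments are at most `K²` times
those of `f`. -/
theorem inv (hI : IsOpen I) [hc : I.OrdConnected] (hf : ADeriv I f f') (h0 : ∀ x ∈ I, f x ≠ 0) :
    ADeriv I (fun x => (f x)⁻¹) (fun x => -f' x / f x ^ 2) := by
  refine ⟨fun c hc' d hd => ?_, ?_⟩
  · have hsub := hc.uIcc_subset hc' hd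
    have hcont : ContinuousOn (fun x => (f x)⁻¹) (Set.uIcc c d) :=
      ((hf.continuousOn hI).mono hsub).inv₀ fun x hx => h0 x (hsub hx)
    obtain ⟨K, hK⟩ := isCompact_uIcc.exists_bound_of_continuousOn hcont
    refine (hf.1 c hc' d hd).of_dist_le (C := K * K) fun x hx y hy => ?_
    have hx0 := h0 x (hsub hx)
    have hy0 := h0 y (hsub hy)
    have : (f x)⁻¹ - (f y)⁻¹ = (f x)⁻¹ * (f y)⁻¹ * (f y - f x) := by field_simp
    rw [dist_eq_norm, this, norm_mul, norm_mul, ← dist_eq_norm, dist_comm (f y)]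
    have := hK x hx
    gcongr
    · exact (norm_nonneg _).trans this
    · exact hK y hy
  · filter_upwards [hf.2, ae_restrict_mem hI.measurableSet] with x hx hxI
    exact hx.inv (h0 x hxI)

theorem ae_uIcc (hI : I.OrdConnected) (hf : ADeriv I f f') {c d : ℝ} (hc : c ∈ I) (hd : d ∈ I) :
    ∀ᵐ x, x ∈ Set.uIcc c d → HasDerivAt f (f' x) x := by
  have : ∀ᵐ x ∂volume.restrict (Set.uIcc c d), HasDerivAt f (f' x) x :=
    ae_mono (Measure.restrict_mono (hI.uIcc_subset hc hd) le_rfl) hf.2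
  rwa [ae_restrict_iff' measurableSet_uIcc] at this

theorem eq_of_deriv_zero (hI : I.OrdConnected) (hf : ADeriv I f (fun _ => 0)) {c d : ℝ}
    (hc : c ∈ I) (hd : d ∈ I) : f c = f d := by
  obtain ⟨C, hC⟩ := (hf.1 c hc d hd).const_of_ae_hasDerivAt_zero (hf.ae_uIcc hI hc hd)
  rw [hC c Set.left_mem_uIcc, hC d Set.right_mem_uIcc]

theorem re_im (hf : ADeriv I f f') {c d : ℝ} (hc : c ∈ I) (hd : d ∈ I) :
    AbsolutelyContinuousOnInterval (fun x => (f x).re) c d ∧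
    AbsolutelyContinuousOnInterval (fun x => (f x).im) c d :=
  ⟨(hf.1 c hc d hd).of_dist_le (C := 1) fun x _ y _ => by
      rw [one_mul, Real.dist_eq, dist_eq_norm, ← Complex.sub_re]; exact Complex.abs_re_le_norm _,
   (hf.1 c hc d hd).of_dist_le (C := 1) fun x _ y _ => by
      rw [one_mul, Real.dist_eq, dist_eq_norm, ← Complex.sub_im]; exact Complex.abs_im_le_norm _⟩

theorem intervalIntegrable (hI : I.OrdConnected) (hf : ADeriv I f f') {c d : ℝ}
    (hc : c ∈ I) (hd : d ∈ I) : IntervalIntegrable f' volume c d := by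
  obtain ⟨h1, h2⟩ := hf.re_im hc hd
  have i1 := h1.intervalIntegrable_deriv
  have i2 := h2.intervalIntegrable_deriv
  have i3 : IntervalIntegrable (fun x => ((deriv (fun x => (f x).re) x : ℝ) : ℂ) +
      ((deriv (fun x => (f x).im) x : ℝ) : ℂ) * Complex.I) volume c d :=
    IntervalIntegrable.add ⟨i1.1.ofReal, i1.2.ofReal⟩
      (IntervalIntegrable.mul_const ⟨i2.1.ofReal, i2.2.ofReal⟩ _)
  refine i3.congr_ae ?_
  rw [EventuallyEq, ae_restrict_iff' measurableSet_uIoc]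
  filter_upwards [hf.ae_uIcc hI hc hd] with x hx hxm
  have hd := hx (Set.uIoc_subset_uIcc hxm)
  have e1 : HasDerivAt (fun x => (f x).re) (f' x).re x :=
    (Complex.reCLM.hasFDerivAt.comp_hasDerivAt x hd)
  have e2 : HasDerivAt (fun x => (f x).im) (f' x).im x :=
    (Complex.imCLM.hasFDerivAt.comp_hasDerivAt x hd)
  rw [e1.deriv, e2.deriv, Complex.re_add_im]

/-- The primitive of a locally integrable function. -/
theorem integral (hI : IsOpen I) [hc : I.OrdConnected] {k : ℝ → ℂ}
    (hk : ∀ c ∈ I, ∀ d ∈ I, IntervalIntegrable k volume c d) {x₀ : ℝ} (hx₀ : x₀ ∈ I) :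
    ADeriv I (fun x => ∫ t in x₀..x, k t) k := by
  have min_mem : ∀ p q : ℝ, p ∈ I → q ∈ I → min p q ∈ I := fun p q hp hq => by
    rcases min_choice p q with h | h <;> rwa [h]
  have max_mem : ∀ p q : ℝ, p ∈ I → q ∈ I → max p q ∈ I := fun p q hp hq => by
    rcases max_choice p q with h | h <;> rwa [h]
  refine ⟨fun c hc' d hd => ?_, ?_⟩
  -- The interval is enlarged so as to contain the base point `x₀` as well, as absolute continuity
  -- of a primitive is stated for a base point inside.
  · obtain ⟨e, he, e', he', h1, h2⟩ : ∃ e ∈ I, ∃ e' ∈ I, x₀ ∈ Set.uIcc e e' ∧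
        Set.uIcc c d ⊆ Set.uIcc e e' := by
      refine ⟨min x₀ (min c d), ?_, max x₀ (max c d), ?_, ?_, ?_⟩
      · exact min_mem _ _ hx₀ (min_mem _ _ hc' hd)
      · exact max_mem _ _ hx₀ (max_mem _ _ hc' hd)
      · rw [Set.mem_uIcc]; simp
      · rw [Set.uIcc_subset_uIcc_iff_mem, Set.mem_uIcc, Set.mem_uIcc]; simp
    have i1 := hk e he e' he'
    have r : IntervalIntegrable (fun x => (k x).re) volume e e' := ⟨i1.1.re, i1.2.re⟩
    have i : IntervalIntegrable (fun x => (k x).im) volume e e' := ⟨i1.1.im, i1.2.im⟩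
    have a1 := (r.absolutelyContinuousOnInterval_intervalIntegral h1).mono h2
    have a2 := (i.absolutelyContinuousOnInterval_intervalIntegral h1).mono h2
    have b1 : AbsolutelyContinuousOnInterval
        (fun x => ((∫ t in x₀..x, (k t).re : ℝ) : ℂ)) c d :=
      a1.of_dist_le (C := 1) fun x _ y _ => by rw [one_mul, Complex.dist_of_im_eq] <;> simp
    have b2 : AbsolutelyContinuousOnInterval
        (fun x => ((∫ t in x₀..x, (k t).im : ℝ) : ℂ)) c d :=
      a2.of_dist_le (C := 1) fun x _ y _ => by rw [one_mul, Complex.dist_of_im_eq] <;> simp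
    refine (b1.add (b2.const_smul Complex.I)).congr' fun x hx => ?_
    have ii : IntervalIntegrable k volume x₀ x := hk _ hx₀ _ (hc.uIcc_subset hc' hd hx)
    simp only [Pi.add_apply, smul_eq_mul]
    apply Complex.ext
    · have := Complex.reCLM.intervalIntegral_comp_comm ii
      simpa using this
    · have := Complex.imCLM.intervalIntegral_comp_comm ii
      simpa using this
  · refine ae_restrict_of_forall_uIcc hI fun c hc' d hd => ?_
    have h1 := (hk c hc' d hd).ae_hasDerivAt_integral
    filter_upwards [h1] with x hx hxm
    have h2 := (hx hxm c Set.left_mem_uIcc).const_add (∫ t in x₀..c, k t)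
    refine h2.congr_of_eventuallyEq ?_
    filter_upwards [hI.mem_nhds (hc.uIcc_subset hc' hd hxm)] with y hy
    rw [intervalIntegral.integral_add_adjacent_intervals (hk _ hx₀ _ hc') (hk _ hc' _ hy)]

theorem integral_eq_sub (hI : IsOpen I) [hc : I.OrdConnected] (hf : ADeriv I f f') {c d : ℝ}
    (hc' : c ∈ I) (hd : d ∈ I) : ∫ t in c..d, f' t = f d - f c := by
  have h1 := ADeriv.integral hI (fun c hc' d hd => hf.intervalIntegrable hc hc' hd) hc'
  have h2 := ((hf.sub h1).congr_deriv (g' := fun _ => 0) (by simp)).eq_of_deriv_zero hc hc' hd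
  simp only [intervalIntegral.integral_same, sub_zero] at h2
  rw [h2]; ring

end ADeriv

/-! ### Algebra in `ℂ²` -/

theorem CC2.ext {v w : CC2} (h0 : v 0 = w 0) (h1 : v 1 = w 1) : v = w := by
  ext i; fin_cases i <;> assumption

/-- Componentwise complex conjugation. -/
def conj2 (v : CC2) : CC2 := !₂[starRingEnd ℂ (v 0), starRingEnd ℂ (v 1)]

/-- The matrix `(1/i) σ₂`. -/
def rot2 (v : CC2) : CC2 := !₂[-v 1, v 0]

@[simp] theorem conj2_zero' (v : CC2) : conj2 v 0 = starRingEnd ℂ (v 0) := rfl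
@[simp] theorem conj2_one' (v : CC2) : conj2 v 1 = starRingEnd ℂ (v 1) := rfl
@[simp] theorem rot2_zero' (v : CC2) : rot2 v 0 = -v 1 := rfl
@[simp] theorem rot2_one' (v : CC2) : rot2 v 1 = v 0 := rfl

theorem CC2.norm_sq (v : CC2) : ‖v‖ ^ 2 = ‖v 0‖ ^ 2 + ‖v 1‖ ^ 2 := by
  rw [EuclideanSpace.norm_sq_eq, Fin.sum_univ_two]

theorem CC2.norm_apply_le (v : CC2) (i : Fin 2) : ‖v i‖ ≤ ‖v‖ := PiLp.norm_apply_le v i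

theorem CC2.norm_le_add (v : CC2) : ‖v‖ ≤ ‖v 0‖ + ‖v 1‖ := by
  refine abs_le_of_sq_le_sq' ?_ (by positivity) |>.2
  rw [CC2.norm_sq]; nlinarith [norm_nonneg (v 0), norm_nonneg (v 1)]

@[simp] theorem norm_conj2 (v : CC2) : ‖conj2 v‖ = ‖v‖ := by
  rw [← sq_eq_sq₀ (norm_nonneg _) (norm_nonneg _), CC2.norm_sq, CC2.norm_sq]; simp

theorem continuous_conj2 : Continuous conj2 := by
  refine (PiLp.continuous_toLp 2 _).comp (continuous_pi fun i => ?_)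
  fin_cases i
  · exact Complex.continuous_conj.comp (EuclideanSpace.proj (𝕜 := ℂ) (0 : Fin 2)).continuous
  · exact Complex.continuous_conj.comp (EuclideanSpace.proj (𝕜 := ℂ) (1 : Fin 2)).continuous

theorem inner_eq_dotT (v w : CC2) : inner ℂ v w = dotT (conj2 v) w := by
  rw [EuclideanSpace.inner_eq_star_dotProduct]
  simp [dotT, dotProduct, Fin.sum_univ_two, mul_comm]

theorem conj2_conj2 (v : CC2) : conj2 (conj2 v) = v := CC2.ext (by simp) (by simp)

theorem norm_dotT_le (v w : CC2) : ‖dotT v w‖ ≤ ‖v‖ * ‖w‖ := by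
  have := norm_inner_le_norm (𝕜 := ℂ) (conj2 v) w
  rwa [inner_eq_dotT, conj2_conj2, norm_conj2] at this

theorem wronsk_eq_dotT (v w : CC2) : wronsk v w = dotT (rot2 v) w := by
  simp [wronsk, dotT]; ring

@[simp] theorem norm_rot2 (v : CC2) : ‖rot2 v‖ = ‖v‖ := by
  rw [← sq_eq_sq₀ (norm_nonneg _) (norm_nonneg _), CC2.norm_sq, CC2.norm_sq]; simp [add_comm]

theorem norm_wronsk_le (v w : CC2) : ‖wronsk v w‖ ≤ ‖v‖ * ‖w‖ := by
  rw [wronsk_eq_dotT]; simpa using norm_dotT_le (rot2 v) w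

theorem dotT_comm (v w : CC2) : dotT v w = dotT w v := by simp only [dotT]; ring
theorem wronsk_antisymm (v w : CC2) : wronsk v w = -wronsk w v := by simp only [wronsk]; ring
@[simp] theorem wronsk_self (v : CC2) : wronsk v v = 0 := by simp only [wronsk]; ring

@[simp] theorem dotT_add_right (u v w : CC2) : dotT u (v + w) = dotT u v + dotT u w := by
  simp [dotT]; ring
@[simp] theorem dotT_sub_right (u v w : CC2) : dotT u (v - w) = dotT u v - dotT u w := by
  simp [dotT]; ring
@[simp] theorem dotT_smul_right (k : ℂ) (v w : CC2) : dotT v (k • w) = k * dotT v w := by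
  simp [dotT]; ring
@[simp] theorem dotT_smul_left (k : ℂ) (v w : CC2) : dotT (k • v) w = k * dotT v w := by
  simp [dotT]; ring
@[simp] theorem wronsk_add_right (u v w : CC2) : wronsk u (v + w) = wronsk u v + wronsk u w := by
  simp [wronsk]; ring
@[simp] theorem wronsk_add_left (u v w : CC2) : wronsk (u + v) w = wronsk u w + wronsk v w := by
  simp [wronsk]; ring
@[simp] theorem wronsk_sub_right (u v w : CC2) : wronsk u (v - w) = wronsk u v - wronsk u w := by
  simp [wronsk]; ring
@[simp] theorem wronsk_sub_left (u v w : CC2) : wronsk (u - v) w = wronsk u w - wronsk v w := by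
  simp [wronsk]; ring
@[simp] theorem wronsk_smul_right (k : ℂ) (v w : CC2) : wronsk v (k • w) = k * wronsk v w := by
  simp [wronsk]; ring
@[simp] theorem wronsk_smul_left (k : ℂ) (v w : CC2) : wronsk (k • v) w = k * wronsk v w := by
  simp [wronsk]; ring
@[simp] theorem wronsk_zero_left (v : CC2) : wronsk 0 v = 0 := by simp [wronsk]
@[simp] theorem wronsk_zero_right (v : CC2) : wronsk v 0 = 0 := by simp [wronsk]
@[simp] theorem dotT_zero_right (v : CC2) : dotT v 0 = 0 := by simp [dotT]
-- Plücker's relation. At an end point it trades one Wronskian for Wronskians with a generator of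
-- the boundary condition.
theorem wronsk_pluecker (a b c d : CC2) :
    wronsk a b * wronsk c d = wronsk a c * wronsk b d - wronsk a d * wronsk b c := by
  simp only [wronsk]; ring

/-- Cramer's rule without division, hence valid also for dependent `f`, `g`. -/
theorem wronsk_smul_eq (v f g : CC2) : wronsk f g • v = wronsk v g • f - wronsk v f • g := by
  apply CC2.ext <;> simp [wronsk] <;> ring

theorem eq_of_wronsk_eq_one {θ φ : CC2} (h : wronsk θ φ = 1) (f : CC2) :
    f = wronsk θ f • φ - wronsk φ f • θ := by
  have := wronsk_smul_eq f θ φ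
  rw [h, one_smul] at this
  rw [wronsk_antisymm θ f, wronsk_antisymm φ f]
  nth_rewrite 1 [this]
  apply CC2.ext <;> simp <;> ring

/-! ### The inhomogeneous Dirac equation, Lagrange's identity and variation of constants -/

namespace DiracData

variable (S : DiracData)

theorem isOpen_I : IsOpen S.I :=
  (isOpen_lt continuous_const continuous_coe_real_ereal).inter
    (isOpen_lt continuous_coe_real_ereal continuous_const)

instance ordConnected_I : S.I.OrdConnected :=
  ⟨fun _ hx _ hy _ hz => ⟨hx.1.trans_le (EReal.coe_le_coe_iff.2 hz.1),
    (EReal.coe_le_coe_iff.2 hz.2).trans_lt hy.2⟩⟩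

theorem measurableSet_I : MeasurableSet S.I := S.isOpen_I.measurableSet

/-- `f` is locally absolutely continuous and `τ f = g` almost everywhere. -/
def DEq (f g : ℝ → CC2) : Prop :=
  S.ACLoc f ∧ ∀ᵐ x ∂(volume.restrict S.I), S.tau f x = g x

variable {S} {f g f' g' : ℝ → CC2}

theorem ACLoc.ae_differentiableAt (hf : S.ACLoc f) :
    ∀ᵐ x ∂(volume.restrict S.I), DifferentiableAt ℝ f x :=
  ae_restrict_of_forall_uIcc S.isOpen_I fun c hc d hd =>
    (hf c hc d hd).boundedVariationOn.ae_differentiableAt_of_mem_uIcc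

theorem hasDerivAt_CC2 {f : ℝ → CC2} {v : CC2} {x : ℝ} :
    HasDerivAt f v x ↔ HasDerivAt (fun y => f y 0) (v 0) x ∧ HasDerivAt (fun y => f y 1) (v 1) x := by
  rw [← Fin.forall_fin_two (p := fun i => HasDerivAt (fun y => f y i) (v i) x), ← hasDerivAt_pi]
  exact ⟨fun h => ((PiLp.continuousLinearEquiv 2 ℝ (fun _ : Fin 2 => ℂ)).toContinuousLinearMap).hasFDerivAt.comp_hasDerivAt x h,
    fun h => ((PiLp.continuousLinearEquiv 2 ℝ (fun _ : Fin 2 => ℂ)).symm.toContinuousLinearMap).hasFDerivAt.comp_hasDerivAt x h⟩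

/-- Solving for the derivatives turns `τ f = g` into a first-order system for the two components, to
which the scalar calculus of `ADeriv` applies. -/
theorem dEq_iff : S.DEq f g ↔
    ADeriv S.I (fun x => f x 0) (fun x => g x 1 - (S.qam x : ℂ) * f x 0
      - ((S.qel x - (S.m + S.qsc x) : ℝ) : ℂ) * f x 1) ∧
    ADeriv S.I (fun x => f x 1) (fun x => -g x 0 + ((S.qel x + (S.m + S.qsc x) : ℝ) : ℂ) * f x 0
      + (S.qam x : ℂ) * f x 1) := by
  constructor
  · rintro ⟨h1, h2⟩
    refine ⟨⟨fun c hc d hd => (h1 c hc d hd).of_dist_le (C := 1) fun x _ y _ => ?_, ?_⟩,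
      ⟨fun c hc d hd => (h1 c hc d hd).of_dist_le (C := 1) fun x _ y _ => ?_, ?_⟩⟩
    · rw [one_mul, dist_eq_norm, dist_eq_norm]; exact CC2.norm_apply_le (f x - f y) 0
    · filter_upwards [h2, h1.ae_differentiableAt] with x hx hd
      have := (hasDerivAt_CC2.1 hd.hasDerivAt).1
      convert! this using 1
      rw [← hx]; simp [tau]; ring
    · rw [one_mul, dist_eq_norm, dist_eq_norm]; exact CC2.norm_apply_le (f x - f y) 1
    · filter_upwards [h2, h1.ae_differentiableAt] with x hx hd
      have := (hasDerivAt_CC2.1 hd.hasDerivAt).2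
      convert! this using 1
      rw [← hx]; simp [tau]; ring
  · rintro ⟨h1, h2⟩
    refine ⟨fun c hc d hd => ?_, ?_⟩
    · have a0 : AbsolutelyContinuousOnInterval (fun x => (!₂[f x 0, 0] : CC2)) c d :=
        (h1.1 c hc d hd).of_dist_le (C := 1) fun x _ y _ => by
          rw [one_mul, dist_eq_norm, dist_eq_norm]
          refine (CC2.norm_le_add _).trans ?_
          simp
      have a1 : AbsolutelyContinuousOnInterval (fun x => (!₂[0, f x 1] : CC2)) c d :=
        (h2.1 c hc d hd).of_dist_le (C := 1) fun x _ y _ => by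
          rw [one_mul, dist_eq_norm, dist_eq_norm]
          refine (CC2.norm_le_add _).trans ?_
          simp
      exact (a0.add a1).congr' fun x _ => CC2.ext (by simp) (by simp)
    · filter_upwards [h1.2, h2.2] with x hx0 hx1
      have := (hasDerivAt_CC2 (f := f) (v := !₂[_, _])).2 ⟨hx0, hx1⟩
      apply CC2.ext <;> simp [tau, this.deriv] <;> ring

namespace DEq

theorem congr (hf : S.DEq f g) (h : ∀ x ∈ S.I, f x = f' x) (h' : ∀ x ∈ S.I, g x = g' x) :
    S.DEq f' g' := by
  rw [dEq_iff] at *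
  constructor
  · exact hf.1.congr S.isOpen_I (fun x hx => by rw [h x hx]) fun x hx => by rw [h x hx, h' x hx]
  · exact hf.2.congr S.isOpen_I (fun x hx => by rw [h x hx]) fun x hx => by rw [h x hx, h' x hx]

theorem congr_right (hf : S.DEq f g) (h' : g =ᵐ[volume.restrict S.I] g') : S.DEq f g' :=
  ⟨hf.1, by filter_upwards [hf.2, h'] with x hx h; rw [hx, h]⟩

/-- Lagrange's identity: the potential matrix is symmetric for the bilinear product and cancels. The
primed functions are the images under `τ`, not derivatives. -/
theorem wronsk (hf : S.DEq f f') (hg : S.DEq g g') :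
    ADeriv S.I (fun x => wronsk (f x) (g x))
      (fun x => dotT (f' x) (g x) - dotT (f x) (g' x)) := by
  rw [dEq_iff] at hf hg
  refine ((hf.1.mul hg.2).sub (hf.2.mul hg.1)).congr_deriv (Eventually.of_forall fun x => ?_)
  simp only [dotT]; push_cast; ring

theorem add (hf : S.DEq f f') (hg : S.DEq g g') :
    S.DEq (fun x => f x + g x) (fun x => f' x + g' x) := by
  rw [dEq_iff] at *
  constructor
  · refine (hf.1.add hg.1).congr_deriv (Eventually.of_forall fun x => ?_)
    simp; ring
  · refine (hf.2.add hg.2).congr_deriv (Eventually.of_forall fun x => ?_)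
    simp; ring

/-- Leibniz rule; only the first-order part of `τ` sees the scalar factor. -/
theorem fsmul {k k' : ℝ → ℂ} (hk : ADeriv S.I k k') (hf : S.DEq f g) :
    S.DEq (fun x => k x • f x) (fun x => k x • g x + k' x • rot2 (f x)) := by
  rw [dEq_iff] at *
  constructor
  · refine (hk.mul hf.1).congr_deriv (Eventually.of_forall fun x => ?_)
    simp; ring
  · refine (hk.mul hf.2).congr_deriv (Eventually.of_forall fun x => ?_)
    simp; ring

theorem smul (k : ℂ) (hf : S.DEq f g) : S.DEq (fun x => k • f x) (fun x => k • g x) :=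
  (hf.fsmul (ADeriv.const k)).congr (fun _ _ => rfl) fun x _ => by simp

theorem sub (hf : S.DEq f f') (hg : S.DEq g g') :
    S.DEq (fun x => f x - g x) (fun x => f' x - g' x) :=
  (hf.add (hg.smul (-1))).congr (fun x _ => by simp [sub_eq_add_neg])
    fun x _ => by simp [sub_eq_add_neg]

theorem conj2 (hf : S.DEq f g) : S.DEq (fun x => conj2 (f x)) (fun x => conj2 (g x)) := by
  rw [dEq_iff] at *
  constructor
  · refine hf.1.star.congr_deriv (Eventually.of_forall fun x => ?_)
    simp
  · refine hf.2.star.congr_deriv (Eventually.of_forall fun x => ?_)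
    simp

theorem continuousOn (hf : S.DEq f g) : ContinuousOn f S.I := by
  rw [dEq_iff] at hf
  have h0 := hf.1.continuousOn S.isOpen_I
  have h1 := hf.2.continuousOn S.isOpen_I
  have : ContinuousOn (fun x => (!₂[f x 0, f x 1] : CC2)) S.I := by
    refine (PiLp.continuous_toLp 2 _).comp_continuousOn (continuousOn_pi.2 fun i => ?_)
    fin_cases i
    · exact h0
    · exact h1
  exact this.congr fun x _ => CC2.ext rfl rfl

theorem dirichletLeft (hf : S.DEq f g) {c : ℝ} (hc : c ∈ S.I) : (S.dirichletLeft c).DEq f g := by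
  have hsub : (S.dirichletLeft c).I ⊆ S.I := fun x hx => ⟨hx.1, hx.2.trans hc.2⟩
  exact ⟨fun p hp q hq => hf.1 p (hsub hp) q (hsub hq),
    ae_mono (Measure.restrict_mono hsub le_rfl) hf.2⟩

end DEq

namespace IsSolution

variable {z w : ℂ}

theorem dEq (hf : S.IsSolution z f) : S.DEq f (fun x => z • f x) := hf

theorem wronsk (hf : S.IsSolution z f) (hg : S.IsSolution w g) :
    ADeriv S.I (fun x => wronsk (f x) (g x)) (fun x => (z - w) * dotT (f x) (g x)) :=
  (hf.dEq.wronsk hg.dEq).congr_deriv (Eventually.of_forall fun x => by simp; ring)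

theorem wronsk_const (hf : S.IsSolution z f) (hg : S.IsSolution z g) {x y : ℝ}
    (hx : x ∈ S.I) (hy : y ∈ S.I) : _root_.wronsk (f x) (g x) = _root_.wronsk (f y) (g y) :=
  ((hf.wronsk hg).congr_deriv (g' := fun _ => 0) (by simp)).eq_of_deriv_zero
    S.ordConnected_I hx hy

theorem add (hf : S.IsSolution z f) (hg : S.IsSolution z g) :
    S.IsSolution z (fun x => f x + g x) :=
  (hf.dEq.add hg.dEq).congr (fun _ _ => rfl) fun x _ => by simp

theorem sub (hf : S.IsSolution z f) (hg : S.IsSolution z g) :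
    S.IsSolution z (fun x => f x - g x) :=
  (hf.dEq.sub hg.dEq).congr (fun _ _ => rfl) fun x _ => by simp [smul_sub]

theorem smul (k : ℂ) (hf : S.IsSolution z f) : S.IsSolution z (fun x => k • f x) :=
  (hf.dEq.smul k).congr (fun _ _ => rfl) fun x _ => by rw [smul_comm]

theorem congr (hf : S.IsSolution z f) (h : ∀ x ∈ S.I, f x = g x) : S.IsSolution z g :=
  hf.dEq.congr h fun x hx => by rw [h x hx]

/-- Wronskians of solutions with the same spectral parameter are constant, so the coefficients may
be computed at any point `d`. -/
theorem eq_lin_comb {φ θ : ℝ → CC2} (hφ : S.IsSolution z φ) (hθ : S.IsSolution z θ)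
    (hW : ∀ x ∈ S.I, _root_.wronsk (θ x) (φ x) = 1) (hf : S.IsSolution z f) {d : ℝ} (hd : d ∈ S.I) :
    ∀ x ∈ S.I, f x = _root_.wronsk (θ d) (f d) • φ x - _root_.wronsk (φ d) (f d) • θ x := by
  intro x hx
  rw [hθ.wronsk_const hf hd hx, hφ.wronsk_const hf hd hx]
  exact eq_of_wronsk_eq_one (hW x hx) _

end IsSolution

/-- Variation of constants. -/
theorem DEq.of_variation {z : ℂ} {φ θ : ℝ → CC2} (hφ : S.IsSolution z φ) (hθ : S.IsSolution z θ)
    (hW : ∀ x ∈ S.I, _root_.wronsk (θ x) (φ x) = 1) {α β : ℝ → ℂ}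
    (hα : ADeriv S.I α (fun x => -dotT (θ x) (g x)))
    (hβ : ADeriv S.I β (fun x => -dotT (φ x) (g x))) :
    S.DEq (fun x => α x • φ x - β x • θ x)
      (fun x => z • (α x • φ x - β x • θ x) + g x) := by
  refine ((hφ.dEq.fsmul hα).sub (hθ.dEq.fsmul hβ)).congr (fun _ _ => rfl) fun x hx => ?_
  have h := hW x hx
  -- The terms produced by differentiating the coefficients recombine to `g` precisely because the
  -- Wronskian is one.
  have key : (-dotT (θ x) (g x)) • rot2 (φ x) + (dotT (φ x) (g x)) • rot2 (θ x) = g x := by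
    simp only [_root_.wronsk] at h
    apply CC2.ext
    · simp [dotT]; linear_combination (g x 0) * h
    · simp [dotT]; linear_combination (g x 1) * h
  nth_rewrite 3 [← key]
  simp only [smul_sub, neg_smul, smul_comm z]
  abel

end DiracData

/-! ### The `L²` seminorm and the Cauchy–Schwarz inequality -/

section l2n

variable {α E F : Type*} [MeasurableSpace α] [NormedAddCommGroup E] [NormedAddCommGroup F]
  {μ ν : Measure α} {f : α → E} {g : α → F}

/-- The `L²` seminorm as a real number. -/
def l2n (μ : Measure α) (f : α → E) : ℝ := Real.sqrt (∫ x, ‖f x‖ ^ 2 ∂μ)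

theorem l2n_nonneg : 0 ≤ l2n μ f := Real.sqrt_nonneg _

theorem l2n_sq : l2n μ f ^ 2 = ∫ x, ‖f x‖ ^ 2 ∂μ :=
  Real.sq_sqrt (integral_nonneg fun _ => by positivity)

theorem MeasureTheory.MemLp.integrable_norm_sq (hf : MemLp f 2 μ) :
    Integrable (fun x => ‖f x‖ ^ 2) μ := (memLp_two_iff_integrable_sq_norm hf.1).1 hf

theorem l2n_mono (hf : MemLp f 2 ν) (h : μ ≤ ν) : l2n μ f ≤ l2n ν f :=
  Real.sqrt_le_sqrt (integral_mono_measure h (Eventually.of_forall fun _ => by positivity)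
    hf.integrable_norm_sq)

theorem MeasureTheory.MemLp.integrable_norm_mul (hf : MemLp f 2 μ) (hg : MemLp g 2 μ) :
    Integrable (fun x => ‖f x‖ * ‖g x‖) μ := hf.norm.integrable_mul hg.norm

theorem integral_norm_mul_le (hf : MemLp f 2 μ) (hg : MemLp g 2 μ) :
    ∫ x, ‖f x‖ * ‖g x‖ ∂μ ≤ l2n μ f * l2n μ g := by
  have h := integral_mul_le_Lp_mul_Lq_of_nonneg (p := 2) (q := 2) (μ := μ) (f := fun x => ‖f x‖)
    (g := fun x => ‖g x‖) Real.HolderConjugate.two_two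
    (Eventually.of_forall fun _ => norm_nonneg _) (Eventually.of_forall fun _ => norm_nonneg _)
    (by simpa using hf.norm) (by simpa using hg.norm)
  simpa [l2n, Real.sqrt_eq_rpow] using h

end l2n

theorem integrable_dotT {μ : Measure ℝ} {f g : ℝ → CC2} (hf : MemLp f 2 μ) (hg : MemLp g 2 μ) :
    Integrable (fun x => dotT (f x) (g x)) μ := by
  refine (hf.integrable_norm_mul hg).mono' ?_ (Eventually.of_forall fun x => norm_dotT_le _ _)
  have c : ∀ {f : ℝ → CC2} (i : Fin 2), AEStronglyMeasurable f μ →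
      AEStronglyMeasurable (fun x => f x i) μ := fun i h =>
    (EuclideanSpace.proj (𝕜 := ℂ) i).continuous.comp_aestronglyMeasurable h
  exact ((c 0 hf.1).mul (c 0 hg.1)).add ((c 1 hf.1).mul (c 1 hg.1))

theorem norm_integral_dotT_le {μ : Measure ℝ} {f g : ℝ → CC2} (hf : MemLp f 2 μ)
    (hg : MemLp g 2 μ) : ‖∫ x, dotT (f x) (g x) ∂μ‖ ≤ l2n μ f * l2n μ g :=
  (norm_integral_le_integral_norm _).trans <|
    (integral_mono (integrable_dotT hf hg).norm (hf.integrable_norm_mul hg)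
      fun _ => norm_dotT_le _ _).trans (integral_norm_mul_le hf hg)

namespace DiracData

variable (S : DiracData)

/-! ### The two ends of the interval: `true` is the right end, `false` the left end -/

/-- The part of `I` between `c` and an end point. -/
def side : Bool → ℝ → Set ℝ
  | true, c => {x ∈ S.I | c < x}
  | false, c => {x ∈ S.I | x < c}

/-- The filter of points tending to an end point. -/
def endF : Bool → Filter ℝ
  | true => S.atRight
  | false => S.atLeft

/-- Square integrability near an end point. -/
def L2End (r : Bool) (f : ℝ → CC2) : Prop := ∃ c ∈ S.I, MemLp f 2 (volume.restrict (S.side r c))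

variable {S} {r : Bool} {c d x y : ℝ}

theorem side_subset : S.side r c ⊆ S.I := by
  cases r <;> exact fun x hx => hx.1

theorem measurableSet_side : MeasurableSet (S.side r c) := by
  cases r
  · exact S.measurableSet_I.inter measurableSet_Iio
  · exact S.measurableSet_I.inter measurableSet_Ioi

theorem side_subset_side (h : x ∈ S.side r c) : S.side r x ⊆ S.side r c := by
  cases r
  · exact fun y hy => ⟨hy.1, lt_trans hy.2 h.2⟩
  · exact fun y hy => ⟨hy.1, lt_trans h.2 hy.2⟩

theorem side_le_or (c d : ℝ) : S.side r c ⊆ S.side r d ∨ S.side r d ⊆ S.side r c := by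
  rcases le_total c d with h | h <;> cases r
  · exact Or.inl fun y hy => ⟨hy.1, lt_of_lt_of_le hy.2 h⟩
  · exact Or.inr fun y hy => ⟨hy.1, lt_of_le_of_lt h hy.2⟩
  · exact Or.inr fun y hy => ⟨hy.1, lt_of_lt_of_le hy.2 h⟩
  · exact Or.inl fun y hy => ⟨hy.1, lt_of_le_of_lt h hy.2⟩

theorem exists_mem_side (hc : c ∈ S.I) : ∃ x, x ∈ S.side r c := by
  cases r
  · obtain ⟨x, h1, h2⟩ := EReal.lt_iff_exists_real_btwn.1 hc.1
    exact ⟨x, ⟨h1, h2.trans hc.2⟩, EReal.coe_lt_coe_iff.1 h2⟩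
  · obtain ⟨x, h1, h2⟩ := EReal.lt_iff_exists_real_btwn.1 hc.2
    exact ⟨x, ⟨hc.1.trans h1, h2⟩, EReal.coe_lt_coe_iff.1 h1⟩

theorem eventually_side (hc : c ∈ S.I) : ∀ᶠ x in S.endF r, x ∈ S.side r c := by
  cases r
  · have : Set.Ioo S.a (c : EReal) ∈ 𝓝[>] S.a := Ioo_mem_nhdsGT hc.1
    filter_upwards [preimage_mem_comap this] with x hx
    exact ⟨⟨hx.1, hx.2.trans hc.2⟩, EReal.coe_lt_coe_iff.1 hx.2⟩
  · have : Set.Ioo (c : EReal) S.b ∈ 𝓝[<] S.b := Ioo_mem_nhdsLT hc.2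
    filter_upwards [preimage_mem_comap this] with x hx
    exact ⟨⟨hc.1.trans hx.1, hx.2⟩, EReal.coe_lt_coe_iff.1 hx.1⟩

theorem exists_side_of_eventually (hc : c ∈ S.I) {P : ℝ → Prop} (h : ∀ᶠ x in S.endF r, P x) :
    ∃ d ∈ S.side r c, ∀ x ∈ S.side r d, P x := by
  cases r
  · obtain ⟨e, he, H⟩ :=
      ((nhdsGT_basis_of_exists_gt ⟨(c : EReal), hc.1⟩).comap _).eventually_iff.1 h
    obtain ⟨d, h1, h2⟩ := EReal.lt_iff_exists_real_btwn.1 (lt_min he hc.1)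
    refine ⟨d, ⟨⟨h1, (h2.trans_le (min_le_right _ _)).trans hc.2⟩,
      EReal.coe_lt_coe_iff.1 (h2.trans_le (min_le_right _ _))⟩, fun x hx => H ⟨hx.1.1, ?_⟩⟩
    exact (EReal.coe_lt_coe_iff.2 hx.2).trans (h2.trans_le (min_le_left _ _))
  · obtain ⟨e, he, H⟩ :=
      ((nhdsLT_basis_of_exists_lt ⟨(c : EReal), hc.2⟩).comap _).eventually_iff.1 h
    obtain ⟨d, h1, h2⟩ := EReal.lt_iff_exists_real_btwn.1 (max_lt he hc.2)
    refine ⟨d, ⟨⟨hc.1.trans ((le_max_right _ _).trans_lt h1), h2⟩,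
      EReal.coe_lt_coe_iff.1 ((le_max_right _ _).trans_lt h1)⟩, fun x hx => H ⟨?_, hx.1.2⟩⟩
    exact ((le_max_left _ _).trans_lt h1).trans (EReal.coe_lt_coe_iff.2 hx.2)

theorem endF_neBot (hc : c ∈ S.I) : (S.endF r).NeBot := by
  rw [neBot_iff]
  intro h
  obtain ⟨d, hd, H⟩ := exists_side_of_eventually (r := r) hc (P := fun _ => False) (by rw [h]; simp)
  obtain ⟨x, hx⟩ := exists_mem_side (r := r) (side_subset hd)
  exact H x hx

instance endF_countable : (S.endF r).IsCountablyGenerated := by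
  cases r
  · exact inferInstanceAs (Filter.comap _ _).IsCountablyGenerated
  · exact inferInstanceAs (Filter.comap _ _).IsCountablyGenerated

/-- At the left end `uIoc c x` is `(x, c]` and contains `c`, which `side` omits, so equality holds
only up to a point. -/
theorem uIoc_inter_side (hc : c ∈ S.I) (hx : x ∈ S.side r c) :
    (Set.uIoc c x ∩ S.side r c : Set ℝ) =ᵐ[volume] Set.uIoc c x := by
  have h : ∀ᵐ y : ℝ, y ≠ c := by simp [ae_iff, measure_singleton]
  filter_upwards [h] with y hy
  refine propext ⟨fun h => h.1, fun h => ⟨h, ?_⟩⟩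
  have hI : y ∈ S.I := S.ordConnected_I.uIcc_subset hc (side_subset hx) (Set.uIoc_subset_uIcc h)
  cases r
  · rw [Set.uIoc_of_ge hx.2.le] at h
    exact ⟨hI, lt_of_le_of_ne h.2 hy⟩
  · rw [Set.uIoc_of_le hx.2.le] at h
    exact ⟨hI, h.1⟩

end DiracData

/-! ### Integrals and square integrability towards an end point -/

namespace DiracData

variable {S : DiracData} {r : Bool} {c d x y : ℝ}

theorem restrict_side_uIoc (hc : c ∈ S.I) (hx : x ∈ S.side r c) :
    (volume.restrict (S.side r c)).restrict (Set.uIoc c x) = volume.restrict (Set.uIoc c x) := by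
  rw [Measure.restrict_restrict measurableSet_uIoc]
  exact Measure.restrict_congr_set (uIoc_inter_side hc hx)

theorem aecover_side (c : ℝ) :
    AECover (volume.restrict (S.side r c)) (S.endF r) (fun x => Set.uIoc c x) := by
  refine ⟨?_, fun _ => measurableSet_uIoc⟩
  filter_upwards [ae_restrict_mem measurableSet_side] with y hy
  filter_upwards [eventually_side (r := r) (side_subset hy)] with x hx
  cases r
  · rw [Set.uIoc_of_ge (hx.2.trans hy.2).le]; exact ⟨hx.2, hy.2.le⟩
  · rw [Set.uIoc_of_le (hy.2.trans hx.2).le]; exact ⟨hy.2, hx.2.le⟩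

/-- Orientation of the end: `1` at the right end point, `-1` at the left one. -/
def sgn : Bool → ℝ
  | true => 1
  | false => -1

theorem intervalIntegral_eq_sgn {E : Type*} [NormedAddCommGroup E] [NormedSpace ℝ E] (k : ℝ → E)
    (hx : x ∈ S.side r c) : ∫ t in c..x, k t = sgn r • ∫ t in Set.uIoc c x, k t := by
  rw [intervalIntegral.intervalIntegral_eq_integral_uIoc]
  cases r
  · rw [if_neg (not_le.2 hx.2)]; rfl
  · rw [if_pos hx.2.le]; rfl

theorem tendsto_uIoc {E : Type*} [NormedAddCommGroup E] [NormedSpace ℝ E]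
    {k : ℝ → E} (hc : c ∈ S.I) (hk : IntegrableOn k (S.side r c)) :
    Tendsto (fun x => ∫ t in Set.uIoc c x, k t) (S.endF r) (𝓝 (∫ t in S.side r c, k t)) := by
  refine ((aecover_side c).integral_tendsto_of_countably_generated hk).congr' ?_
  filter_upwards [eventually_side hc] with x hx
  rw [restrict_side_uIoc hc hx]

theorem tendsto_intervalIntegral_end {E : Type*} [NormedAddCommGroup E] [NormedSpace ℝ E]
    {k : ℝ → E} (hc : c ∈ S.I) (hk : IntegrableOn k (S.side r c)) :
    Tendsto (fun x => ∫ t in c..x, k t) (S.endF r) (𝓝 (sgn r • ∫ t in S.side r c, k t)) := by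
  refine ((tendsto_uIoc hc hk).const_smul (sgn r)).congr' ?_
  filter_upwards [eventually_side hc] with x hx
  rw [intervalIntegral_eq_sgn k hx]

theorem uIoc_subset_side_ae {c x : ℝ} (hc : c ∈ S.I) (hx : x ∈ S.side r c) :
    volume.restrict (Set.uIoc c x) ≤ volume.restrict (S.side r c) := by
  rw [← restrict_side_uIoc hc hx]; exact Measure.restrict_le_self

theorem setIntegral_side_split {E : Type*} [NormedAddCommGroup E] [NormedSpace ℝ E] {k : ℝ → E}
    (hc : c ∈ S.I) (hk : IntegrableOn k (S.side r c)) (hx : x ∈ S.side r c) :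
    ∫ t in S.side r c, k t = (∫ t in Set.uIoc c x, k t) + ∫ t in S.side r x, k t := by
  have h : S.side r c =ᵐ[volume] (Set.uIoc c x ∪ S.side r x : Set ℝ) := by
    have h1 : ∀ᵐ y : ℝ, y ≠ c := by simp [ae_iff, measure_singleton]
    have h2 : ∀ᵐ y : ℝ, y ≠ x := by simp [ae_iff, measure_singleton]
    filter_upwards [h1, h2] with y hy hy'
    have hI : y ∈ Set.uIoc c x → y ∈ S.I := fun h =>
      S.ordConnected_I.uIcc_subset hc (side_subset hx) (Set.uIoc_subset_uIcc h)
    refine propext ⟨fun h => ?_, fun h => ?_⟩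
    · cases r
      · rcases lt_or_gt_of_ne hy' with h' | h'
        · exact Or.inr ⟨h.1, h'⟩
        · left; rw [Set.uIoc_of_ge hx.2.le]; exact ⟨h', h.2.le⟩
      · rcases lt_or_gt_of_ne hy' with h' | h'
        · left; rw [Set.uIoc_of_le hx.2.le]; exact ⟨h.2, h'.le⟩
        · exact Or.inr ⟨h.1, h'⟩
    · rcases h with h | h
      · have hI := hI h
        cases r
        · rw [Set.uIoc_of_ge hx.2.le] at h
          exact ⟨hI, lt_of_le_of_ne h.2 hy⟩
        · rw [Set.uIoc_of_le hx.2.le] at h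
          exact ⟨hI, h.1⟩
      · exact side_subset_side hx h
  have hd : Disjoint (Set.uIoc c x) (S.side r x) := by
    rw [Set.disjoint_left]
    intro y hy hy'
    cases r
    · rw [Set.uIoc_of_ge hx.2.le] at hy; exact lt_asymm hy.1 hy'.2
    · rw [Set.uIoc_of_le hx.2.le] at hy; exact (hy'.2.trans_le hy.2).false
  rw [setIntegral_congr_set h, setIntegral_union hd measurableSet_side]
  · exact Integrable.mono_measure hk (uIoc_subset_side_ae hc hx)
  · exact hk.mono_set (side_subset_side hx)

theorem tendsto_tail_zero {E : Type*} [NormedAddCommGroup E] [NormedSpace ℝ E]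
    {k : ℝ → E} (hc : c ∈ S.I) (hk : IntegrableOn k (S.side r c)) :
    Tendsto (fun x => ∫ t in S.side r x, k t) (S.endF r) (𝓝 0) := by
  have h := (tendsto_uIoc hc hk).const_sub (∫ t in S.side r c, k t)
  rw [sub_self] at h
  refine h.congr' ?_
  filter_upwards [eventually_side hc] with x hx
  rw [setIntegral_side_split hc hk hx]; abel

theorem tendsto_l2n_zero {E : Type*} [NormedAddCommGroup E] {f : ℝ → E} (hc : c ∈ S.I)
    (hf : MemLp f 2 (volume.restrict (S.side r c))) :
    Tendsto (fun x => l2n (volume.restrict (S.side r x)) f) (S.endF r) (𝓝 0) := by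
  have := (tendsto_tail_zero hc hf.integrable_norm_sq).sqrt
  rwa [Real.sqrt_zero] at this

theorem side_subset_union (c d : ℝ) :
    S.side r d ⊆ S.side r c ∪ Set.uIcc c d := by
  intro y hy
  cases r
  · rcases lt_or_ge y c with h | h
    · exact Or.inl ⟨hy.1, h⟩
    · exact Or.inr (Set.mem_uIcc.2 (Or.inl ⟨h, hy.2.le⟩))
  · rcases lt_or_ge c y with h | h
    · exact Or.inl ⟨hy.1, h⟩
    · exact Or.inr (Set.mem_uIcc.2 (Or.inr ⟨hy.2.le, h⟩))

theorem memLp_uIcc_of_continuousOn {f : ℝ → CC2} (hf : ContinuousOn f S.I) (hc : c ∈ S.I)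
    (hd : d ∈ S.I) : MemLp f 2 (volume.restrict (Set.uIcc c d)) := by
  have hcont := hf.mono (S.ordConnected_I.uIcc_subset hc hd)
  have hm := hcont.aestronglyMeasurable (μ := volume) measurableSet_uIcc
  rw [memLp_two_iff_integrable_sq_norm hm]
  exact (hcont.norm.pow 2).integrableOn_compact isCompact_uIcc

theorem memLp_union {f : ℝ → CC2} {s t : Set ℝ} (hs : MemLp f 2 (volume.restrict s))
    (ht : MemLp f 2 (volume.restrict t)) : MemLp f 2 (volume.restrict (s ∪ t)) := by
  have h1 : AEStronglyMeasurable f (volume.restrict (s ∪ t)) :=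
    aestronglyMeasurable_union_iff.2 ⟨hs.1, ht.1⟩
  rw [memLp_two_iff_integrable_sq_norm h1]
  exact IntegrableOn.union hs.integrable_norm_sq ht.integrable_norm_sq

/-- Continuity makes the base point of a one-sided neighbourhood immaterial. -/
theorem L2End.memLp {f : ℝ → CC2} (hf : S.L2End r f) (hcont : ContinuousOn f S.I) (hd : d ∈ S.I) :
    MemLp f 2 (volume.restrict (S.side r d)) := by
  obtain ⟨c, hc, h⟩ := hf
  exact (memLp_union h (memLp_uIcc_of_continuousOn hcont hc hd)).mono_measure
    (Measure.restrict_mono (side_subset_union c d) le_rfl)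

theorem L2End.exists_common {f g : ℝ → CC2} (hf : S.L2End r f) (hg : S.L2End r g) :
    ∃ c ∈ S.I, MemLp f 2 (volume.restrict (S.side r c)) ∧
      MemLp g 2 (volume.restrict (S.side r c)) := by
  obtain ⟨c, hc, hf⟩ := hf
  obtain ⟨d, hd, hg⟩ := hg
  rcases side_le_or (S := S) (r := r) c d with h | h
  · exact ⟨c, hc, hf, hg.mono_measure (Measure.restrict_mono h le_rfl)⟩
  · exact ⟨d, hd, hf.mono_measure (Measure.restrict_mono h le_rfl), hg⟩

theorem L2End.lin_comb {f g : ℝ → CC2} (hf : S.L2End r f) (hg : S.L2End r g) (p q : ℂ) :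
    S.L2End r (fun x => p • f x + q • g x) := by
  obtain ⟨c, hc, hf, hg⟩ := hf.exists_common hg
  exact ⟨c, hc, (hf.const_smul p).add (hg.const_smul q)⟩

theorem L2End.smul {f : ℝ → CC2} (hf : S.L2End r f) (p : ℂ) : S.L2End r (fun x => p • f x) := by
  obtain ⟨c, hc, hf⟩ := hf
  exact ⟨c, hc, hf.const_smul p⟩

theorem L2End.congr {f g : ℝ → CC2} (hf : S.L2End r f) (h : f =ᵐ[volume.restrict S.I] g) :
    S.L2End r g := by
  obtain ⟨c, hc, hf⟩ := hf
  exact ⟨c, hc, hf.ae_eq (ae_mono (Measure.restrict_mono side_subset le_rfl) h)⟩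

theorem L2End.conj2 {f : ℝ → CC2} (hf : S.L2End r f) :
    S.L2End r (fun x => conj2 (f x)) := by
  obtain ⟨c, hc, hf⟩ := hf
  refine ⟨c, hc, hf.of_le ?_ (Eventually.of_forall fun x => by simp)⟩
  exact continuous_conj2.comp_aestronglyMeasurable hf.1

/-- A self-improving `L²` bound near an end point. -/
theorem memLp_side_of_gronwall {v : ℝ → CC2} {A : ℝ → ℝ} {K B : ℝ} (hc : c ∈ S.I)
    (hv : ContinuousOn v S.I) (hA : MemLp A 2 (volume.restrict (S.side r c))) (hK : 0 ≤ K)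
    (hB : 0 ≤ B) (hAB : B * l2n (volume.restrict (S.side r c)) A ≤ 1 / 2)
    (h : ∀ x ∈ S.side r c, ‖v x‖ ≤ |A x| * (K + B * l2n (volume.restrict (Set.uIoc c x)) v)) :
    MemLp v 2 (volume.restrict (S.side r c)) := by
  have hmeas : AEStronglyMeasurable v (volume.restrict (S.side r c)) :=
    (hv.mono side_subset).aestronglyMeasurable measurableSet_side
  have hloc : ∀ x ∈ S.I, MemLp v 2 (volume.restrict (Set.uIoc c x)) := fun x hx =>
    (memLp_uIcc_of_continuousOn hv hc hx).mono_measure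
      (Measure.restrict_mono Set.uIoc_subset_uIcc le_rfl)
  set a := l2n (volume.restrict (S.side r c)) A with ha
  have ha0 : 0 ≤ a := l2n_nonneg
  -- The norm `N` of `v` on the compact piece is finite and satisfies `N ≤ a (K + B N)`; since `B a
  -- ≤ 1/2`, the last term is absorbed and the bound does not depend on `x`.
  have key : ∀ x ∈ S.side r c, l2n (volume.restrict (Set.uIoc c x)) v ≤ 2 * a * K := by
    intro x hx
    set N := l2n (volume.restrict (Set.uIoc c x)) v with hN
    have hN0 : 0 ≤ N := l2n_nonneg
    have hA' : MemLp A 2 (volume.restrict (Set.uIoc c x)) :=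
      hA.mono_measure (uIoc_subset_side_ae hc hx)
    have h1 : N ^ 2 ≤ (a * (K + B * N)) ^ 2 := by
      calc N ^ 2 = ∫ y in Set.uIoc c x, ‖v y‖ ^ 2 := l2n_sq
        _ ≤ ∫ y in Set.uIoc c x, (K + B * N) ^ 2 * ‖A y‖ ^ 2 := by
            refine integral_mono_ae (hloc x (side_subset hx)).integrable_norm_sq
              (hA'.integrable_norm_sq.const_mul _) ?_
            have h1 : ∀ᵐ y ∂volume.restrict (Set.uIoc c x), y ∈ S.side r c := by
              rw [← restrict_side_uIoc hc hx]
              exact ae_restrict_of_ae (ae_restrict_mem measurableSet_side)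
            filter_upwards [h1, ae_restrict_mem measurableSet_uIoc] with y hy hy'
            have h2 : l2n (volume.restrict (Set.uIoc c y)) v ≤ N := by
              refine l2n_mono (hloc x (side_subset hx)) (Measure.restrict_mono ?_ le_rfl)
              cases r
              · rw [Set.uIoc_of_ge hx.2.le] at hy' ⊢
                rw [Set.uIoc_of_ge hy.2.le]
                exact Set.Ioc_subset_Ioc_left hy'.1.le
              · rw [Set.uIoc_of_le hx.2.le] at hy' ⊢
                rw [Set.uIoc_of_le hy.2.le]
                exact Set.Ioc_subset_Ioc_right hy'.2
            have h3 : ‖v y‖ ≤ |A y| * (K + B * N) := (h y hy).trans (by gcongr)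
            calc ‖v y‖ ^ 2 ≤ (|A y| * (K + B * N)) ^ 2 := by gcongr
              _ = (K + B * N) ^ 2 * ‖A y‖ ^ 2 := by rw [Real.norm_eq_abs]; ring
        _ = (K + B * N) ^ 2 * ∫ y in Set.uIoc c x, ‖A y‖ ^ 2 := integral_const_mul _ _
        _ ≤ (K + B * N) ^ 2 * a ^ 2 := by
            rw [ha, l2n_sq]
            exact mul_le_mul_of_nonneg_left (integral_mono_measure (uIoc_subset_side_ae hc hx)
              (Eventually.of_forall fun _ => by positivity) hA.integrable_norm_sq) (by positivity)
        _ = (a * (K + B * N)) ^ 2 := by ring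
    have h2 : N ≤ a * (K + B * N) := abs_le_of_sq_le_sq' h1 (by positivity) |>.2
    nlinarith
  rw [memLp_two_iff_integrable_sq_norm hmeas]
  have := endF_neBot (r := r) hc
  refine (aecover_side c).integrable_of_lintegral_enorm_bounded ((2 * a * K) ^ 2)
    (hmeas.norm.pow 2) ?_
  filter_upwards [eventually_side hc] with x hx
  rw [restrict_side_uIoc hc hx, ← ofReal_integral_norm_eq_lintegral_enorm
    (hloc x (side_subset hx)).integrable_norm_sq]
  refine ENNReal.ofReal_le_ofReal ?_
  have : ∀ y, ‖‖v y‖ ^ 2‖ = ‖v y‖ ^ 2 := fun y => by simp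
  simp_rw [this]
  rw [← l2n_sq]
  have := key x hx
  have h0 : 0 ≤ l2n (volume.restrict (Set.uIoc c x)) v := l2n_nonneg
  gcongr

end DiracData

/-! ### Maximal domain, limit circle criterion and boundary Wronskians -/

namespace DiracData

variable {S : DiracData} {r : Bool} {c d x y : ℝ}

/-- `f` lies in the domain of the maximal operator near an end point, and `τ f = f'`. -/
structure InMax (S : DiracData) (r : Bool) (f f' : ℝ → CC2) : Prop where
  dEq : S.DEq f f'
  l2 : S.L2End r f
  l2' : S.L2End r f'

/-- The limit circle case at an end point. -/
def LimitCircle (S : DiracData) (r : Bool) : Prop :=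
  ∀ (z : ℂ) (f : ℝ → CC2), S.IsSolution z f → S.L2End r f

theorem IsSolution.inMax {z : ℂ} {f : ℝ → CC2} (hf : S.IsSolution z f) (h : S.L2End r f) :
    S.InMax r f (fun x => z • f x) := ⟨hf, h, h.smul z⟩

theorem InMax.conj2 {f f' : ℝ → CC2} (hf : S.InMax r f f') :
    S.InMax r (fun x => conj2 (f x)) (fun x => conj2 (f' x)) :=
  ⟨hf.dEq.conj2, hf.l2.conj2, hf.l2'.conj2⟩

theorem InMax.exists_integrableOn {f f' g g' : ℝ → CC2} (hf : S.InMax r f f')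
    (hg : S.InMax r g g') : ∃ c ∈ S.I, IntegrableOn (fun x => dotT (f' x) (g x) -
      dotT (f x) (g' x)) (S.side r c) := by
  obtain ⟨c, hc, h1, h2⟩ := hf.l2'.exists_common hg.l2'
  exact ⟨c, hc, (integrable_dotT h1 (hg.l2.memLp hg.dEq.continuousOn hc)).sub
    (integrable_dotT (hf.l2.memLp hf.dEq.continuousOn hc) h2)⟩

/-- By Lagrange's identity the derivative of the Wronskian is integrable near the end point. -/
theorem InMax.tendsto_wronsk {f f' g g' : ℝ → CC2} (hf : S.InMax r f f') (hg : S.InMax r g g') :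
    ∃ L, Tendsto (fun x => wronsk (f x) (g x)) (S.endF r) (𝓝 L) := by
  obtain ⟨c, hc, h⟩ := hf.exists_integrableOn hg
  refine ⟨_, ((tendsto_intervalIntegral_end hc h).const_add (wronsk (f c) (g c))).congr' ?_⟩
  filter_upwards [eventually_side (r := r) hc] with x hx
  rw [(hf.dEq.wronsk hg.dEq).integral_eq_sub S.isOpen_I hc (side_subset hx)]
  ring

/-- If the Wronskian of two functions in the maximal domain does not vanish at an end point, then
the end point is in the limit circle case. -/
theorem limitCircle_of_wronsk {f f' g g' : ℝ → CC2} (hf : S.InMax r f f') (hg : S.InMax r g g')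
    (h : ¬ Tendsto (fun x => wronsk (f x) (g x)) (S.endF r) (𝓝 0)) : S.LimitCircle r := by
  intro ζ v hv
  obtain ⟨L, hL⟩ := hf.tendsto_wronsk hg
  have hL0 : L ≠ 0 := fun h0 => h (h0 ▸ hL)
  obtain ⟨c, hc, hf'c, hg'c⟩ := hf.l2'.exists_common hg.l2'
  have hfc := hf.l2.memLp hf.dEq.continuousOn hc
  have hgc := hg.l2.memLp hg.dEq.continuousOn hc
  have hvc := hv.dEq.continuousOn
  set p : ℝ → CC2 := fun x => ζ • f x - f' x with hp
  set q : ℝ → CC2 := fun x => ζ • g x - g' x with hq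
  have hpc : MemLp p 2 (volume.restrict (S.side r c)) := (hfc.const_smul ζ).sub hf'c
  have hqc : MemLp q 2 (volume.restrict (S.side r c)) := (hgc.const_smul ζ).sub hg'c
  -- Near the end `|W(f,g)| > |L|/2`, and `W(f,g) v = W(v,g) f - W(v,f) g` then bounds `|v|` by `A`
  -- times a bound for the two Wronskians with `v`. Since `A` is square integrable, its norm can be
  -- made small by moving closer to the end.
  set A : ℝ → ℝ := fun x => (2 / ‖L‖) * (‖f x‖ + ‖g x‖) with hAdef
  have hAc : MemLp A 2 (volume.restrict (S.side r c)) := (hfc.norm.add hgc.norm).const_mul _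
  set B := l2n (volume.restrict (S.side r c)) p + l2n (volume.restrict (S.side r c)) q with hB
  have hB0 : 0 ≤ B := add_nonneg l2n_nonneg l2n_nonneg
  have hev1 : ∀ᶠ x in S.endF r, B * l2n (volume.restrict (S.side r x)) A < 1 / 2 := by
    have := (tendsto_l2n_zero hc hAc).const_mul B
    rw [mul_zero] at this
    exact this.eventually_lt_const (by norm_num)
  have hev2 : ∀ᶠ x in S.endF r, ‖L‖ / 2 < ‖wronsk (f x) (g x)‖ :=
    hL.norm.eventually_const_lt (by linarith [norm_pos_iff.2 hL0])
  obtain ⟨d, hd, H⟩ := exists_side_of_eventually hc (hev1.and hev2)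
  obtain ⟨e, he⟩ := exists_mem_side (r := r) (side_subset hd)
  have heI : e ∈ S.I := side_subset he
  have hec : S.side r e ⊆ S.side r c := (side_subset_side he).trans (side_subset_side hd)
  have hr := Measure.restrict_mono (μ := volume) hec le_rfl
  refine ⟨e, heI, memLp_side_of_gronwall (A := A) (B := B)
    (K := ‖wronsk (v e) (f e)‖ + ‖wronsk (v e) (g e)‖) heI hvc (hAc.mono_measure hr)
    (by positivity) hB0 (H e he).1.le fun x hx => ?_⟩
  have hxI := side_subset hx
  have hWx := (H x (side_subset_side he hx)).2
  have hvloc : MemLp v 2 (volume.restrict (Set.uIoc e x)) :=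
    (memLp_uIcc_of_continuousOn hvc heI hxI).mono_measure
      (Measure.restrict_mono Set.uIoc_subset_uIcc le_rfl)
  set N := l2n (volume.restrict (Set.uIoc e x)) v with hN
  have hN0 : 0 ≤ N := l2n_nonneg
  -- The derivative of `W(v,w)` is `vᵀ(ζ w - τ w)`, so by Cauchy–Schwarz `W(v,w)` grows at most
  -- linearly in the norm of `v` on the piece already covered.
  have bound : ∀ {w w' : ℝ → CC2}, S.DEq w w' →
      MemLp (fun x => ζ • w x - w' x) 2 (volume.restrict (S.side r c)) →
      ‖wronsk (v x) (w x)‖ ≤ ‖wronsk (v e) (w e)‖ +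
        l2n (volume.restrict (S.side r c)) (fun x => ζ • w x - w' x) * N := by
    intro w w' hw hm
    have h1 := ((hv.dEq.wronsk hw).congr_deriv
      (g' := fun x => dotT (v x) (ζ • w x - w' x))
      (Eventually.of_forall fun x => by simp)).integral_eq_sub S.isOpen_I heI hxI
    have h2 : wronsk (v x) (w x) = wronsk (v e) (w e) +
        ∫ t in e..x, dotT (v t) (ζ • w t - w' t) := by rw [h1]; ring
    have hmu : MemLp (fun x => ζ • w x - w' x) 2 (volume.restrict (Set.uIoc e x)) :=
      hm.mono_measure ((uIoc_subset_side_ae heI hx).trans hr)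
    rw [h2]
    refine (norm_add_le _ _).trans (add_le_add le_rfl ?_)
    rw [intervalIntegral.norm_intervalIntegral_eq]
    refine (norm_integral_dotT_le hvloc hmu).trans ?_
    rw [mul_comm]
    gcongr
    exact l2n_mono hm ((uIoc_subset_side_ae heI hx).trans hr)
  have bf := bound hf.dEq hpc
  have bg := bound hg.dEq hqc
  have hLpos : 0 < ‖L‖ := norm_pos_iff.2 hL0
  have hlp : 0 ≤ l2n (volume.restrict (S.side r c)) p := l2n_nonneg
  have hlq : 0 ≤ l2n (volume.restrict (S.side r c)) q := l2n_nonneg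
  set K := ‖wronsk (v e) (f e)‖ + ‖wronsk (v e) (g e)‖ with hK
  have e1 : ‖wronsk (f x) (g x)‖ * ‖v x‖ ≤ (‖f x‖ + ‖g x‖) * (K + B * N) := by
    rw [← norm_smul, wronsk_smul_eq]
    refine (norm_sub_le _ _).trans ?_
    rw [norm_smul, norm_smul, add_mul]
    have a1 : ‖wronsk (v x) (g x)‖ ≤ K + B * N := by
      refine bg.trans ?_
      rw [hK, hB]
      nlinarith [norm_nonneg (wronsk (v e) (f e)), mul_nonneg hlp hN0]
    have a2 : ‖wronsk (v x) (f x)‖ ≤ K + B * N := by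
      refine bf.trans ?_
      rw [hK, hB]
      nlinarith [norm_nonneg (wronsk (v e) (g e)), mul_nonneg hlq hN0]
    rw [mul_comm _ ‖f x‖, mul_comm _ ‖g x‖]
    gcongr
  have e2 : ‖L‖ / 2 * ‖v x‖ ≤ (‖f x‖ + ‖g x‖) * (K + B * N) :=
    (mul_le_mul_of_nonneg_right hWx.le (norm_nonneg _)).trans e1
  have e3 : |A x| = 2 / ‖L‖ * (‖f x‖ + ‖g x‖) := abs_of_nonneg (by positivity)
  rw [e3]
  calc ‖v x‖ = 2 / ‖L‖ * (‖L‖ / 2 * ‖v x‖) := by field_simp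
    _ ≤ 2 / ‖L‖ * ((‖f x‖ + ‖g x‖) * (K + B * N)) := by gcongr
    _ = _ := by ring

/-- The Wronskian of two functions in the domain vanishes at the end point. -/
theorem tendsto_wronsk_zero {f f' g g' u : ℝ → CC2} (hf : S.InMax r f f') (hg : S.InMax r g g')
    (h : S.LimitCircle r → ∃ (p p' : ℝ → CC2) (k : ℂ), S.InMax r p p' ∧ k ≠ 0 ∧
      Tendsto (fun x => wronsk (u x) (p x)) (S.endF r) (𝓝 k))
    (huf : S.LimitCircle r → Tendsto (fun x => wronsk (u x) (f x)) (S.endF r) (𝓝 0))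
    (hug : S.LimitCircle r → Tendsto (fun x => wronsk (u x) (g x)) (S.endF r) (𝓝 0)) :
    Tendsto (fun x => wronsk (f x) (g x)) (S.endF r) (𝓝 0) := by
  -- A non-zero limit forces the limit circle case, where both boundary conditions are available.
  -- With a partner `p` such that `W(u,p) → k ≠ 0`, Plücker's relation gives `W(f,g)` as a quotient
  -- whose numerator tends to zero.
  by_contra hcon
  have hlc := limitCircle_of_wronsk hf hg hcon
  obtain ⟨p, p', k, hp, hk, hup⟩ := h hlc
  obtain ⟨L1, h1⟩ := hp.tendsto_wronsk hg
  obtain ⟨L2, h2⟩ := hp.tendsto_wronsk hf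
  have h3 := ((((huf hlc).mul h1).sub ((hug hlc).mul h2))).div hup hk
  simp only [zero_mul, sub_zero, zero_div] at h3
  refine hcon (h3.congr' ?_)
  filter_upwards [hup.eventually_ne hk] with x hx
  rw [Pi.div_apply, div_eq_iff hx, mul_comm (wronsk (f x) (g x)), wronsk_pluecker (u x) (p x) (f x) (g x)]

/-- A function generating the boundary condition at an end point admits a non-degenerate partner. -/
theorem exists_partner {φ θ u : ℝ → CC2} {z : ℂ} (hφ : S.IsSolution z φ) (hθ : S.IsSolution z θ)
    (hW : ∀ x ∈ S.I, wronsk (θ x) (φ x) = 1) (hu : S.IsSolution z u) (hu0 : ∃ x ∈ S.I, u x ≠ 0)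
    (hlc : S.LimitCircle r) : ∃ (p p' : ℝ → CC2) (k : ℂ), S.InMax r p p' ∧ k ≠ 0 ∧
      Tendsto (fun x => wronsk (u x) (p x)) (S.endF r) (𝓝 k) := by
  obtain ⟨d, hd, hud⟩ := hu0
  have hex : ∃ p, S.IsSolution z p ∧ wronsk (u d) (p d) ≠ 0 := by
    by_contra hcon
    push Not at hcon
    have h1 := hcon φ hφ
    have h2 := hcon θ hθ
    apply hud
    rw [eq_of_wronsk_eq_one (hW d hd) (u d), wronsk_antisymm (θ d), wronsk_antisymm (φ d), h1, h2]
    simp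
  obtain ⟨p, hp, hne⟩ := hex
  refine ⟨p, _, _, hp.inMax (hlc _ _ hp), hne, tendsto_const_nhds.congr' ?_⟩
  filter_upwards [eventually_side (r := r) hd] with x hx
  exact hu.wronsk_const hp hd (side_subset hx)

theorem InDomLeft.inMax {f : ℝ → CC2} (hf : S.InDomLeft f) : S.InMax false f (S.tau f) :=
  ⟨⟨hf.1, Eventually.of_forall fun _ => rfl⟩, hf.2.1, hf.2.2.1⟩

theorem InDomRight.inMax {f : ℝ → CC2} (hf : S.InDomRight f) : S.InMax true f (S.tau f) :=
  ⟨⟨hf.1, Eventually.of_forall fun _ => rfl⟩, hf.2.1, hf.2.2.1⟩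

theorem IsStandard.tendsto_wronsk_left (hS : S.IsStandard) {φ θ f g : ℝ → CC2}
    (hφ : S.IsSolution 0 φ) (hθ : S.IsSolution 0 θ) (hW : ∀ x ∈ S.I, wronsk (θ x) (φ x) = 1)
    (hf : S.InDomLeft f) (hg : S.InDomLeft g) :
    Tendsto (fun x => wronsk (f x) (g x)) S.atLeft (𝓝 0) :=
  tendsto_wronsk_zero (r := false) hf.inMax hg.inMax
    (fun h => exists_partner hφ hθ hW (hS.bc_left h).1 (hS.bc_left h).2.2 h)
    (fun h => hf.2.2.2 h) (fun h => hg.2.2.2 h)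

theorem IsStandard.tendsto_wronsk_right (hS : S.IsStandard) {φ θ f g : ℝ → CC2}
    (hφ : S.IsSolution 0 φ) (hθ : S.IsSolution 0 θ) (hW : ∀ x ∈ S.I, wronsk (θ x) (φ x) = 1)
    (hf : S.InDomRight f) (hg : S.InDomRight g) :
    Tendsto (fun x => wronsk (f x) (g x)) S.atRight (𝓝 0) :=
  tendsto_wronsk_zero (r := true) hf.inMax hg.inMax
    (fun h => exists_partner hφ hθ hW (hS.bc_right h).1 (hS.bc_right h).2.2 h)
    (fun h => hf.2.2.2 h) (fun h => hg.2.2.2 h)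

end DiracData

/-! ### Holomorphic families of square integrable functions -/

/-- Cauchy's formula, with distance at least `s/2` from `z` to the circle: the kernel costs a factor
`2`, whence `2/(2π) = 1/π`. -/
theorem norm_le_integral_circleMap {h : ℂ → ℂ} (hh : Differentiable ℂ h) {z₀ z : ℂ} {s : ℝ}
    (hs : 0 < s) (hz : z ∈ Metric.closedBall z₀ (s / 2)) :
    ‖h z‖ ≤ Real.pi⁻¹ * ∫ θ in (0 : ℝ)..2 * Real.pi, ‖h (circleMap z₀ s θ)‖ := by
  have hz' : z ∈ Metric.ball z₀ s := Metric.closedBall_subset_ball (by linarith) hz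
  have h1 := Complex.two_pi_I_inv_smul_circleIntegral_sub_inv_smul_of_differentiable_on_off_countable
    Set.countable_empty hz' hh.continuous.continuousOn fun x _ => hh x
  rw [← h1, norm_smul, circleIntegral]
  have hpi := Real.pi_pos
  have hc : Continuous fun θ => ‖h (circleMap z₀ s θ)‖ :=
    (hh.continuous.comp (continuous_circleMap z₀ s)).norm
  have h2 : ‖∫ θ in (0 : ℝ)..2 * Real.pi, deriv (circleMap z₀ s) θ •
      (circleMap z₀ s θ - z)⁻¹ • h (circleMap z₀ s θ)‖ ≤
      ∫ θ in (0 : ℝ)..2 * Real.pi, 2 * ‖h (circleMap z₀ s θ)‖ := by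
    refine intervalIntegral.norm_integral_le_of_norm_le (by positivity) (Eventually.of_forall
      fun θ _ => ?_) ((hc.const_mul 2).intervalIntegrable _ _)
    rw [norm_smul, norm_smul, ← mul_assoc]
    refine mul_le_mul_of_nonneg_right ?_ (norm_nonneg _)
    have e1 : ‖deriv (circleMap z₀ s) θ‖ = s := by
      simp [deriv_circleMap, abs_of_pos hs]
    have e2 : s / 2 ≤ ‖circleMap z₀ s θ - z‖ := by
      have a1 : ‖circleMap z₀ s θ - z₀‖ = s := by simp [circleMap, abs_of_pos hs]
      have a2 : ‖z - z₀‖ ≤ s / 2 := by rwa [← dist_eq_norm]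
      have a3 := norm_sub_norm_le (circleMap z₀ s θ - z₀) (z - z₀)
      rw [sub_sub_sub_cancel_right] at a3
      linarith
    rw [e1, norm_inv, ← div_eq_mul_inv, div_le_iff₀ (by linarith)]
    linarith
  rw [intervalIntegral.integral_const_mul] at h2
  have e3 : ‖(2 * Real.pi * Complex.I : ℂ)⁻¹‖ = (2 * Real.pi)⁻¹ := by
    simp [abs_of_pos hpi]
  rw [e3]
  calc _ ≤ (2 * Real.pi)⁻¹ * (2 * ∫ θ in (0 : ℝ)..2 * Real.pi, ‖h (circleMap z₀ s θ)‖) := by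
        gcongr
    _ = _ := by field_simp

/-- The scalar bound is applied to the square of each component, itself entire. The mean on the
right is of `‖h‖²`, so it can be integrated in `x` by Tonelli. -/
theorem norm_sq_le_integral_circleMap {h : ℂ → CC2} (hh : Differentiable ℂ h) {z₀ z : ℂ} {s : ℝ}
    (hs : 0 < s) (hz : z ∈ Metric.closedBall z₀ (s / 2)) :
    ‖h z‖ ^ 2 ≤ Real.pi⁻¹ * ∫ θ in (0 : ℝ)..2 * Real.pi, ‖h (circleMap z₀ s θ)‖ ^ 2 := by
  have hd : ∀ i : Fin 2, Differentiable ℂ fun z => h z i := differentiable_piLp 2 |>.1 hh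
  have key : ∀ i : Fin 2, ‖h z i‖ ^ 2 ≤
      Real.pi⁻¹ * ∫ θ in (0 : ℝ)..2 * Real.pi, ‖h (circleMap z₀ s θ) i‖ ^ 2 := fun i => by
    have := norm_le_integral_circleMap ((hd i).pow 2) hs hz
    simpa using this
  have hi : ∀ i : Fin 2, IntervalIntegrable (fun θ => ‖h (circleMap z₀ s θ) i‖ ^ 2) volume 0
      (2 * Real.pi) := fun i =>
    ((((hd i).continuous.comp (continuous_circleMap z₀ s)).norm).pow 2).intervalIntegrable _ _
  simp_rw [CC2.norm_sq]
  rw [intervalIntegral.integral_add (hi 0) (hi 1), mul_add]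
  exact add_le_add (key 0) (key 1)

/-- A family of functions, entire in the parameter, whose `L²` norms are bounded for non-real
parameters in a disc, is dominated by a square integrable function on a smaller disc. -/
theorem exists_dominating {J : Set ℝ} (hJ : MeasurableSet J) {f : ℂ → ℝ → CC2}
    (hd : ∀ x ∈ J, Differentiable ℂ fun z => f z x) (hm : ∀ z, ContinuousOn (f z) J) (z₀ : ℝ)
    {s : ℝ} (hs : 0 < s) {C : ENNReal} (hC : C ≠ ⊤)
    (hb : ∀ z ∈ Metric.closedBall (z₀ : ℂ) s, z.im ≠ 0 → ∫⁻ x in J, ‖f z x‖ₑ ^ 2 ≤ C) :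
    ∃ D : ℝ → ℝ, MemLp D 2 (volume.restrict J) ∧
      ∀ z ∈ Metric.closedBall (z₀ : ℂ) (s / 2), ∀ x ∈ J, ‖f z x‖ ≤ D x := by
  have hpi := Real.pi_pos
  classical
  -- Extended by zero off `J`, the family is continuous in the angle and measurable in `x`, hence
  -- jointly measurable, as Tonelli requires.
  set u : ℝ → ℝ → CC2 := fun θ => J.indicator (f (circleMap z₀ s θ)) with hu
  have hum : ∀ θ, Measurable (u θ) := fun θ => by
    rw [hu]
    have := (hm (circleMap z₀ s θ)).measurable_piecewise (g := fun _ => (0 : CC2))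
      continuousOn_const hJ
    simpa only [Set.piecewise_eq_indicator] using! this
  have huc : ∀ x, Continuous fun θ => u θ x := fun x => by
    by_cases hx : x ∈ J
    · simp only [hu, Set.indicator_of_mem hx]
      exact (hd x hx).continuous.comp (continuous_circleMap _ _)
    · simp only [hu, Set.indicator_of_notMem hx]
      exact continuous_const
  have hjm : Measurable (Function.uncurry u) := measurable_uncurry_of_continuous_of_measurable huc hum
  set P : ℝ → ENNReal := fun x => ∫⁻ θ in Set.Ioc 0 (2 * Real.pi), ‖u θ x‖ₑ ^ 2 with hP
  have hjm2 : Measurable fun p : ℝ × ℝ => ‖u p.1 p.2‖ₑ ^ 2 := (hjm.enorm).pow_const 2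
  have hPm : Measurable P := by
    exact Measurable.lintegral_prod_left (μ := volume.restrict (Set.Ioc 0 (2 * Real.pi))) hjm2
  have hPint : ∀ x ∈ J, P x = ENNReal.ofReal
      (∫ θ in (0 : ℝ)..2 * Real.pi, ‖f (circleMap z₀ s θ) x‖ ^ 2) := by
    intro x hx
    have hc : Continuous fun θ => ‖f (circleMap z₀ s θ) x‖ ^ 2 :=
      (((hd x hx).continuous.comp (continuous_circleMap _ _)).norm.pow 2)
    rw [intervalIntegral.integral_of_le (by positivity), ofReal_integral_eq_lintegral_ofReal
      (hc.integrableOn_Ioc) (Eventually.of_forall fun _ => by positivity)]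
    refine lintegral_congr fun θ => ?_
    simp only [hu, Set.indicator_of_mem hx]
    rw [ENNReal.ofReal_pow (norm_nonneg _), ofReal_norm]
  -- The circle meets the real axis at countably many angles only, so a bound at non-real parameters
  -- is enough.
  have hnull : ∀ᵐ θ : ℝ, (circleMap z₀ s θ).im ≠ 0 := by
    have hcount : {θ : ℝ | Real.sin θ = 0}.Countable := by
      refine (Set.countable_range fun n : ℤ => (n : ℝ) * Real.pi).mono fun θ hθ => ?_
      obtain ⟨n, hn⟩ := Real.sin_eq_zero_iff.1 hθ
      exact ⟨n, hn⟩
    filter_upwards [hcount.ae_notMem volume] with θ hθ h0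
    apply hθ
    have : (circleMap (z₀ : ℂ) s θ).im = s * Real.sin θ := by
      simp [circleMap, Complex.exp_im]
    rw [this] at h0
    exact (mul_eq_zero.1 h0).resolve_left hs.ne'
  have htot : ∫⁻ x in J, P x ≤ ENNReal.ofReal (2 * Real.pi) * C := by
    rw [hP, lintegral_lintegral_swap]
    · calc _ ≤ ∫⁻ θ in Set.Ioc 0 (2 * Real.pi), C := by
            refine lintegral_mono_ae ?_
            filter_upwards [ae_restrict_of_ae hnull] with θ hθ
            refine le_trans (le_of_eq ?_) (hb (circleMap z₀ s θ) ?_ hθ)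
            · refine setLIntegral_congr_fun hJ fun x hx => ?_
              simp only [hu, Set.indicator_of_mem hx]
            · exact circleMap_mem_closedBall _ hs.le _
        _ = _ := by simp [mul_comm]
    · exact (hjm2.comp measurable_swap).aemeasurable
  refine ⟨fun x => Real.sqrt (Real.pi⁻¹ * (P x).toReal), ?_, fun z hz x hx => ?_⟩
  · have hDm : Measurable fun x => Real.sqrt (Real.pi⁻¹ * (P x).toReal) :=
      (hPm.ennreal_toReal.const_mul _).sqrt
    rw [memLp_two_iff_integrable_sq hDm.aestronglyMeasurable]
    have h1 : Integrable (fun x => (P x).toReal) (volume.restrict J) :=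
      integrable_toReal_of_lintegral_ne_top hPm.aemeasurable
        (htot.trans_lt (ENNReal.mul_lt_top ENNReal.ofReal_lt_top hC.lt_top)).ne
    refine (h1.const_mul Real.pi⁻¹).congr (Eventually.of_forall fun x => ?_)
    simp only
    rw [Real.sq_sqrt (by positivity)]
  · refine Real.le_sqrt_of_sq_le ?_
    rw [hPint x hx, ENNReal.toReal_ofReal]
    · exact norm_sq_le_integral_circleMap (hd x hx) hs hz
    · exact intervalIntegral.integral_nonneg (by positivity) fun _ _ => by positivity

/-- The Schwarz lemma, applied to `h` and then to its difference quotient; each application costs a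
factor `2/ρ`. -/
theorem norm_sub_sub_deriv_le {E : Type*} [NormedAddCommGroup E] [NormedSpace ℂ E]
    [CompleteSpace E] {h : ℂ → E} {z₀ z : ℂ} {ρ M : ℝ} (hd : DifferentiableOn ℂ h (Metric.ball z₀ ρ))
    (hM : ∀ w ∈ Metric.ball z₀ ρ, ‖h w‖ ≤ M) (hz : z ∈ Metric.ball z₀ ρ) :
    ‖dslope h z₀ z‖ ≤ 2 * M / ρ ∧
      ‖h z - h z₀ - (z - z₀) • deriv h z₀‖ ≤ 4 * M / ρ ^ 2 * ‖z - z₀‖ ^ 2 := by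
  have hρ : 0 < ρ := dist_nonneg.trans_lt (Metric.mem_ball.1 hz)
  have h0 : z₀ ∈ Metric.ball z₀ ρ := Metric.mem_ball_self hρ
  have maps : ∀ {k : ℂ → E} {M : ℝ}, (∀ w ∈ Metric.ball z₀ ρ, ‖k w‖ ≤ M) →
      Set.MapsTo k (Metric.ball z₀ ρ) (Metric.closedBall (k z₀) (2 * M)) := fun hk w hw => by
    rw [Metric.mem_closedBall, dist_eq_norm]
    refine (norm_sub_le _ _).trans ?_
    linarith [hk w hw, hk z₀ h0]
  have b1 : ∀ w ∈ Metric.ball z₀ ρ, ‖dslope h z₀ w‖ ≤ 2 * M / ρ := fun w hw =>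
    Complex.norm_dslope_le_div_of_mapsTo_ball hd (maps hM) hw
  have d1 : DifferentiableOn ℂ (dslope h z₀) (Metric.ball z₀ ρ) :=
    (Complex.differentiableOn_dslope (Metric.ball_mem_nhds _ hρ)).2 hd
  refine ⟨b1 z hz, ?_⟩
  have b2 := Complex.norm_dslope_le_div_of_mapsTo_ball d1 (maps b1) hz
  have e : h z - h z₀ - (z - z₀) • deriv h z₀ =
      (z - z₀) • (z - z₀) • dslope (dslope h z₀) z₀ z := by
    rw [sub_smul_dslope, smul_sub, sub_smul_dslope, dslope_same]
  rw [e, norm_smul, norm_smul]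
  calc _ ≤ ‖z - z₀‖ * (‖z - z₀‖ * (2 * (2 * M / ρ) / ρ)) := by gcongr
    _ = _ := by field_simp; ring

/-- A dominated family of square integrable functions which depends holomorphically on a
parameter pointwise is holomorphic as a function with values in `L²`. -/
theorem exists_hasDerivAt_Lp {μ : Measure ℝ} {f : ℂ → ℝ → CC2} {D : ℝ → ℝ}
    (hD : MemLp D 2 μ) {z₀ : ℂ} {s : ℝ}
    (hm : ∀ z ∈ Metric.ball z₀ s, AEStronglyMeasurable (f z) μ)
    (hd : ∀ᵐ x ∂μ, DifferentiableOn ℂ (fun z => f z x) (Metric.ball z₀ s))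
    (hb : ∀ᵐ x ∂μ, ∀ z ∈ Metric.ball z₀ s, ‖f z x‖ ≤ D x) :
    ∃ V V' : ℂ → Lp CC2 2 μ, ∀ z ∈ Metric.ball z₀ s, HasDerivAt V (V' z) z ∧ V z =ᵐ[μ] f z ∧
      V' z =ᵐ[μ] fun x => deriv (fun z => f z x) z := by
  have hmem : ∀ z ∈ Metric.ball z₀ s, MemLp (f z) 2 μ := fun z hz =>
    hD.of_le (hm z hz) (by filter_upwards [hb] with x hx using (hx z hz).trans (le_abs_self _))
  classical
  refine ⟨fun z => if h : MemLp (f z) 2 μ then h.toLp else 0,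
    fun z => if h : MemLp (fun x => deriv (fun z => f z x) z) 2 μ then h.toLp else 0,
    fun z₁ hz₁ => ?_⟩
  obtain ⟨ρ, hρ, hρs⟩ := Metric.isOpen_iff.1 Metric.isOpen_ball z₁ hz₁
  -- The derivative is a pointwise limit of difference quotients. The steps `ρ/(n+2)` keep even the
  -- first point strictly inside the ball.
  have hfm : AEStronglyMeasurable (fun x => deriv (fun z => f z x) z₁) μ := by
    have hlim : ∀ᵐ x ∂μ, Tendsto (fun n : ℕ => ((ρ / (n + 2) : ℝ) : ℂ)⁻¹ •
        (f (z₁ + ((ρ / (n + 2) : ℝ) : ℂ)) x - f z₁ x)) atTop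
        (𝓝 (deriv (fun z => f z x) z₁)) := by
      filter_upwards [hd] with x hx
      have h1 := ((hx.differentiableAt (Metric.isOpen_ball.mem_nhds hz₁)).hasDerivAt).tendsto_slope_zero
      refine h1.comp (tendsto_nhdsWithin_iff.2 ⟨?_, Eventually.of_forall fun n => ?_⟩)
      · have := (tendsto_const_div_atTop_nhds_zero_nat ρ).comp (tendsto_add_atTop_nat 2)
        have h2 := (Complex.continuous_ofReal.tendsto 0).comp this
        simpa [Function.comp_def] using! h2
      · have : (0 : ℝ) < ρ / (n + 2) := by positivity
        simp only [Set.mem_compl_iff, Set.mem_singleton_iff]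
        exact_mod_cast this.ne'
    refine aestronglyMeasurable_of_tendsto_ae atTop (fun n => ?_) hlim
    have hmem' : z₁ + ((ρ / (n + 2) : ℝ) : ℂ) ∈ Metric.ball z₁ ρ := ?_
    · exact ((hm _ (hρs hmem')).sub (hm _ hz₁)).const_smul ((ρ / (n + 2) : ℝ) : ℂ)⁻¹
    rw [Metric.mem_ball, dist_eq_norm, add_sub_cancel_left, Complex.norm_real, Real.norm_eq_abs,
      abs_of_pos (by positivity), div_lt_iff₀ (by positivity)]
    nlinarith
  have hfd : MemLp (fun x => deriv (fun z => f z x) z₁) 2 μ := by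
    refine (hD.const_mul (2 / ρ)).of_le hfm ?_
    filter_upwards [hd, hb] with x hx hbx
    have := (norm_sub_sub_deriv_le (hx.mono hρs) (fun w hw => hbx w (hρs hw))
      (Metric.mem_ball_self hρ)).1
    rw [dslope_same] at this
    refine this.trans ((le_of_eq ?_).trans (le_abs_self _))
    ring
  refine ⟨?_, by beta_reduce; rw [dif_pos (hmem z₁ hz₁)]; exact (hmem z₁ hz₁).coeFn_toLp,
    by beta_reduce; rw [dif_pos hfd]; exact hfd.coeFn_toLp⟩
  beta_reduce
  rw [dif_pos hfd, hasDerivAt_iff_isLittleO]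
  -- The second-order Taylor remainder is bounded pointwise by a constant times `|z - z₁|² D(x)`,
  -- and `D` is square integrable.
  have hO : (fun z => (if h : MemLp (f z) 2 μ then h.toLp else 0) -
      (if h : MemLp (f z₁) 2 μ then h.toLp else 0) - (z - z₁) • hfd.toLp) =O[𝓝 z₁]
      fun z => ‖z - z₁‖ ^ 2 := by
    refine Asymptotics.IsBigO.of_bound (4 / ρ ^ 2 * ‖hD.toLp D‖) ?_
    filter_upwards [Metric.ball_mem_nhds z₁ hρ] with z hz
    rw [dif_pos (hmem z (hρs hz)), dif_pos (hmem z₁ hz₁)]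
    have hle : ∀ᵐ x ∂μ, ‖((hmem z (hρs hz)).toLp - (hmem z₁ hz₁).toLp - (z - z₁) • hfd.toLp :
        Lp CC2 2 μ) x‖ ≤ (4 / ρ ^ 2 * ‖z - z₁‖ ^ 2) * ‖hD.toLp D x‖ := by
      filter_upwards [Lp.coeFn_sub ((hmem z (hρs hz)).toLp - (hmem z₁ hz₁).toLp)
        ((z - z₁) • hfd.toLp), Lp.coeFn_sub (hmem z (hρs hz)).toLp (hmem z₁ hz₁).toLp,
        Lp.coeFn_smul (z - z₁) hfd.toLp, hfd.coeFn_toLp, (hmem z (hρs hz)).coeFn_toLp,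
        (hmem z₁ hz₁).coeFn_toLp, hD.coeFn_toLp, hd, hb] with x h1 h2 h3 h4 h5 h6 h7 hx hbx
      rw [h1, Pi.sub_apply, h2, Pi.sub_apply, h3, Pi.smul_apply, h4, h5, h6, h7]
      have := (norm_sub_sub_deriv_le (hx.mono hρs) (fun w hw => hbx w (hρs hw)) hz).2
      refine this.trans ?_
      rw [Real.norm_eq_abs]
      calc _ = (4 / ρ ^ 2 * ‖z - z₁‖ ^ 2) * D x := by ring
        _ ≤ _ := by gcongr; exact le_abs_self _
    have := Lp.norm_le_mul_norm_of_ae_le_mul hle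
    refine this.trans (le_of_eq ?_)
    simp; ring
  refine hO.trans_isLittleO ?_
  have := (Asymptotics.isLittleO_pow_sub_sub z₁ (m := 2) (by norm_num)).norm_left
  simpa using this

/-- Pairing with `k` is the inner product with its conjugate, a continuous functional on `L²`, so it
may be applied to the derivative of the `L²`-valued family. -/
theorem hasDerivAt_integral_dotT {μ : Measure ℝ} {f : ℂ → ℝ → CC2} {D : ℝ → ℝ} {k : ℝ → CC2}
    (hD : MemLp D 2 μ) (hk : MemLp k 2 μ) {z₀ : ℂ} {s : ℝ}
    (hm : ∀ z ∈ Metric.ball z₀ s, AEStronglyMeasurable (f z) μ)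
    (hd : ∀ᵐ x ∂μ, DifferentiableOn ℂ (fun z => f z x) (Metric.ball z₀ s))
    (hb : ∀ᵐ x ∂μ, ∀ z ∈ Metric.ball z₀ s, ‖f z x‖ ≤ D x) {z : ℂ} (hz : z ∈ Metric.ball z₀ s) :
    MemLp (fun x => deriv (fun z => f z x) z) 2 μ ∧
    HasDerivAt (fun z => ∫ x, dotT (k x) (f z x) ∂μ)
      (∫ x, dotT (k x) (deriv (fun z => f z x) z) ∂μ) z := by
  obtain ⟨V, V', hV⟩ := exists_hasDerivAt_Lp hD hm hd hb
  have hk' : MemLp (fun x => conj2 (k x)) 2 μ :=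
    hk.of_le (continuous_conj2.comp_aestronglyMeasurable hk.1) (Eventually.of_forall fun x => by simp)
  have key : ∀ (v : Lp CC2 2 μ) (w : ℝ → CC2), v =ᵐ[μ] w →
      innerSL ℂ hk'.toLp v = ∫ x, dotT (k x) (w x) ∂μ := fun v w h => by
    rw [innerSL_apply_apply, L2.inner_def]
    refine integral_congr_ae ?_
    filter_upwards [h, hk'.coeFn_toLp] with x h1 h2
    rw [h1, h2, inner_eq_dotT, conj2_conj2]
  refine ⟨(memLp_congr_ae (hV z hz).2.2).1 (Lp.memLp _), ?_⟩
  have h1 := (innerSL ℂ hk'.toLp).hasFDerivAt.comp_hasDerivAt z (hV z hz).1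
  rw [key _ _ (hV z hz).2.2] at h1
  refine h1.congr_of_eventuallyEq ?_
  filter_upwards [Metric.isOpen_ball.mem_nhds hz] with w hw
  exact (key _ _ (hV w hw).2.1).symm

/-! ### A bound for resolvents of symmetric operators at real points -/

/-- Log-convexity makes successive ratios non-decreasing; a first ratio above `q` would force growth
faster than `qⁿ`. -/
theorem le_mul_of_logConvex {a : ℕ → ℝ} {M q : ℝ} (ha : ∀ n, 0 ≤ a n) (hq : 0 < q)
    (hconv : ∀ n, a (n + 1) ^ 2 ≤ a n * a (n + 2)) (hbd : ∀ n, a n ≤ M * q ^ n) :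
    a 1 ≤ q * a 0 := by
  by_contra hcon
  push Not at hcon
  have h1 : 0 < a 1 := (mul_nonneg hq.le (ha 0)).trans_lt hcon
  have h0 : 0 < a 0 := by
    rcases (ha 0).lt_or_eq with h | h
    · exact h
    · have := hconv 0; rw [← h] at this; nlinarith
  set ρ := a 1 / a 0 with hρ
  have hqρ : q < ρ := by rwa [hρ, lt_div_iff₀ h0]
  have hρ0 : 0 < ρ := hq.trans hqρ
  have step : ∀ n, 0 < a n ∧ ρ * a n ≤ a (n + 1) := by
    intro n
    induction n with
    | zero => exact ⟨h0, by rw [hρ]; field_simp; exact le_rfl⟩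
    | succ n ih =>
      have hp : 0 < a (n + 1) := (mul_pos hρ0 ih.1).trans_le ih.2
      refine ⟨hp, ?_⟩
      have h2 := hconv n
      have h3 : ρ * a n * a (n + 1) ≤ a n * a (n + 2) := by nlinarith [ih.2]
      have h4 : a n * (ρ * a (n + 1)) ≤ a n * a (n + 2) := by linarith
      exact le_of_mul_le_mul_left h4 ih.1
  have lower : ∀ n, a 0 * ρ ^ n ≤ a n := by
    intro n
    induction n with
    | zero => simp
    | succ n ih => calc a 0 * ρ ^ (n + 1) = ρ * (a 0 * ρ ^ n) := by ring
        _ ≤ ρ * a n := by gcongr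
        _ ≤ _ := (step n).2
  obtain ⟨n, hn⟩ := pow_unbounded_of_one_lt (M / a 0) ((one_lt_div hq).2 hqρ)
  have h5 := (lower n).trans (hbd n)
  rw [div_pow, lt_div_iff₀ (by positivity), div_mul_eq_mul_div, div_lt_iff₀ h0] at hn
  linarith

/-- A holomorphic family of solutions of `(A - z) V = g`, where `A` is a closed symmetric linear
relation, is bounded at real points by a constant that only depends on the disc. -/
theorem norm_le_of_resolvent_family {X : Type*} [NormedAddCommGroup X] [InnerProductSpace ℂ X]
    [CompleteSpace X] {Γ : Submodule ℂ (X × X)} (hcl : IsClosed (Γ : Set (X × X)))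
    (hsym : ∀ p ∈ Γ, ∀ q ∈ Γ, inner ℂ p.2 q.1 = inner ℂ p.1 q.2) {t r : ℝ} (hr : 0 < r)
    {V : ℂ → X} (hV : DifferentiableOn ℂ V (Metric.ball (t : ℂ) r)) {g : X}
    (h : ∀ z ∈ Metric.ball (t : ℂ) r, (V z, g + z • V z) ∈ Γ) : ‖V t‖ ≤ 4 / r * ‖g‖ := by
  have htb : (t : ℂ) ∈ Metric.ball (t : ℂ) r := Metric.mem_ball_self hr
  have hnhds := Metric.ball_mem_nhds (t : ℂ) hr
  -- Iterated difference quotients at `t` stand in for powers of the resolvent: they satisfy `(A -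
  -- t) W (n+1) = W n` on the whole disc, without a bounded resolvent being known.
  set W : ℕ → ℂ → X := fun n => (fun k => dslope k (t : ℂ))^[n] V with hW
  have hWs : ∀ n, W (n + 1) = dslope (W n) t := fun n => by
    simp only [hW, Function.iterate_succ_apply']
  have hWd : ∀ n, DifferentiableOn ℂ (W n) (Metric.ball (t : ℂ) r) := by
    intro n
    induction n with
    | zero => exact hV
    | succ n ih => rw [hWs]; exact (Complex.differentiableOn_dslope hnhds).2 ih
  have hclose : ∀ F : ℂ → X × X, ContinuousAt F t →
      (∀ z ∈ Metric.ball (t : ℂ) r, z ≠ t → F z ∈ Γ) → ∀ z ∈ Metric.ball (t : ℂ) r, F z ∈ Γ := by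
    intro F hF hin z hz
    by_cases hzt : z = t
    · subst hzt
      refine hcl.mem_of_tendsto (b := 𝓝[≠] (t : ℂ)) (hF.tendsto.mono_left nhdsWithin_le_nhds) ?_
      filter_upwards [self_mem_nhdsWithin, nhdsWithin_le_nhds hnhds] with w hw hw'
      exact hin w hw' hw
    · exact hin z hz hzt
  have hWc : ∀ n, ContinuousAt (W n) t := fun n =>
    ((hWd n).differentiableAt hnhds).continuousAt
  have step : ∀ n, ∀ z ∈ Metric.ball (t : ℂ) r,
      (W (n + 1) z, W n z + (t : ℂ) • W (n + 1) z) ∈ Γ := by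
    intro n
    induction n with
    | zero =>
      refine hclose _ ((hWc 1).prodMk ((hWc 0).add ((hWc 1).const_smul (t : ℂ)))) fun z hz hzt => ?_
      have h1 := Γ.smul_mem (z - t)⁻¹ (Γ.sub_mem (h z hz) (h t htb))
      have hne : z - t ≠ 0 := sub_ne_zero.2 hzt
      convert h1 using 1
      rw [hWs, dslope_of_ne _ hzt, slope_def_module]
      refine Prod.ext rfl ?_
      change W 0 z + _ = (z - t)⁻¹ • (g + z • V z - (g + (t : ℂ) • V t))
      have e : g + z • V z - (g + (t : ℂ) • V t) = (z - t) • V z + (t : ℂ) • (V z - V t) := by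
        module
      rw [e, smul_add, inv_smul_smul₀ hne, smul_comm (z - (t : ℂ))⁻¹]
      rfl
    | succ n ih =>
      refine hclose _ ((hWc (n + 2)).prodMk ((hWc (n + 1)).add ((hWc (n + 2)).const_smul (t : ℂ))))
        fun z hz hzt => ?_
      have h1 := Γ.smul_mem (z - t)⁻¹ (Γ.sub_mem (ih z hz) (ih t htb))
      convert h1 using 1
      rw [hWs (n + 1), dslope_of_ne _ hzt, slope_def_module]
      refine Prod.ext rfl ?_
      change W (n + 1) z + _ = (z - t)⁻¹ • (W n z + (t : ℂ) • W (n + 1) z -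
        (W n t + (t : ℂ) • W (n + 1) t))
      have e : W n z + (t : ℂ) • W (n + 1) z - (W n t + (t : ℂ) • W (n + 1) t) =
        (W n z - W n t) + (t : ℂ) • (W (n + 1) z - W (n + 1) t) := by module
      rw [e, smul_add, smul_comm (z - (t : ℂ))⁻¹]
      congr 1
      rw [hWs n, dslope_of_ne _ hzt, slope_def_module]
  have hhalf : Metric.ball (t : ℂ) (r / 2) ⊆ Metric.ball (t : ℂ) r :=
    Metric.ball_subset_ball (by linarith)
  obtain ⟨M, hM⟩ := (isCompact_closedBall (t : ℂ) (r / 2)).exists_bound_of_continuousOn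
    (hV.continuousOn.mono (Metric.closedBall_subset_ball (by linarith)))
  -- Each difference quotient on the disc of radius `r/2` costs `2/(r/2) = 4/r`.
  have hbd : ∀ n, ∀ z ∈ Metric.ball (t : ℂ) (r / 2), ‖W n z‖ ≤ M * (4 / r) ^ n := by
    intro n
    induction n with
    | zero => intro z hz; simpa [hW] using hM z (Metric.ball_subset_closedBall hz)
    | succ n ih =>
      intro z hz
      rw [hWs]
      refine (norm_sub_sub_deriv_le ((hWd n).mono hhalf) ih hz).1.trans (le_of_eq ?_)
      rw [pow_succ]; field_simp; ring
  -- The index is shifted so that `w 0 = g` and `w 1 = V t`; the bound sought is that of the first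
  -- ratio.
  set w : ℕ → X := fun n => Nat.casesOn n g fun k => W k t with hw
  have hwΓ : ∀ n, (w (n + 1), w n + (t : ℂ) • w (n + 1)) ∈ Γ := by
    intro n
    cases n with
    | zero => exact h t htb
    | succ n => exact step n t htb
  -- Symmetry gives `‖w (n+1)‖² = ⟨w (n+2), w n⟩`; the terms with `t` cancel because `t` is real.
  have hconv : ∀ n, ‖w (n + 1)‖ ^ 2 ≤ ‖w n‖ * ‖w (n + 2)‖ := by
    intro n
    have h1 := hsym _ (hwΓ (n + 1)) _ (hwΓ n)
    simp only [inner_add_left, inner_add_right, inner_smul_left, inner_smul_right,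
      Complex.conj_ofReal, add_left_inj] at h1
    rw [inner_self_eq_norm_sq_to_K] at h1
    have h2 := congrArg norm h1
    have h3 := norm_inner_le_norm (𝕜 := ℂ) (w (n + 2)) (w n)
    rw [← h2] at h3
    simp only [Complex.coe_algebraMap, norm_pow, Complex.norm_real, norm_norm] at h3
    linarith
  have hfin : ‖w 1‖ ≤ 4 / r * ‖w 0‖ := by
    refine le_mul_of_logConvex (a := fun n => ‖w n‖) (M := max ‖g‖ (M * (4 / r)⁻¹))
      (fun n => norm_nonneg _) (by positivity) hconv fun n => ?_
    cases n with
    | zero => simp [hw]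
    | succ n =>
      have h1 := hbd n t (Metric.mem_ball_self (by linarith))
      calc ‖w (n + 1)‖ ≤ M * (4 / r) ^ n := h1
        _ = (M * (4 / r)⁻¹) * (4 / r) ^ (n + 1) := by rw [pow_succ]; field_simp
        _ ≤ _ := by gcongr; exact le_max_right _ _
  exact hfin

/-! ### Domination of real entire solutions -/

/-- Schwarz reflection: both sides are entire up to conjugation and agree along the real sequence
`1/(n+1)`, so the identity theorem applies. -/
theorem apply_conj_of_real {F : ℂ → ℂ} (hF : Differentiable ℂ F) (hr : ∀ t : ℝ, (F t).im = 0)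
    (z : ℂ) : F (starRingEnd ℂ z) = starRingEnd ℂ (F z) := by
  set G : ℂ → ℂ := fun z => starRingEnd ℂ (F (starRingEnd ℂ z)) with hG
  have hGd : Differentiable ℂ G := fun z => by
    have := (hF (starRingEnd ℂ z)).conj_conj
    simpa [hG, Function.comp_def] using! this
  have hfr : ∃ᶠ z in 𝓝[≠] (0 : ℂ), F z = G z := by
    have hlim : Tendsto (fun n : ℕ => ((1 / (n + 1 : ℝ) : ℝ) : ℂ)) atTop (𝓝[≠] 0) := by
      refine tendsto_nhdsWithin_iff.2 ⟨?_, Eventually.of_forall fun n => ?_⟩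
      · have := (Complex.continuous_ofReal.tendsto 0).comp tendsto_one_div_add_atTop_nhds_zero_nat
        simpa [Function.comp_def] using! this
      · have : (0 : ℝ) < 1 / (n + 1) := by positivity
        simp only [Set.mem_compl_iff, Set.mem_singleton_iff]
        exact_mod_cast this.ne'
    refine hlim.frequently (Frequently.of_forall fun n => ?_)
    simp only [hG, Complex.conj_ofReal]
    exact (Complex.conj_eq_iff_im.2 (hr _)).symm
  have h := AnalyticOnNhd.eq_of_frequently_eq (z₀ := 0)
    (fun z _ => hF.analyticAt z) (fun z _ => hGd.analyticAt z) hfr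
  have := congrFun h (starRingEnd ℂ z)
  rw [this]; simp [hG]

/-- The Wronskian vanishes on the diagonal, so it is Lipschitz in the distance of the parameters.
This is what cancels the factor `z - z̄` in Green's formula. -/
theorem exists_wronsk_le {f : ℂ → CC2} (hf : Differentiable ℂ f) (z₀ : ℂ) (s : ℝ) :
    ∃ C, 0 ≤ C ∧ ∀ z ∈ Metric.closedBall z₀ s, ∀ w ∈ Metric.closedBall z₀ s,
      ‖wronsk (f z) (f w)‖ ≤ C * ‖z - w‖ := by
  obtain ⟨B, hB⟩ := (isCompact_closedBall z₀ s).exists_bound_of_continuousOn hf.continuous.continuousOn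
  have hdc : Continuous (deriv f) := (hf.contDiff (n := 1)).continuous_deriv le_rfl
  obtain ⟨L, hL⟩ := (isCompact_closedBall z₀ s).exists_bound_of_continuousOn hdc.continuousOn
  refine ⟨|B| * |L|, by positivity, fun z hz w hw => ?_⟩
  have e : wronsk (f z) (f w) = wronsk (f z) (f w - f z) := by simp
  have h1 := (convex_closedBall z₀ s).norm_image_sub_le_of_norm_deriv_le (fun x _ => hf x) hL hz hw
  rw [e, norm_sub_rev z w, mul_assoc]
  refine (norm_wronsk_le _ _).trans ?_
  gcongr
  · exact (hB z hz).trans (le_abs_self _)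
  · exact h1.trans (by gcongr; exact le_abs_self _)

namespace DiracData

variable {S : DiracData} {r : Bool} {c d : ℝ}

theorem IsRealEntireSolution.apply_conj {Φ : ℂ → ℝ → CC2} (hΦ : S.IsRealEntireSolution Φ) (z : ℂ)
    {x : ℝ} (hx : x ∈ S.I) : Φ (starRingEnd ℂ z) x = conj2 (Φ z x) :=
  CC2.ext
    (apply_conj_of_real (differentiable_piLp 2 |>.1 (hΦ.2.1 x hx) 0) (fun t => hΦ.2.2 t x hx 0) z)
    (apply_conj_of_real (differentiable_piLp 2 |>.1 (hΦ.2.1 x hx) 1) (fun t => hΦ.2.2 t x hx 1) z)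

/-- Green's formula at an end point at which the Wronskian vanishes. -/
theorem green_side {f f' g g' : ℝ → CC2} (hf : S.DEq f f') (hg : S.DEq g g') (hc : c ∈ S.I)
    (hi : IntegrableOn (fun x => dotT (f' x) (g x) - dotT (f x) (g' x)) (S.side r c))
    (h0 : Tendsto (fun x => wronsk (f x) (g x)) (S.endF r) (𝓝 0)) :
    sgn r • ∫ x in S.side r c, (dotT (f' x) (g x) - dotT (f x) (g' x)) =
      -wronsk (f c) (g c) := by
  have := endF_neBot (r := r) hc
  have h1 := tendsto_intervalIntegral_end hc hi
  have h2 : Tendsto (fun x => ∫ t in c..x, (dotT (f' t) (g t) - dotT (f t) (g' t))) (S.endF r)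
      (𝓝 (0 - wronsk (f c) (g c))) := by
    refine (h0.sub_const _).congr' ?_
    filter_upwards [eventually_side (r := r) hc] with x hx
    rw [(hf.wronsk hg).integral_eq_sub S.isOpen_I hc (side_subset hx)]
  rw [tendsto_nhds_unique h1 h2, zero_sub]

theorem integral_dotT_left {z w : ℂ} {f g : ℝ → CC2} (hf : S.IsSolution z f)
    (hg : S.IsSolution w g) (hf2 : S.L2End false f) (hg2 : S.L2End false g) (hc : c ∈ S.I)
    (h0 : Tendsto (fun x => wronsk (f x) (g x)) S.atLeft (𝓝 0)) :
    (z - w) * ∫ x in S.side false c, dotT (f x) (g x) = wronsk (f c) (g c) := by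
  have hi := (integrable_dotT (hf2.memLp hf.dEq.continuousOn hc)
    (hg2.memLp hg.dEq.continuousOn hc)).const_mul (z - w)
  have e : ∀ x, dotT (z • f x) (g x) - dotT (f x) (w • g x) = (z - w) * dotT (f x) (g x) :=
    fun x => by simp; ring
  have := green_side (r := false) hf.dEq hg.dEq hc (by simpa only [e] using! hi) h0
  simp only [e, sgn, neg_smul, one_smul, neg_inj] at this
  rw [← this, integral_const_mul]

theorem ofReal_norm_sq_eq_dotT {v w : CC2} (h : w = conj2 v) :
    ((‖v‖ ^ 2 : ℝ) : ℂ) = dotT v w := by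
  rw [h, dotT_comm, ← inner_eq_dotT, inner_self_eq_norm_sq_to_K]; simp

/-- By reflection `Φ(z̄)` is the conjugate of `Φ(z)`, so the integral in the hypothesis is `∫
|Φ(z)|²`, and dividing by `z - z̄` bounds it at non-real parameters. -/
theorem IsRealEntireSolution.exists_dominating {Φ : ℂ → ℝ → CC2} (hΦ : S.IsRealEntireSolution Φ)
    {J : Set ℝ} (hJ : MeasurableSet J) (hJI : J ⊆ S.I)
    (hJ2 : ∀ z, MemLp (Φ z) 2 (volume.restrict J)) (z₀ : ℝ) {s C : ℝ} (hs : 0 < s)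
    (hb : ∀ z ∈ Metric.closedBall (z₀ : ℂ) s, starRingEnd ℂ z ∈ Metric.closedBall (z₀ : ℂ) s →
      ‖(z - starRingEnd ℂ z) * ∫ x in J, dotT (Φ z x) (Φ (starRingEnd ℂ z) x)‖ ≤
        C * ‖z - starRingEnd ℂ z‖) :
    ∃ D : ℝ → ℝ, MemLp D 2 (volume.restrict J) ∧
      ∀ z ∈ Metric.closedBall (z₀ : ℂ) (s / 2), ∀ x ∈ J, ‖Φ z x‖ ≤ D x := by
  refine _root_.exists_dominating hJ (fun x hx => hΦ.2.1 x (hJI hx))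
    (fun z => ((hΦ.1 z).dEq.continuousOn).mono hJI) z₀ hs (C := ENNReal.ofReal C)
    ENNReal.ofReal_ne_top fun z hz hzi => ?_
  have hz' : starRingEnd ℂ z ∈ Metric.closedBall (z₀ : ℂ) s := by
    rw [Metric.mem_closedBall] at hz ⊢
    rw [← Complex.dist_conj_conj]; simpa using hz
  have hne : z - starRingEnd ℂ z ≠ 0 := by
    rw [sub_ne_zero]
    exact fun h => hzi (Complex.conj_eq_iff_im.1 h.symm)
  have h1 := hb z hz hz'
  rw [norm_mul, mul_comm, mul_le_mul_iff_left₀ (norm_pos_iff.2 hne)] at h1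
  have h2 : ((∫ x in J, ‖Φ z x‖ ^ 2 : ℝ) : ℂ) = ∫ x in J, dotT (Φ z x) (Φ (starRingEnd ℂ z) x) := by
    rw [← integral_complex_ofReal]
    refine setIntegral_congr_fun hJ fun x hx => ?_
    exact ofReal_norm_sq_eq_dotT (hΦ.apply_conj z (hJI hx))
  rw [← h2, Complex.norm_real, Real.norm_eq_abs] at h1
  calc ∫⁻ x in J, ‖Φ z x‖ₑ ^ 2 = ∫⁻ x in J, ENNReal.ofReal (‖Φ z x‖ ^ 2) := by
        refine lintegral_congr fun x => ?_
        rw [ENNReal.ofReal_pow (norm_nonneg _), ofReal_norm]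
    _ = ENNReal.ofReal (∫ x in J, ‖Φ z x‖ ^ 2) :=
        (ofReal_integral_eq_lintegral_ofReal (hJ2 z).integrable_norm_sq
          (Eventually.of_forall fun _ => by positivity)).symm
    _ ≤ _ := ENNReal.ofReal_le_ofReal ((le_abs_self _).trans h1)

/-- The boundary term at the left end vanishes, so Green's formula leaves a single Wronskian at `c`.
-/
theorem IsRealEntireSolution.exists_dominating_left {Φ : ℂ → ℝ → CC2}
    (hΦ : S.IsRealEntireSolution Φ) (hΦ2 : ∀ z, S.L2End false (Φ z))
    (hW : ∀ z w, Tendsto (fun x => wronsk (Φ z x) (Φ w x)) S.atLeft (𝓝 0)) (hc : c ∈ S.I)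
    (z₀ : ℝ) {s : ℝ} (hs : 0 < s) :
    ∃ D : ℝ → ℝ, MemLp D 2 (volume.restrict (S.side false c)) ∧
      ∀ z ∈ Metric.closedBall (z₀ : ℂ) s, ∀ x ∈ S.side false c, ‖Φ z x‖ ≤ D x := by
  obtain ⟨C, -, hC⟩ := exists_wronsk_le (hΦ.2.1 c hc) z₀ (2 * s)
  have := hΦ.exists_dominating measurableSet_side side_subset
    (fun z => (hΦ2 z).memLp (hΦ.1 z).dEq.continuousOn hc) z₀ (s := 2 * s) (C := C) (by linarith)
    fun z hz hz' => by
      rw [integral_dotT_left (hΦ.1 z) (hΦ.1 _) (hΦ2 z) (hΦ2 _) hc (hW _ _)]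
      exact hC z hz _ hz'
  rwa [mul_div_cancel_left₀ _ two_ne_zero] at this

theorem IsRealEntireSolution.exists_dominating_uIoc {Φ : ℂ → ℝ → CC2}
    (hΦ : S.IsRealEntireSolution Φ) (hc : c ∈ S.I) (hd : d ∈ S.I) (z₀ : ℝ) {s : ℝ} (hs : 0 < s) :
    ∃ D : ℝ → ℝ, MemLp D 2 (volume.restrict (Set.uIoc c d)) ∧
      ∀ z ∈ Metric.closedBall (z₀ : ℂ) s, ∀ x ∈ Set.uIoc c d, ‖Φ z x‖ ≤ D x := by
  obtain ⟨C, -, hC⟩ := exists_wronsk_le (hΦ.2.1 c hc) z₀ (2 * s)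
  obtain ⟨C', -, hC'⟩ := exists_wronsk_le (hΦ.2.1 d hd) z₀ (2 * s)
  have hsub : Set.uIoc c d ⊆ S.I :=
    Set.uIoc_subset_uIcc.trans (S.ordConnected_I.uIcc_subset hc hd)
  have := hΦ.exists_dominating measurableSet_uIoc hsub
    (fun z => (memLp_uIcc_of_continuousOn (hΦ.1 z).dEq.continuousOn hc hd).mono_measure
      (Measure.restrict_mono Set.uIoc_subset_uIcc le_rfl)) z₀ (s := 2 * s) (C := C' + C)
      (by linarith) fun z hz hz' => by
      have h1 := ((hΦ.1 z).wronsk (hΦ.1 (starRingEnd ℂ z))).integral_eq_sub S.isOpen_I hc hd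
      rw [← integral_const_mul, ← intervalIntegral.norm_intervalIntegral_eq, h1, add_mul]
      exact (norm_sub_le _ _).trans (add_le_add (hC' z hz _ hz') (hC z hz _ hz'))
  rwa [mul_div_cancel_left₀ _ two_ne_zero] at this

end DiracData

namespace DiracData

variable {S : DiracData} {r : Bool} {c d x y : ℝ}

/-! ### Green's operator -/

theorem mem_side_or (hx : x ∈ S.I) (hd : d ∈ S.I) : x ∈ S.side r d ∨ x = d ∨ d ∈ S.side r x := by
  rcases lt_trichotomy x d with h | h | h <;> cases r
  · exact Or.inl ⟨hx, h⟩
  · exact Or.inr (Or.inr ⟨hd, h⟩)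
  · exact Or.inr (Or.inl h)
  · exact Or.inr (Or.inl h)
  · exact Or.inr (Or.inr ⟨hd, h⟩)
  · exact Or.inl ⟨hx, h⟩

theorem setIntegral_side_sub {E : Type*} [NormedAddCommGroup E] [NormedSpace ℝ E] {k : ℝ → E}
    (hk : ∀ d ∈ S.I, IntegrableOn k (S.side r d)) (hd : d ∈ S.I) (hx : x ∈ S.I) :
    ∫ t in S.side r x, k t = (∫ t in S.side r d, k t) - sgn r • ∫ t in d..x, k t := by
  have hs : sgn r * sgn r = 1 := by cases r <;> simp [sgn]
  rcases mem_side_or (r := r) hx hd with h | h | h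
  · rw [setIntegral_side_split hd (hk d hd) h, intervalIntegral_eq_sgn k h, smul_smul, hs, one_smul]
    abel
  · simp [h]
  · rw [setIntegral_side_split hx (hk x hx) h, intervalIntegral.integral_symm,
      intervalIntegral_eq_sgn k h, smul_neg, smul_smul, hs, one_smul]
    abel

theorem intervalIntegrable_of_side {E : Type*} [NormedAddCommGroup E] {k : ℝ → E}
    (hk : ∀ d ∈ S.I, IntegrableOn k (S.side r d)) (hc : c ∈ S.I) (hd : d ∈ S.I) :
    IntervalIntegrable k volume c d := by
  rw [intervalIntegrable_iff]
  rcases mem_side_or (r := r) hd hc with h | h | h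
  · exact Integrable.mono_measure (hk c hc) (uIoc_subset_side_ae hc h)
  · simp [h]
  · rw [Set.uIoc_comm]
    exact Integrable.mono_measure (hk d hd) (uIoc_subset_side_ae hd h)

theorem aDeriv_side {k : ℝ → ℂ} (hk : ∀ d ∈ S.I, IntegrableOn k (S.side r d)) :
    ADeriv S.I (fun x => ∫ t in S.side r x, k t) (fun x => -((sgn r : ℝ) : ℂ) * k x) := by
  rcases S.I.eq_empty_or_nonempty with h | ⟨d, hd⟩
  · constructor
    · intro c hc; rw [h] at hc; exact hc.elim
    · rw [h]; simp
  · have h1 := (ADeriv.const (I := S.I) (∫ t in S.side r d, k t)).sub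
      ((ADeriv.integral S.isOpen_I (fun c hc e he => intervalIntegrable_of_side hk hc he) hd).const_mul
        ((sgn r : ℝ) : ℂ))
    refine h1.congr S.isOpen_I (fun x hx => ?_) fun x _ => by ring
    rw [setIntegral_side_sub hk hd hx]
    simp

theorem setIntegral_I_split {E : Type*} [NormedAddCommGroup E] [NormedSpace ℝ E] {k : ℝ → E}
    (hk : IntegrableOn k S.I) (d : ℝ) :
    ∫ t in S.I, k t = (∫ t in S.side false d, k t) + ∫ t in S.side true d, k t := by
  have h : S.I =ᵐ[volume] (S.side false d ∪ S.side true d : Set ℝ) := by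
    have h1 : ∀ᵐ y : ℝ, y ≠ d := by simp [ae_iff, measure_singleton]
    filter_upwards [h1] with y hy
    refine propext ⟨fun h => ?_, fun h => ?_⟩
    · rcases lt_or_gt_of_ne hy with h' | h'
      · exact Or.inl ⟨h, h'⟩
      · exact Or.inr ⟨h, h'⟩
    · rcases h with h | h <;> exact h.1
  have hdj : Disjoint (S.side false d) (S.side true d) :=
    Set.disjoint_left.2 fun y hy hy' => lt_asymm hy.2 hy'.2
  rw [setIntegral_congr_set h, setIntegral_union hdj measurableSet_side
    (hk.mono_set side_subset) (hk.mono_set side_subset)]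

/-- The Green operator with kernel built from two solutions. -/
def greenOp (S : DiracData) (φ χ g : ℝ → CC2) (x : ℝ) : CC2 :=
  (∫ y in S.side true x, dotT (χ y) (g y)) • φ x + (∫ y in S.side false x, dotT (φ y) (g y)) • χ x

section Green

variable {z : ℂ} {φ χ g : ℝ → CC2}

theorem greenOp_congr {g' : ℝ → CC2} (h : g =ᵐ[volume.restrict S.I] g') :
    S.greenOp φ χ g = S.greenOp φ χ g' := by
  funext x
  have : ∀ (r : Bool) (k : ℝ → CC2), ∫ y in S.side r x, dotT (k y) (g y) =
      ∫ y in S.side r x, dotT (k y) (g' y) := fun r k => by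
    refine integral_congr_ae ?_
    filter_upwards [ae_mono (Measure.restrict_mono (side_subset (S := S)) le_rfl) h] with y hy
    rw [hy]
  simp only [greenOp, this]

theorem integrableOn_dotT_side (hφ : S.IsSolution z φ) (h2 : S.L2End r φ)
    (hg : MemLp g 2 (volume.restrict S.I)) (hd : d ∈ S.I) :
    IntegrableOn (fun y => dotT (φ y) (g y)) (S.side r d) :=
  integrable_dotT (h2.memLp hφ.dEq.continuousOn hd)
    (hg.mono_measure (Measure.restrict_mono side_subset le_rfl))

/-- Variation of constants, with each coefficient integrated from the end at which the solution
under the integral is square integrable. -/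
theorem greenOp_dEq (hφ : S.IsSolution z φ) (hχ : S.IsSolution z χ)
    (hW : ∀ x ∈ S.I, wronsk (χ x) (φ x) = 1) (hφ2 : S.L2End false φ) (hχ2 : S.L2End true χ)
    (hg : MemLp g 2 (volume.restrict S.I)) :
    S.DEq (S.greenOp φ χ g) (fun x => z • S.greenOp φ χ g x + g x) := by
  have hα := (aDeriv_side (r := true) fun d hd => integrableOn_dotT_side hχ hχ2 hg hd)
  have hβ := (aDeriv_side (r := false) fun d hd => integrableOn_dotT_side hφ hφ2 hg hd).neg
  have := DEq.of_variation (g := g) hφ hχ hW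
    (hα.congr_deriv (Eventually.of_forall fun x => by simp [sgn]))
    (hβ.congr_deriv (Eventually.of_forall fun x => by simp [sgn]))
  refine this.congr (fun x _ => ?_) fun x _ => ?_ <;> simp [greenOp, sub_eq_add_neg]

theorem wronsk_eq_setIntegral_side {f : ℝ → CC2} (hφ : S.IsSolution z φ) (hφ2 : S.L2End r φ)
    (hf : S.DEq f (fun x => z • f x + g x)) (hg : MemLp g 2 (volume.restrict S.I)) (hc : c ∈ S.I)
    (h0 : Tendsto (fun x => wronsk (φ x) (f x)) (S.endF r) (𝓝 0)) :
    wronsk (φ c) (f c) = sgn r • ∫ x in S.side r c, dotT (φ x) (g x) := by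
  have e : ∀ x, dotT (z • φ x) (f x) - dotT (φ x) (z • f x + g x) = -dotT (φ x) (g x) :=
    fun x => by simp
  have hi := (integrableOn_dotT_side (r := r) hφ hφ2 hg hc).neg
  have := green_side (r := r) hφ.dEq hf hc (by simpa only [e] using! hi) h0
  simp only [e] at this
  rw [integral_neg, smul_neg, neg_inj] at this
  exact this.symm

theorem eq_greenOp {f : ℝ → CC2} (hφ : S.IsSolution z φ) (hχ : S.IsSolution z χ)
    (hW : ∀ x ∈ S.I, wronsk (χ x) (φ x) = 1) (hφ2 : S.L2End false φ) (hχ2 : S.L2End true χ)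
    (hf : S.DEq f (fun x => z • f x + g x)) (hg : MemLp g 2 (volume.restrict S.I))
    (h1 : Tendsto (fun x => wronsk (φ x) (f x)) (S.endF false) (𝓝 0))
    (h2 : Tendsto (fun x => wronsk (χ x) (f x)) (S.endF true) (𝓝 0)) (hx : x ∈ S.I) :
    f x = S.greenOp φ χ g x := by
  rw [eq_of_wronsk_eq_one (hW x hx) (f x), wronsk_eq_setIntegral_side hχ hχ2 hf hg hx h2,
    wronsk_eq_setIntegral_side hφ hφ2 hf hg hx h1]
  simp [greenOp, sgn]

theorem tendsto_setIntegral_side_opposite {k : ℝ → ℂ} (hk : IntegrableOn k S.I) (hd : d ∈ S.I) :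
    Tendsto (fun x => ∫ y in S.side (!r) x, k y) (S.endF r) (𝓝 (∫ y in S.I, k y)) := by
  have h := (tendsto_tail_zero (r := r) hd (hk.mono_set side_subset)).const_sub (∫ y in S.I, k y)
  rw [sub_zero] at h
  refine h.congr' ?_
  filter_upwards [eventually_side (r := r) hd] with x hx
  rw [setIntegral_I_split hk x]
  cases r <;> simp

end Green

end DiracData

namespace DiracData

variable {T : DiracData} {r : Bool} {c d x y : ℝ}

/-! ### Restriction to `(a, c)` with a Dirichlet condition at `c` -/

/-- A real entire fundamental system whose first member is square integrable near the left end
point, which is in the limit point case. -/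
structure LeftSystem (T : DiracData) (φ θ : ℂ → ℝ → CC2) : Prop where
  entire_left : T.IsRealEntireSolution φ
  entire : T.IsRealEntireSolution θ
  wronsk_eq : ∀ z, ∀ x ∈ T.I, wronsk (θ z x) (φ z x) = 1
  l2 : ∀ z, T.L2End false (φ z)
  limitPoint : ¬ T.LimitCircle false

theorem dirichletLeft_I (hc : c ∈ T.I) : (T.dirichletLeft c).I = T.side false c := by
  ext x
  constructor
  · rintro ⟨h1, h2⟩
    exact ⟨⟨h1, h2.trans hc.2⟩, EReal.coe_lt_coe_iff.1 h2⟩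
  · rintro ⟨h1, h2⟩
    exact ⟨h1.1, EReal.coe_lt_coe_iff.2 h2⟩

theorem dirichletLeft_I_subset (hc : c ∈ T.I) : (T.dirichletLeft c).I ⊆ T.I := by
  rw [dirichletLeft_I hc]; exact side_subset

theorem dirichletLeft_side (hc : c ∈ T.I) (hd : d ∈ (T.dirichletLeft c).I) :
    (T.dirichletLeft c).side false d = T.side false d := by
  ext x
  simp only [side, dirichletLeft_I hc]
  rw [dirichletLeft_I hc] at hd
  exact ⟨fun h => ⟨h.1.1, h.2⟩, fun h => ⟨⟨h.1, lt_trans h.2 hd.2⟩, h.2⟩⟩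

theorem dirichletLeft_nonempty (hc : c ∈ T.I) : ∃ d, d ∈ (T.dirichletLeft c).I := by
  rw [dirichletLeft_I hc]; exact exists_mem_side hc

theorem tendsto_dirichletLeft {f : ℝ → CC2} (hc : c ∈ T.I) (hf : ContinuousOn f T.I) :
    Tendsto f ((T.dirichletLeft c).endF true) (𝓝 (f c)) := by
  have h1 : (T.dirichletLeft c).endF true ≤ 𝓝 c := by
    rw [EReal.isEmbedding_coe.nhds_eq_comap]
    exact comap_mono nhdsWithin_le_nhds
  exact ((hf.continuousAt (T.isOpen_I.mem_nhds hc)).tendsto).mono_left h1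

theorem l2End_dirichletLeft_right {f : ℝ → CC2} (hc : c ∈ T.I) (hf : ContinuousOn f T.I) :
    (T.dirichletLeft c).L2End true f := by
  obtain ⟨d, hd⟩ := dirichletLeft_nonempty hc
  refine ⟨d, hd, (memLp_uIcc_of_continuousOn hf (dirichletLeft_I_subset hc hd) hc).mono_measure
    (Measure.restrict_mono (fun x hx => ?_) le_rfl)⟩
  have hx1 := hx.1
  rw [dirichletLeft_I hc] at hx1
  exact Set.mem_uIcc.2 (Or.inl ⟨hx.2.le, hx1.2.le⟩)

theorem l2End_dirichletLeft_left {f : ℝ → CC2} (hc : c ∈ T.I) :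
    (T.dirichletLeft c).L2End false f → T.L2End false f := by
  rintro ⟨d, hd, h⟩
  rw [dirichletLeft_side hc hd] at h
  exact ⟨d, dirichletLeft_I_subset hc hd, h⟩

theorem memLp_dirichletLeft {f : ℝ → CC2} (hc : c ∈ T.I) (hf : ContinuousOn f T.I)
    (h : T.L2End false f) : MemLp f 2 (volume.restrict (T.dirichletLeft c).I) := by
  rw [dirichletLeft_I hc]; exact h.memLp hf hc

theorem l2End_of_memLp {S : DiracData} {f : ℝ → CC2} (h : MemLp f 2 (volume.restrict S.I))
    (hd : d ∈ S.I) : S.L2End r f :=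
  ⟨d, hd, h.mono_measure (Measure.restrict_mono side_subset le_rfl)⟩

theorem IsSolution.dirichletLeft {z : ℂ} {f : ℝ → CC2} (hf : T.IsSolution z f) (hc : c ∈ T.I) :
    (T.dirichletLeft c).IsSolution z f := hf.dEq.dirichletLeft hc

namespace LeftSystem

variable {φ θ : ℂ → ℝ → CC2}

theorem limitPoint_dirichletLeft (h : T.LeftSystem φ θ) (hc : c ∈ T.I) :
    ¬ (T.dirichletLeft c).LimitCircle false := fun hK =>
  h.limitPoint fun z f hf => l2End_dirichletLeft_left hc (hK z f (hf.dirichletLeft hc))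

/-- The point `c` is interior to the original interval: every solution combines `φ` and `θ`, which
are continuous up to `c`. -/
theorem limitCircle_dirichletLeft (h : T.LeftSystem φ θ) (hc : c ∈ T.I) :
    (T.dirichletLeft c).LimitCircle true := by
  intro z f hf
  obtain ⟨d, hd⟩ := dirichletLeft_nonempty hc
  have hφ := h.entire_left.1 z
  have hθ := h.entire.1 z
  have e := (hφ.dirichletLeft hc).eq_lin_comb (hθ.dirichletLeft hc)
    (fun x hx => h.wronsk_eq z x (dirichletLeft_I_subset hc hx)) hf hd
  have h1 := (l2End_dirichletLeft_right hc hφ.dEq.continuousOn).lin_comb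
    (l2End_dirichletLeft_right hc hθ.dEq.continuousOn) (wronsk (θ z d) (f d)) (-wronsk (φ z d) (f d))
  refine h1.congr ?_
  filter_upwards [ae_restrict_mem (T.dirichletLeft c).measurableSet_I] with x hx
  rw [e x hx, neg_smul, sub_eq_add_neg]

theorem tendsto_wronsk_left (h : T.LeftSystem φ θ) {f f' g g' : ℝ → CC2} (hf : T.InMax false f f')
    (hg : T.InMax false g g') : Tendsto (fun x => wronsk (f x) (g x)) T.atLeft (𝓝 0) := by
  by_contra hcon
  exact h.limitPoint (limitCircle_of_wronsk hf hg hcon)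

theorem tendsto_wronsk_dirichletLeft (h : T.LeftSystem φ θ) (hc : c ∈ T.I) {f f' g g' : ℝ → CC2}
    (hf : (T.dirichletLeft c).InMax false f f') (hg : (T.dirichletLeft c).InMax false g g') :
    Tendsto (fun x => wronsk (f x) (g x)) ((T.dirichletLeft c).endF false) (𝓝 0) := by
  by_contra hcon
  exact h.limitPoint_dirichletLeft hc (limitCircle_of_wronsk hf hg hcon)

/-- The function is recovered from its Wronskians with `θ` and `φ`, which have limits, while `θ` and
`φ` are continuous at `c`. -/
theorem exists_tendsto_right (h : T.LeftSystem φ θ) (hc : c ∈ T.I) {f f' : ℝ → CC2}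
    (hf : (T.dirichletLeft c).InMax true f f') :
    ∃ v, Tendsto f ((T.dirichletLeft c).endF true) (𝓝 v) := by
  have hlc := h.limitCircle_dirichletLeft hc
  have hφ := (h.entire_left.1 0).dirichletLeft hc
  have hθ := (h.entire.1 0).dirichletLeft hc
  obtain ⟨L1, h1⟩ := (hθ.inMax (hlc _ _ hθ)).tendsto_wronsk hf
  obtain ⟨L2, h2⟩ := (hφ.inMax (hlc _ _ hφ)).tendsto_wronsk hf
  obtain ⟨d, hd⟩ := dirichletLeft_nonempty hc
  refine ⟨_, ((h1.smul (tendsto_dirichletLeft hc (h.entire_left.1 0).dEq.continuousOn)).sub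
    (h2.smul (tendsto_dirichletLeft hc (h.entire.1 0).dEq.continuousOn))).congr' ?_⟩
  filter_upwards [eventually_side (r := true) hd] with x hx
  exact (eq_of_wronsk_eq_one (h.wronsk_eq 0 x (dirichletLeft_I_subset hc (side_subset hx))) _).symm

/-- The left end is limit point and imposes nothing; at `c`, always limit circle, the condition is
that the first component tends to zero. -/
theorem mem_graph_iff (h : T.LeftSystem φ θ) (hc : c ∈ T.I)
    {p : (T.dirichletLeft c).L2 × (T.dirichletLeft c).L2} :
    p ∈ (T.dirichletLeft c).graph ↔ ∃ F G : ℝ → CC2, (T.dirichletLeft c).DEq F G ∧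
      Tendsto (fun x => F x 0) ((T.dirichletLeft c).endF true) (𝓝 0) ∧
      p.1 =ᵐ[volume.restrict (T.dirichletLeft c).I] F ∧
      p.2 =ᵐ[volume.restrict (T.dirichletLeft c).I] G := by
  have hw : ∀ v : CC2, wronsk !₂[(0 : ℂ), 1] v = -v 0 := fun v => by simp [wronsk]
  constructor
  · rintro ⟨F, h1, -, h2, h3, h4⟩
    refine ⟨F, _, ⟨h1, Eventually.of_forall fun _ => rfl⟩, ?_, h3, h4⟩
    have h5 : Tendsto (fun x => wronsk !₂[(0 : ℂ), 1] (F x)) ((T.dirichletLeft c).endF true)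
        (𝓝 0) := h2 (h.limitCircle_dirichletLeft hc)
    simp only [hw] at h5
    simpa using h5.neg
  · rintro ⟨F, G, h1, h2, h3, h4⟩
    refine ⟨F, h1.1, fun hl => absurd hl (h.limitPoint_dirichletLeft hc), fun _ => ?_, h3, ?_⟩
    · change Tendsto (fun x => wronsk !₂[(0 : ℂ), 1] (F x)) ((T.dirichletLeft c).endF true) (𝓝 0)
      simp only [hw]
      simpa using h2.neg
    · filter_upwards [h4, h1.2] with x h5 h6
      rw [h5, h6]

theorem inMax_of_ae_eq {S : DiracData} {p q : S.L2} {F G : ℝ → CC2} (hFG : S.DEq F G)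
    (h1 : p =ᵐ[volume.restrict S.I] F) (h2 : q =ᵐ[volume.restrict S.I] G) (hd : d ∈ S.I) :
    S.InMax r F G :=
  ⟨hFG, l2End_of_memLp ((memLp_congr_ae h1).1 (Lp.memLp p)) hd,
    l2End_of_memLp ((memLp_congr_ae h2).1 (Lp.memLp q)) hd⟩

/-- The graph of the restricted operator, as a linear relation. -/
def dirichletGraph (h : T.LeftSystem φ θ) (hc : c ∈ T.I) :
    Submodule ℂ ((T.dirichletLeft c).L2 × (T.dirichletLeft c).L2) where
  carrier := (T.dirichletLeft c).graph
  add_mem' := by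
    intro p q hp hq
    rw [h.mem_graph_iff hc] at hp hq ⊢
    obtain ⟨F, G, a1, a2, a3, a4⟩ := hp
    obtain ⟨F', G', b1, b2, b3, b4⟩ := hq
    refine ⟨_, _, a1.add b1, by simpa using a2.add b2, ?_, ?_⟩
    · filter_upwards [Lp.coeFn_add p.1 q.1, a3, b3] with x e1 e2 e3
      rw [Prod.fst_add, e1, Pi.add_apply, e2, e3]
    · filter_upwards [Lp.coeFn_add p.2 q.2, a4, b4] with x e1 e2 e3
      rw [Prod.snd_add, e1, Pi.add_apply, e2, e3]
  zero_mem' := by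
    rw [h.mem_graph_iff hc]
    have h0 : (T.dirichletLeft c).DEq (fun _ => 0) (fun _ => 0) := by
      have := ((h.entire.1 0).dEq.smul 0).dirichletLeft hc
      simpa using this
    exact ⟨_, _, h0, by simpa using tendsto_const_nhds, Lp.coeFn_zero _ _ _, Lp.coeFn_zero _ _ _⟩
  smul_mem' := by
    intro k p hp
    rw [h.mem_graph_iff hc] at hp ⊢
    obtain ⟨F, G, a1, a2, a3, a4⟩ := hp
    refine ⟨_, _, a1.smul k, by simpa using a2.const_mul k, ?_, ?_⟩
    · filter_upwards [Lp.coeFn_smul k p.1, a3] with x e1 e2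
      rw [Prod.smul_fst, e1, Pi.smul_apply, e2]
    · filter_upwards [Lp.coeFn_smul k p.2, a4] with x e1 e2
      rw [Prod.smul_snd, e1, Pi.smul_apply, e2]

/-- Green's formula on both sides of `d`. The left boundary term vanishes by the limit point
property, the right one because both first components tend to zero and the second components
converge. -/
theorem symmetric_graph (h : T.LeftSystem φ θ) (hc : c ∈ T.I)
    (p : (T.dirichletLeft c).L2 × (T.dirichletLeft c).L2) (hp : p ∈ (T.dirichletLeft c).graph)
    (q : (T.dirichletLeft c).L2 × (T.dirichletLeft c).L2) (hq : q ∈ (T.dirichletLeft c).graph) :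
    inner ℂ p.2 q.1 = inner ℂ p.1 q.2 := by
  obtain ⟨d, hd⟩ := dirichletLeft_nonempty hc
  obtain ⟨F, F', a1, a2, a3, a4⟩ := (h.mem_graph_iff hc).1 hp
  obtain ⟨G, G', b1, b2, b3, b4⟩ := (h.mem_graph_iff hc).1 hq
  have mF := (memLp_congr_ae a3).1 (Lp.memLp p.1)
  have mF' := (memLp_congr_ae a4).1 (Lp.memLp p.2)
  have mG := (memLp_congr_ae b3).1 (Lp.memLp q.1)
  have mG' := (memLp_congr_ae b4).1 (Lp.memLp q.2)
  have mc : ∀ {f : ℝ → CC2}, MemLp f 2 (volume.restrict (T.dirichletLeft c).I) →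
      MemLp (fun x => conj2 (f x)) 2 (volume.restrict (T.dirichletLeft c).I) := fun hf =>
    hf.of_le (continuous_conj2.comp_aestronglyMeasurable hf.1) (Eventually.of_forall fun x => by simp)
  have i1 := integrable_dotT (mc mF') mG
  have i2 := integrable_dotT (mc mF) mG'
  have i3 : IntegrableOn (fun x => dotT (conj2 (F' x)) (G x) - dotT (conj2 (F x)) (G' x))
      (T.dirichletLeft c).I := i1.sub i2
  have e1 : inner ℂ p.2 q.1 = ∫ x in (T.dirichletLeft c).I, dotT (conj2 (F' x)) (G x) := by
    rw [L2.inner_def]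
    refine integral_congr_ae ?_
    filter_upwards [a4, b3] with x h1 h2
    rw [h1, h2, inner_eq_dotT]
  have e2 : inner ℂ p.1 q.2 = ∫ x in (T.dirichletLeft c).I, dotT (conj2 (F x)) (G' x) := by
    rw [L2.inner_def]
    refine integral_congr_ae ?_
    filter_upwards [a3, b4] with x h1 h2
    rw [h1, h2, inner_eq_dotT]
  have hsp := setIntegral_I_split (S := T.dirichletLeft c)
    (k := fun x => dotT (conj2 (F' x)) (G x) - dotT (conj2 (F x)) (G' x)) i3 d
  rw [e1, e2, ← sub_eq_zero, ← integral_sub i1 i2, hsp]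
  have hFl := inMax_of_ae_eq (r := false) a1 a3 a4 hd
  have hFr := inMax_of_ae_eq (r := true) a1 a3 a4 hd
  have hGl := inMax_of_ae_eq (r := false) b1 b3 b4 hd
  have hGr := inMax_of_ae_eq (r := true) b1 b3 b4 hd
  have g1 := green_side (r := false) a1.conj2 b1 hd (i3.mono_set side_subset)
    (h.tendsto_wronsk_dirichletLeft hc hFl.conj2 hGl)
  have hWr : Tendsto (fun x => wronsk (conj2 (F x)) (G x)) ((T.dirichletLeft c).endF true)
      (𝓝 0) := by
    obtain ⟨v, hv⟩ := h.exists_tendsto_right hc hFr.conj2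
    obtain ⟨w, hw⟩ := h.exists_tendsto_right hc hGr
    have hv1 := ((EuclideanSpace.proj (𝕜 := ℂ) (1 : Fin 2)).continuous.tendsto _).comp hv
    have hw1 := ((EuclideanSpace.proj (𝕜 := ℂ) (1 : Fin 2)).continuous.tendsto _).comp hw
    have a2' := (Complex.continuous_conj.tendsto _).comp a2
    have := (a2'.mul hw1).sub (hv1.mul b2)
    simpa [wronsk, Function.comp_def] using! this
  have g2 := green_side (r := true) a1.conj2 b1 hd (i3.mono_set side_subset) hWr
  simp only [sgn, neg_smul, one_smul, neg_inj] at g1 g2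
  rw [g1, g2]; ring

end LeftSystem

end DiracData

/-! ### Continuity of `L²` pairings and an abstract resolvent criterion -/

theorem norm_Lp_eq_l2n {μ : Measure ℝ} (g : Lp CC2 2 μ) : ‖g‖ = l2n μ g := by
  rw [l2n, ← Real.sqrt_sq (norm_nonneg g)]
  congr 1
  have h1 : ((‖g‖ ^ 2 : ℝ) : ℂ) = inner ℂ g g := by rw [inner_self_eq_norm_sq_to_K]; simp
  have h2 : ((∫ x, ‖g x‖ ^ 2 ∂μ : ℝ) : ℂ) = inner ℂ g g := by
    rw [L2.inner_def]
    refine (integral_ofReal (𝕜 := ℂ)).symm.trans ?_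
    exact integral_congr_ae (Eventually.of_forall fun x => by
      simp [inner_self_eq_norm_sq_to_K])
  exact_mod_cast h1.trans h2.symm

theorem l2n_congr {μ : Measure ℝ} {f g : ℝ → CC2} (h : f =ᵐ[μ] g) : l2n μ f = l2n μ g := by
  rw [l2n, l2n, integral_congr_ae]
  filter_upwards [h] with x hx
  rw [hx]

theorem norm_setIntegral_dotT_le {J s : Set ℝ} (hs : s ⊆ J) {f : ℝ → CC2} {D : ℝ → ℝ}
    (hD : MemLp D 2 (volume.restrict s)) (hf : ∀ᵐ x ∂(volume.restrict s), ‖f x‖ ≤ D x)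
    (g : Lp CC2 2 (volume.restrict J)) :
    ‖∫ x in s, dotT (f x) (g x)‖ ≤ l2n (volume.restrict s) D * ‖g‖ := by
  have hle : volume.restrict s ≤ volume.restrict J := Measure.restrict_mono hs le_rfl
  have hg : MemLp g 2 (volume.restrict s) := (Lp.memLp g).mono_measure hle
  calc ‖∫ x in s, dotT (f x) (g x)‖ ≤ ∫ x in s, ‖D x‖ * ‖g x‖ := by
        refine norm_integral_le_of_norm_le (hD.integrable_norm_mul hg) ?_
        filter_upwards [hf] with x hx
        exact (norm_dotT_le _ _).trans (mul_le_mul_of_nonneg_right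
          (hx.trans (le_abs_self _)) (norm_nonneg _))
    _ ≤ l2n (volume.restrict s) D * l2n (volume.restrict s) g := integral_norm_mul_le hD hg
    _ ≤ _ := mul_le_mul_of_nonneg_left (by rw [norm_Lp_eq_l2n]; exact l2n_mono (Lp.memLp g) hle)
        l2n_nonneg

theorem tendsto_setIntegral_dotT {J s : Set ℝ} (hs : s ⊆ J) {f : ℝ → CC2}
    (hf : MemLp f 2 (volume.restrict s)) {g : ℕ → Lp CC2 2 (volume.restrict J)}
    {g₀ : Lp CC2 2 (volume.restrict J)} (hg : Tendsto g atTop (𝓝 g₀)) :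
    Tendsto (fun n => ∫ x in s, dotT (f x) (g n x)) atTop (𝓝 (∫ x in s, dotT (f x) (g₀ x))) := by
  have hle : volume.restrict s ≤ volume.restrict J := Measure.restrict_mono hs le_rfl
  have hi : ∀ g : Lp CC2 2 (volume.restrict J), Integrable (fun x => dotT (f x) (g x))
      (volume.restrict s) := fun g => integrable_dotT hf ((Lp.memLp g).mono_measure hle)
  rw [tendsto_iff_norm_sub_tendsto_zero] at hg ⊢
  have h0 := hg.const_mul (l2n (volume.restrict s) fun x => ‖f x‖)
  rw [mul_zero] at h0
  refine squeeze_zero (fun _ => norm_nonneg _) (fun n => ?_) h0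
  rw [← integral_sub (hi _) (hi _)]
  refine le_of_eq_of_le ?_ (norm_setIntegral_dotT_le hs hf.norm
    (Eventually.of_forall fun x => le_rfl) (g n - g₀))
  congr 1
  refine integral_congr_ae ?_
  filter_upwards [ae_mono hle (Lp.coeFn_sub (g n) g₀)] with x hx
  rw [hx, Pi.sub_apply, dotT_sub_right]

/-- Solving the resolvent equation with a uniform bound on a dense subspace suffices for the
existence of the resolvent of a closed linear relation. -/
theorem exists_resolvent {X : Type*} [NormedAddCommGroup X] [NormedSpace ℂ X] [CompleteSpace X]
    {Γ : Submodule ℂ (X × X)} (hcl : IsClosed (Γ : Set (X × X))) {z : ℂ}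
    (hinj : ∀ f, (f, z • f) ∈ Γ → f = 0) {A : Submodule ℂ X} (hA : ∀ g, g ∈ closure (A : Set X))
    {C : ℝ} (h : ∀ g ∈ A, ∃ f, (f, g + z • f) ∈ Γ ∧ ‖f‖ ≤ C * ‖g‖) :
    ∃ R : X →L[ℂ] X, ∀ f g, R g = f ↔ (f, g + z • f) ∈ Γ := by
  have huniq : ∀ {f f' g}, (f, g + z • f) ∈ Γ → (f', g + z • f') ∈ Γ → f = f' := by
    intro f f' g h1 h2
    have := Γ.sub_mem h1 h2
    rw [Prod.mk_sub_mk, add_sub_add_left_eq_sub, ← smul_sub] at this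
    exact sub_eq_zero.1 (hinj _ this)
  have hbd : ∀ {f g}, g ∈ A → (f, g + z • f) ∈ Γ → ‖f‖ ≤ C * ‖g‖ := by
    intro f g hg hf
    obtain ⟨f', h1, h2⟩ := h g hg
    rwa [huniq hf h1]
  have hall : ∀ g, ∃ f, (f, g + z • f) ∈ Γ ∧ ‖f‖ ≤ C * ‖g‖ := by
    intro g
    obtain ⟨u, huA, hu⟩ := mem_closure_iff_seq_limit.1 (hA g)
    choose v hv hvb using fun n => h (u n) (huA n)
    have hd : ∀ m n, dist (v m) (v n) ≤ C * dist (u m) (u n) := fun m n => by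
      rw [dist_eq_norm, dist_eq_norm]
      refine hbd (A.sub_mem (huA m) (huA n)) ?_
      have := Γ.sub_mem (hv m) (hv n)
      rw [Prod.mk_sub_mk] at this
      convert this using 2
      rw [smul_sub]; abel
    have hcau : CauchySeq v := by
      rw [cauchySeq_iff_tendsto_dist_atTop_0]
      have h1 := (cauchySeq_iff_tendsto_dist_atTop_0.1 hu.cauchySeq).const_mul C
      rw [mul_zero] at h1
      exact squeeze_zero (fun _ => dist_nonneg) (fun p => hd p.1 p.2) h1
    obtain ⟨f, hf⟩ := cauchySeq_tendsto_of_complete hcau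
    exact ⟨f, hcl.mem_of_tendsto (hf.prodMk_nhds (hu.add (hf.const_smul z)))
      (Eventually.of_forall hv), le_of_tendsto_of_tendsto' hf.norm (hu.norm.const_mul C) hvb⟩
  choose R hR hRb using hall
  let L : X →ₗ[ℂ] X :=
    { toFun := R
      map_add' := fun g g' => by
        refine huniq (hR _) ?_
        have := Γ.add_mem (hR g) (hR g')
        rw [Prod.mk_add_mk] at this
        convert this using 2
        rw [smul_add]; abel
      map_smul' := fun k g => by
        refine huniq (hR _) ?_
        have := Γ.smul_mem k (hR g)
        rw [Prod.smul_mk] at this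
        convert this using 2
        simp only [RingHom.id_apply]
        rw [smul_add, smul_comm]; rfl }
  refine ⟨L.mkContinuous C hRb, fun f g => ⟨?_, fun hf => huniq (hR g) hf⟩⟩
  rintro rfl
  exact hR g

/-! ### Density of the functions vanishing near the left end -/

namespace DiracData

variable {S : DiracData} {r : Bool} {c d x y : ℝ}

/-- The functions vanishing near the left end point. -/
def vanishLeft (S : DiracData) (hne : S.I.Nonempty) : Submodule ℂ S.L2 where
  carrier := {g | ∃ d ∈ S.I, ∀ᵐ x ∂(volume.restrict (S.side false d)), g x = 0}
  zero_mem' := by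
    obtain ⟨d, hd⟩ := hne
    refine ⟨d, hd, ?_⟩
    filter_upwards [ae_mono (Measure.restrict_mono (side_subset (S := S)) le_rfl)
      (Lp.coeFn_zero CC2 2 (volume.restrict S.I))] with x hx
    rw [hx]; rfl
  add_mem' := by
    rintro p q ⟨d, hd, h⟩ ⟨e, he, h'⟩
    have key : ∀ {d}, volume.restrict (S.side false d) ≤ volume.restrict S.I :=
      Measure.restrict_mono side_subset le_rfl
    rcases side_le_or (S := S) (r := false) d e with hs | hs
    · refine ⟨d, hd, ?_⟩
      filter_upwards [h, ae_mono (Measure.restrict_mono hs le_rfl) h',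
        ae_mono key (Lp.coeFn_add p q)] with x h1 h2 h3
      rw [h3, Pi.add_apply, h1, h2, add_zero]
    · refine ⟨e, he, ?_⟩
      filter_upwards [h', ae_mono (Measure.restrict_mono hs le_rfl) h,
        ae_mono key (Lp.coeFn_add p q)] with x h1 h2 h3
      rw [h3, Pi.add_apply, h1, h2, add_zero]
  smul_mem' := by
    rintro k p ⟨d, hd, h⟩
    refine ⟨d, hd, ?_⟩
    filter_upwards [h, ae_mono (Measure.restrict_mono (side_subset (S := S)) le_rfl)
      (Lp.coeFn_smul k p)] with x h1 h2
    rw [h2, Pi.smul_apply, h1, smul_zero]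

theorem mem_closure_vanishLeft (hne : S.I.Nonempty) (g : S.L2) :
    g ∈ closure (S.vanishLeft hne : Set S.L2) := by
  obtain ⟨c, hc⟩ := hne
  rw [Metric.mem_closure_iff]
  intro ε hε
  have hle : ∀ {d}, volume.restrict (S.side false d) ≤ volume.restrict S.I :=
    Measure.restrict_mono side_subset le_rfl
  obtain ⟨d, hd, hdε⟩ := exists_side_of_eventually (r := false) hc
    ((tendsto_l2n_zero hc ((Lp.memLp g).mono_measure hle)).eventually (gt_mem_nhds hε))
  obtain ⟨e, he⟩ := exists_mem_side (r := false) (side_subset hd)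
  have hm : MemLp ((S.side false e)ᶜ.indicator g) 2 (volume.restrict S.I) :=
    (Lp.memLp g).indicator measurableSet_side.compl
  refine ⟨hm.toLp, ⟨e, side_subset he, ?_⟩, ?_⟩
  · filter_upwards [ae_mono hle hm.coeFn_toLp, ae_restrict_mem measurableSet_side] with x h1 h2
    rw [h1, Set.indicator_of_notMem (by simpa using h2)]
  · rw [dist_eq_norm, norm_Lp_eq_l2n]
    have h1 : (g - hm.toLp : S.L2) =ᵐ[volume.restrict S.I] (S.side false e).indicator g := by
      filter_upwards [Lp.coeFn_sub g hm.toLp, hm.coeFn_toLp] with x h1 h2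
      rw [h1, Pi.sub_apply, h2]
      by_cases hx : x ∈ S.side false e <;> simp [hx]
    have h2 : (fun x => ‖(S.side false e).indicator g x‖ ^ 2) =
        (S.side false e).indicator fun x => ‖g x‖ ^ 2 := by
      funext x
      by_cases hx : x ∈ S.side false e <;> simp [hx]
    rw [l2n_congr h1, l2n, h2, integral_indicator measurableSet_side,
      Measure.restrict_restrict measurableSet_side, Set.inter_eq_left.2 side_subset]
    exact hdε e he

end DiracData

namespace DiracData

variable {T : DiracData} {r : Bool} {c d x y : ℝ}

namespace LeftSystem

variable {φ θ : ℂ → ℝ → CC2} {z : ℂ}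

/-! ### The resolvent of the restricted operator -/

/-- The solution satisfying the Dirichlet condition at `c`. -/
def dirichletSol (φ θ : ℂ → ℝ → CC2) (c : ℝ) (z : ℂ) (x : ℝ) : CC2 :=
  θ z x - (θ z c 0 / φ z c 0) • φ z x

theorem dirichletSol_apply (hE : φ z c 0 ≠ 0) : dirichletSol φ θ c z c 0 = 0 := by
  simp [dirichletSol, hE]

theorem isSolution_dirichletSol (h : T.LeftSystem φ θ) (c : ℝ) :
    T.IsSolution z (dirichletSol φ θ c z) :=
  (h.entire.1 z).sub ((h.entire_left.1 z).smul _)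

theorem wronsk_dirichletSol (h : T.LeftSystem φ θ) (hx : x ∈ T.I) :
    wronsk (dirichletSol φ θ c z x) (φ z x) = 1 := by
  simp [dirichletSol, h.wronsk_eq z x hx]

theorem memLp_left (h : T.LeftSystem φ θ) (hc : c ∈ T.I) (z : ℂ) :
    MemLp (φ z) 2 (volume.restrict (T.dirichletLeft c).I) :=
  memLp_dirichletLeft hc (h.entire_left.1 z).dEq.continuousOn (h.l2 z)

theorem l2End_left (h : T.LeftSystem φ θ) (hc : c ∈ T.I) (z : ℂ) :
    (T.dirichletLeft c).L2End r (φ z) := by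
  obtain ⟨d, hd⟩ := dirichletLeft_nonempty hc
  exact l2End_of_memLp (h.memLp_left hc z) hd

theorem l2End_dirichletSol (h : T.LeftSystem φ θ) (hc : c ∈ T.I) :
    (T.dirichletLeft c).L2End true (dirichletSol φ θ c z) :=
  l2End_dirichletLeft_right hc (h.isSolution_dirichletSol c).dEq.continuousOn

/-- The kernel representation of the resolvent. -/
abbrev green (T : DiracData) (φ θ : ℂ → ℝ → CC2) (c : ℝ) (z : ℂ) (g : ℝ → CC2) : ℝ → CC2 :=
  (T.dirichletLeft c).greenOp (φ z) (dirichletSol φ θ c z) g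

/-- The Wronskian with `φ` vanishes at the left end by the limit point property, and the one with
the Dirichlet solution vanishes at `c` since both first components do. -/
theorem eq_green_of_mem (h : T.LeftSystem φ θ) (hc : c ∈ T.I) (hE : φ z c 0 ≠ 0)
    {f g : (T.dirichletLeft c).L2} (hfg : (f, g + z • f) ∈ (T.dirichletLeft c).graph) :
    f =ᵐ[volume.restrict (T.dirichletLeft c).I] green T φ θ c z g := by
  obtain ⟨d, hd⟩ := dirichletLeft_nonempty hc
  obtain ⟨F, G, hFG, h0, h1, h2⟩ := (h.mem_graph_iff hc).1 hfg
  have hF : (T.dirichletLeft c).DEq F (fun x => z • F x + g x) := by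
    refine hFG.congr_right ?_
    filter_upwards [h1, h2, Lp.coeFn_add g (z • f), Lp.coeFn_smul z f] with x e1 e2 e3 e4
    rw [← e2, e3, Pi.add_apply, e4, Pi.smul_apply, e1, add_comm]
  have hφ := (h.entire_left.1 z).dirichletLeft hc
  have hχ := (h.isSolution_dirichletSol (z := z) c).dirichletLeft hc
  have hχ2 := h.l2End_dirichletSol (z := z) hc
  have hw : Tendsto (fun x => wronsk (dirichletSol φ θ c z x) (F x))
      ((T.dirichletLeft c).endF true) (𝓝 0) := by
    obtain ⟨v, hv⟩ := h.exists_tendsto_right hc (inMax_of_ae_eq (r := true) hFG h1 h2 hd)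
    have hv1 := ((EuclideanSpace.proj (𝕜 := ℂ) (1 : Fin 2)).continuous.tendsto _).comp hv
    have hw := tendsto_dirichletLeft hc (h.isSolution_dirichletSol (z := z) c).dEq.continuousOn
    have hw0 := ((EuclideanSpace.proj (𝕜 := ℂ) (0 : Fin 2)).continuous.tendsto _).comp hw
    have hw1 := ((EuclideanSpace.proj (𝕜 := ℂ) (1 : Fin 2)).continuous.tendsto _).comp hw
    have := (hw0.mul hv1).sub (hw1.mul h0)
    simpa [wronsk, Function.comp_def, dirichletSol_apply hE] using! this
  filter_upwards [h1, ae_restrict_mem (T.dirichletLeft c).measurableSet_I] with x e1 hx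
  rw [e1]
  exact eq_greenOp hφ hχ (fun x hx => h.wronsk_dirichletSol (dirichletLeft_I_subset hc hx))
    (h.l2End_left hc z) hχ2 hF (Lp.memLp g)
    (h.tendsto_wronsk_dirichletLeft hc (hφ.inMax (h.l2End_left hc z))
      (inMax_of_ae_eq (r := false) hFG h1 h2 hd)) hw hx

theorem mem_of_eq_green (h : T.LeftSystem φ θ) (hc : c ∈ T.I) (hE : φ z c 0 ≠ 0)
    {f g : (T.dirichletLeft c).L2}
    (hf : f =ᵐ[volume.restrict (T.dirichletLeft c).I] green T φ θ c z g) :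
    (f, g + z • f) ∈ (T.dirichletLeft c).graph := by
  obtain ⟨d, hd⟩ := dirichletLeft_nonempty hc
  have hφ := (h.entire_left.1 z).dirichletLeft hc
  have hχ := (h.isSolution_dirichletSol (z := z) c).dirichletLeft hc
  have hχ2 := h.l2End_dirichletSol (z := z) hc
  refine (h.mem_graph_iff hc).2 ⟨_, _, greenOp_dEq hφ hχ
    (fun x hx => h.wronsk_dirichletSol (dirichletLeft_I_subset hc hx))
    (h.l2End_left hc z) hχ2 (Lp.memLp g), ?_, hf, ?_⟩
  · have hφ0 := ((EuclideanSpace.proj (𝕜 := ℂ) (0 : Fin 2)).continuous.tendsto _).comp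
      (tendsto_dirichletLeft hc (h.entire_left.1 z).dEq.continuousOn)
    have hχ0 := ((EuclideanSpace.proj (𝕜 := ℂ) (0 : Fin 2)).continuous.tendsto _).comp
      (tendsto_dirichletLeft hc (h.isSolution_dirichletSol (z := z) c).dEq.continuousOn)
    have e1 := tendsto_tail_zero (r := true) hd
      (integrableOn_dotT_side hχ hχ2 (Lp.memLp g) hd)
    have e2 := tendsto_setIntegral_side_opposite (r := true)
      (integrable_dotT (h.memLp_left hc z) (Lp.memLp g)) hd
    have := (e1.mul hφ0).add (e2.mul hχ0)
    simpa [greenOp, Function.comp_def, dirichletSol_apply hE] using! this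
  · filter_upwards [hf, Lp.coeFn_add g (z • f), Lp.coeFn_smul z f] with x e1 e3 e4
    rw [e3, Pi.add_apply, e4, Pi.smul_apply, e1, add_comm]

theorem eq_zero_of_mem (h : T.LeftSystem φ θ) (hc : c ∈ T.I) (hE : φ z c 0 ≠ 0)
    {f : (T.dirichletLeft c).L2} (hf : (f, z • f) ∈ (T.dirichletLeft c).graph) : f = 0 := by
  have h1 := h.eq_green_of_mem hc hE (f := f) (g := 0) (by rwa [zero_add])
  rw [green, greenOp_congr (Lp.coeFn_zero CC2 2 (volume.restrict (T.dirichletLeft c).I))] at h1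
  rw [Lp.eq_zero_iff_ae_eq_zero]
  filter_upwards [h1] with x hx
  rw [hx]
  simp [greenOp]

/-! ### Eigenfunctions -/

theorem eigen_mem (h : T.LeftSystem φ θ) (hc : c ∈ T.I) (hE : φ z c 0 = 0) :
    ((h.memLp_left hc z).toLp, z • (h.memLp_left hc z).toLp) ∈ (T.dirichletLeft c).graph := by
  refine (h.mem_graph_iff hc).2 ⟨_, _, (h.entire_left.1 z).dEq.dirichletLeft hc, ?_,
    (h.memLp_left hc z).coeFn_toLp, ?_⟩
  · have := ((EuclideanSpace.proj (𝕜 := ℂ) (0 : Fin 2)).continuous.tendsto _).comp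
      (tendsto_dirichletLeft hc (h.entire_left.1 z).dEq.continuousOn)
    simpa [Function.comp_def, hE] using! this
  · filter_upwards [Lp.coeFn_smul z (h.memLp_left hc z).toLp, (h.memLp_left hc z).coeFn_toLp]
      with x e1 e2
    rw [e1, Pi.smul_apply, e2]

theorem toLp_ne_zero (h : T.LeftSystem φ θ) (hc : c ∈ T.I) (z : ℂ) :
    (h.memLp_left hc z).toLp ≠ 0 := by
  intro h0
  rw [Lp.eq_zero_iff_ae_eq_zero] at h0
  have hpos : volume (T.dirichletLeft c).I ≠ 0 :=
    ((T.dirichletLeft c).isOpen_I.measure_pos volume (dirichletLeft_nonempty hc)).ne'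
  have : (volume.restrict (T.dirichletLeft c).I) ≠ 0 := by
    rwa [Ne, Measure.restrict_eq_zero]
  have := ae_neBot.2 this
  obtain ⟨x, h1, h2, hx⟩ := (h0.and ((h.memLp_left hc z).coeFn_toLp.and
    (ae_restrict_mem (T.dirichletLeft c).measurableSet_I))).exists
  have hw := h.wronsk_eq z x (dirichletLeft_I_subset hc hx)
  rw [← h2, h1] at hw
  simp at hw

/-- A zero would make `φ z` an eigenfunction of a symmetric relation with a non-real eigenvalue. -/
theorem ne_zero_of_im (h : T.LeftSystem φ θ) (hc : c ∈ T.I) (hz : z.im ≠ 0) : φ z c 0 ≠ 0 := by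
  intro hE
  have h1 := h.symmetric_graph hc _ (h.eigen_mem hc hE) _ (h.eigen_mem hc hE)
  simp only [inner_smul_left, inner_smul_right] at h1
  have h2 := mul_right_cancel₀ (inner_self_ne_zero.2 (h.toLp_ne_zero hc z)) h1
  exact hz (Complex.conj_eq_iff_im.1 h2)

/-- The Wronskian of an eigenfunction with `φ z` is constant and tends to zero at the left end, so
only the `φ`-component remains. -/
theorem mem_span_of_mem (h : T.LeftSystem φ θ) (hc : c ∈ T.I) {f : (T.dirichletLeft c).L2}
    (hf : (f, z • f) ∈ (T.dirichletLeft c).graph) :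
    f ∈ Submodule.span ℂ {(h.memLp_left hc z).toLp} := by
  obtain ⟨d, hd⟩ := dirichletLeft_nonempty hc
  obtain ⟨F, G, hFG, -, h1, h2⟩ := (h.mem_graph_iff hc).1 hf
  have hF : (T.dirichletLeft c).IsSolution z F := by
    refine hFG.congr_right ?_
    filter_upwards [h1, h2, Lp.coeFn_smul z f] with x e1 e2 e4
    rw [← e2, e4, Pi.smul_apply, e1]
  have hφ := (h.entire_left.1 z).dirichletLeft hc
  have hθ := (h.entire.1 z).dirichletLeft hc
  have hw0 : wronsk (φ z d) (F d) = 0 := by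
    have := endF_neBot (r := false) hd
    refine tendsto_nhds_unique (tendsto_const_nhds.congr' ?_)
      (h.tendsto_wronsk_dirichletLeft hc (hφ.inMax (h.l2End_left hc z))
        (inMax_of_ae_eq (r := false) hFG h1 h2 hd))
    filter_upwards [eventually_side (r := false) hd] with x hx
    exact hφ.wronsk_const hF hd (side_subset hx)
  refine Submodule.mem_span_singleton.2 ⟨wronsk (θ z d) (F d), ?_⟩
  refine Lp.ext ?_
  filter_upwards [Lp.coeFn_smul (wronsk (θ z d) (F d)) (h.memLp_left hc z).toLp,
    (h.memLp_left hc z).coeFn_toLp, h1, ae_restrict_mem (T.dirichletLeft c).measurableSet_I]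
    with x e1 e2 e3 hx
  rw [e1, Pi.smul_apply, e2, e3, hφ.eq_lin_comb hθ
    (fun x hx => h.wronsk_eq z x (dirichletLeft_I_subset hc hx)) hF hd x hx, hw0]
  simp

/-! ### The graph is closed -/

/-- At `z = i` membership means `f = G(k - i f)` with Green's operator `G`. For fixed `x` the
right-hand side is continuous in the `L²` data, and a subsequence of the left-hand sides converges
almost everywhere. -/
theorem isClosed_graph (h : T.LeftSystem φ θ) (hc : c ∈ T.I) :
    IsClosed (h.dirichletGraph hc : Set ((T.dirichletLeft c).L2 × (T.dirichletLeft c).L2)) := by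
  have hE : φ Complex.I c 0 ≠ 0 := h.ne_zero_of_im hc (by simp)
  have key : ∀ {f k : (T.dirichletLeft c).L2}, (f, k) ∈ (T.dirichletLeft c).graph ↔
      f =ᵐ[volume.restrict (T.dirichletLeft c).I]
        green T φ θ c Complex.I (k - Complex.I • f : (T.dirichletLeft c).L2) := by
    intro f k
    have e : k = (k - Complex.I • f) + Complex.I • f := by abel
    constructor
    · intro hf
      exact h.eq_green_of_mem hc hE (by rwa [← e])
    · intro hf
      have := h.mem_of_eq_green hc hE hf
      rwa [← e] at this
  refine IsSeqClosed.isClosed fun u p hu hp => ?_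
  have hp1 := (continuous_fst.tendsto p).comp hp
  have hp2 := (continuous_snd.tendsto p).comp hp
  have hp3 := hp2.sub (hp1.const_smul Complex.I)
  obtain ⟨ns, hns, hae⟩ := (tendstoInMeasure_of_tendsto_Lp hp1).exists_seq_tendsto_ae
  change (p.1, p.2) ∈ (T.dirichletLeft c).graph
  rw [key]
  have hun : ∀ᵐ x ∂(volume.restrict (T.dirichletLeft c).I), ∀ n, (u n).1 x =
      green T φ θ c Complex.I ((u n).2 - Complex.I • (u n).1 : (T.dirichletLeft c).L2) x :=
    ae_all_iff.2 fun n => key.1 (hu n)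
  filter_upwards [hae, hun, ae_restrict_mem (T.dirichletLeft c).measurableSet_I] with x e1 e2 hx
  refine tendsto_nhds_unique e1 ?_
  have hχ := (h.isSolution_dirichletSol (z := Complex.I) c).dirichletLeft hc
  have t1 := tendsto_setIntegral_dotT (side_subset (r := true))
    ((h.l2End_dirichletSol hc).memLp hχ.dEq.continuousOn hx) (hp3.comp hns.tendsto_atTop)
  have t2 := tendsto_setIntegral_dotT (side_subset (r := false) (c := x))
    ((h.memLp_left hc Complex.I).mono_measure (Measure.restrict_mono side_subset le_rfl))
    (hp3.comp hns.tendsto_atTop)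
  refine ((t1.smul_const _).add (t2.smul_const _)).congr fun n => ?_
  simp only [Function.comp_apply]
  rw [e2]
  rfl

end LeftSystem

end DiracData

/-! ### Uniform bounds for Green's operator and the resolvent set -/

theorem MeasureTheory.MemLp.indicator_of_restrict {E : Type*} [NormedAddCommGroup E] {J s : Set ℝ}
    (hs : MeasurableSet s) (hsJ : s ⊆ J) {f : ℝ → E} (hf : MemLp f 2 (volume.restrict s)) :
    MemLp (s.indicator f) 2 (volume.restrict J) := by
  rwa [memLp_indicator_iff_restrict hs, Measure.restrict_restrict hs, Set.inter_eq_left.2 hsJ]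

namespace DiracData

variable {S T : DiracData} {r : Bool} {c d x y : ℝ}

/-- Since `g` vanishes to the left of `d`, the solution `χ` enters only to the right of `d`, where
it has a majorant. Near the left end the result is a multiple of `φ`. -/
theorem norm_greenOp_le {φ χ : ℝ → CC2} {A B : ℝ → ℝ} {g : S.L2} (hd : d ∈ S.I)
    (hA : MemLp A 2 (volume.restrict S.I)) (hφ : ∀ x ∈ S.I, ‖φ x‖ ≤ A x)
    (hB : MemLp B 2 (volume.restrict (S.side true d))) (hχ : ∀ x ∈ S.side true d, ‖χ x‖ ≤ B x)
    (hg : ∀ᵐ x ∂(volume.restrict (S.side false d)), g x = 0) (hx : x ∈ S.I) (hxd : x ≠ d) :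
    ‖S.greenOp φ χ g x‖ ≤ l2n (volume.restrict (S.side true d)) B * ‖g‖ * A x +
      l2n (volume.restrict S.I) A * ‖g‖ * (S.side true d).indicator B x := by
  have hle : ∀ {r : Bool} {d : ℝ}, volume.restrict (S.side r d) ≤ volume.restrict S.I :=
    Measure.restrict_mono side_subset le_rfl
  have hBb : ∀ᵐ x ∂(volume.restrict (S.side true d)), ‖χ x‖ ≤ B x := by
    filter_upwards [ae_restrict_mem measurableSet_side] with x hx using hχ x hx
  have bφ : ‖∫ y in S.side false x, dotT (φ y) (g y)‖ ≤ l2n (volume.restrict S.I) A * ‖g‖ := by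
    refine (norm_setIntegral_dotT_le side_subset (hA.mono_measure hle) ?_ g).trans
      (mul_le_mul_of_nonneg_right (l2n_mono hA hle) (norm_nonneg _))
    filter_upwards [ae_restrict_mem measurableSet_side] with x hx using hφ x (side_subset hx)
  rcases lt_or_gt_of_ne hxd with h | h
  · have e0 : ∫ y in S.side false x, dotT (φ y) (g y) = 0 := by
      refine integral_eq_zero_of_ae ?_
      filter_upwards [ae_mono (Measure.restrict_mono
        (side_subset_side (S := S) (r := false) (x := x) (c := d) ⟨hx, h⟩) le_rfl) hg] with y hy
      rw [hy]; simp
    have e1 : ∫ y in S.side true x, dotT (χ y) (g y) = ∫ y in S.side true d, dotT (χ y) (g y) := by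
      refine setIntegral_eq_of_subset_of_ae_sdiff_eq_zero measurableSet_side.nullMeasurableSet
        (side_subset_side ⟨hd, h⟩) ?_
      have h1 : ∀ᵐ y : ℝ, y ≠ d := by simp [ae_iff, measure_singleton]
      filter_upwards [(ae_restrict_iff' measurableSet_side).1 hg, h1] with y h2 h3 h4
      have hyI := side_subset h4.1
      rw [h2 ⟨hyI, lt_of_le_of_ne (not_lt.1 fun h5 => h4.2 ⟨hyI, h5⟩) h3⟩]
      simp
    have hn : x ∉ S.side true d := fun h' => lt_asymm h h'.2
    rw [greenOp, e0, e1, zero_smul, add_zero, Set.indicator_of_notMem hn, mul_zero, add_zero,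
      norm_smul]
    exact mul_le_mul (norm_setIntegral_dotT_le side_subset hB hBb g) (hφ x hx) (norm_nonneg _)
      (mul_nonneg l2n_nonneg (norm_nonneg _))
  · have hm : x ∈ S.side true d := ⟨hx, h⟩
    have hle' : volume.restrict (S.side true x) ≤ volume.restrict (S.side true d) :=
      Measure.restrict_mono (side_subset_side hm) le_rfl
    have bχ : ‖∫ y in S.side true x, dotT (χ y) (g y)‖ ≤
        l2n (volume.restrict (S.side true d)) B * ‖g‖ :=
      (norm_setIntegral_dotT_le side_subset (hB.mono_measure hle') (ae_mono hle' hBb) g).trans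
        (mul_le_mul_of_nonneg_right (l2n_mono hB hle') (norm_nonneg _))
    rw [greenOp, Set.indicator_of_mem hm]
    refine (norm_add_le _ _).trans (add_le_add ?_ ?_) <;> rw [norm_smul]
    · exact mul_le_mul bχ (hφ x hx) (norm_nonneg _) (mul_nonneg l2n_nonneg (norm_nonneg _))
    · exact mul_le_mul bφ (hχ x hm) (norm_nonneg _) (mul_nonneg l2n_nonneg (norm_nonneg _))

theorem exists_greenOp_bound {A B : ℝ → ℝ} {g : S.L2} (hd : d ∈ S.I)
    (hA : MemLp A 2 (volume.restrict S.I)) (hB : MemLp B 2 (volume.restrict (S.side true d)))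
    (hg : ∀ᵐ x ∂(volume.restrict (S.side false d)), g x = 0) :
    ∃ D : ℝ → ℝ, MemLp D 2 (volume.restrict S.I) ∧ ∀ᵐ x ∂(volume.restrict S.I), ∀ φ χ : ℝ → CC2,
      (∀ x ∈ S.I, ‖φ x‖ ≤ A x) → (∀ x ∈ S.side true d, ‖χ x‖ ≤ B x) →
      ‖S.greenOp φ χ g x‖ ≤ D x := by
  refine ⟨_, (hA.const_mul (l2n (volume.restrict (S.side true d)) B * ‖g‖)).add
    ((hB.indicator_of_restrict measurableSet_side side_subset).const_mul
      (l2n (volume.restrict S.I) A * ‖g‖)), ?_⟩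
  filter_upwards [ae_restrict_mem S.measurableSet_I,
    ae_restrict_of_ae (show ∀ᵐ y : ℝ, y ≠ d by simp [ae_iff, measure_singleton])] with x hx hxd
    φ χ hφ hχ
  exact norm_greenOp_le hd hA hφ hB hχ hg hx hxd

namespace LeftSystem

variable {φ θ : ℂ → ℝ → CC2} {z : ℂ}

theorem continuousOn_green (h : T.LeftSystem φ θ) (hc : c ∈ T.I) (z : ℂ)
    (g : (T.dirichletLeft c).L2) :
    ContinuousOn (green T φ θ c z g) (T.dirichletLeft c).I :=
  (greenOp_dEq ((h.entire_left.1 z).dirichletLeft hc)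
    ((h.isSolution_dirichletSol (z := z) c).dirichletLeft hc)
    (fun _ hx => h.wronsk_dirichletSol (dirichletLeft_I_subset hc hx))
    (h.l2End_left hc z) (h.l2End_dirichletSol hc) (Lp.memLp g)).continuousOn

/-- Green's operator supplies `f`; the bound is the usual one from the imaginary part of the pairing
of `(H - z) f` with `f`. -/
theorem exists_mem_of_im (h : T.LeftSystem φ θ) (hc : c ∈ T.I) (hz : z.im ≠ 0)
    {g : (T.dirichletLeft c).L2}
    (hg : g ∈ (T.dirichletLeft c).vanishLeft (dirichletLeft_nonempty hc)) :
    ∃ f, (f, g + z • f) ∈ h.dirichletGraph hc ∧ ‖f‖ ≤ |z.im|⁻¹ * ‖g‖ := by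
  obtain ⟨d, hd, hg⟩ := hg
  have hA := (h.memLp_left hc z).norm
  have hB := ((h.l2End_dirichletSol (z := z) hc).memLp
    ((h.isSolution_dirichletSol (z := z) c).dirichletLeft hc).dEq.continuousOn hd).norm
  obtain ⟨D, hD, hb⟩ := exists_greenOp_bound hd hA hB hg
  have hm : MemLp (green T φ θ c z g) 2 (volume.restrict (T.dirichletLeft c).I) := by
    refine hD.mono'
      ((h.continuousOn_green hc z g).aestronglyMeasurable (T.dirichletLeft c).measurableSet_I) ?_
    filter_upwards [hb] with x hx
    exact hx _ _ (fun _ _ => le_rfl) fun _ _ => le_rfl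
  have hmem := h.mem_of_eq_green hc (h.ne_zero_of_im hc hz) hm.coeFn_toLp
  refine ⟨hm.toLp, hmem, ?_⟩
  set f := hm.toLp
  have hs := h.symmetric_graph hc _ hmem _ hmem
  simp only [inner_add_left, inner_add_right, inner_smul_left, inner_smul_right] at hs
  have e : (z - starRingEnd ℂ z) * inner ℂ f f = inner ℂ g f - inner ℂ f g := by
    linear_combination -hs
  have e2 := congrArg norm e
  rw [norm_mul, inner_self_eq_norm_sq_to_K, Complex.sub_conj] at e2
  have e3 : ‖inner ℂ g f - inner ℂ f g‖ ≤ 2 * (‖g‖ * ‖f‖) := by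
    refine (norm_sub_le _ _).trans ?_
    have := norm_inner_le_norm (𝕜 := ℂ) g f
    have := norm_inner_le_norm (𝕜 := ℂ) f g
    linarith [mul_comm ‖f‖ ‖g‖]
  rw [← e2] at e3
  simp at e3
  have hz' : 0 < |z.im| := abs_pos.2 hz
  rw [inv_mul_eq_div, le_div_iff₀ hz']
  by_cases hf : ‖f‖ = 0
  · rw [hf]; simp
  · have : 0 < ‖f‖ := lt_of_le_of_ne (norm_nonneg _) (Ne.symm hf)
    refine le_of_mul_le_mul_right ?_ this
    linarith

theorem differentiable_apply (h : T.LeftSystem φ θ) (hx : x ∈ T.I) (i : Fin 2) :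
    (Differentiable ℂ fun w => φ w x i) ∧ Differentiable ℂ fun w => θ w x i :=
  ⟨differentiable_piLp 2 |>.1 (h.entire_left.2.1 x hx) i,
    differentiable_piLp 2 |>.1 (h.entire.2.1 x hx) i⟩

theorem differentiableAt_dirichletSol (h : T.LeftSystem φ θ) (hc : c ∈ T.I) (hx : x ∈ T.I)
    (hE : φ z c 0 ≠ 0) : DifferentiableAt ℂ (fun w => dirichletSol φ θ c w x) z :=
  ((h.entire.2.1 x hx).differentiableAt).sub
    ((((h.differentiable_apply hc 0).2 z).div ((h.differentiable_apply hc 0).1 z) hE).smul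
      (h.entire_left.2.1 x hx).differentiableAt)

theorem exists_dominating (h : T.LeftSystem φ θ) (hc : c ∈ T.I) (t : ℝ) {s : ℝ} (hs : 0 < s) :
    ∃ A : ℝ → ℝ, MemLp A 2 (volume.restrict (T.dirichletLeft c).I) ∧
      ∀ w ∈ Metric.closedBall (t : ℂ) s, ∀ x ∈ (T.dirichletLeft c).I, ‖φ w x‖ ≤ A x := by
  rw [dirichletLeft_I hc]
  exact h.entire_left.exists_dominating_left h.l2
    (fun z w => h.tendsto_wronsk_left ((h.entire_left.1 z).inMax (h.l2 z))
      ((h.entire_left.1 w).inMax (h.l2 w))) hc t hs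

theorem exists_dominating_dirichletSol (h : T.LeftSystem φ θ) (hc : c ∈ T.I)
    (hd : d ∈ (T.dirichletLeft c).I) (t : ℝ) {s : ℝ} (hs : 0 < s)
    (hE : ∀ w ∈ Metric.closedBall (t : ℂ) s, φ w c 0 ≠ 0) :
    ∃ B : ℝ → ℝ, MemLp B 2 (volume.restrict ((T.dirichletLeft c).side true d)) ∧
      ∀ w ∈ Metric.closedBall (t : ℂ) s, ∀ x ∈ (T.dirichletLeft c).side true d,
        ‖dirichletSol φ θ c w x‖ ≤ B x := by
  have hdT := dirichletLeft_I_subset hc hd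
  obtain ⟨A, hA, hA'⟩ := h.entire_left.exists_dominating_uIoc hdT hc t hs
  obtain ⟨A', hB, hB'⟩ := h.entire.exists_dominating_uIoc hdT hc t hs
  have hκ : ContinuousOn (fun w => θ w c 0 / φ w c 0) (Metric.closedBall (t : ℂ) s) :=
    (h.differentiable_apply hc 0).2.continuous.continuousOn.div
      (h.differentiable_apply hc 0).1.continuous.continuousOn hE
  obtain ⟨K, hK⟩ := (isCompact_closedBall (t : ℂ) s).exists_bound_of_continuousOn hκ
  have hsub : (T.dirichletLeft c).side true d ⊆ Set.uIoc d c := by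
    intro x hx
    have h1 := hx.1
    have h2 := hd
    rw [dirichletLeft_I hc] at h1 h2
    rw [Set.uIoc_of_le h2.2.le]
    exact ⟨hx.2, h1.2.le⟩
  refine ⟨_, (hB.add (hA.const_mul K)).mono_measure (Measure.restrict_mono hsub le_rfl),
    fun w hw x hx => ?_⟩
  refine (norm_sub_le _ _).trans (add_le_add (hB' w hw x (hsub hx)) ?_)
  rw [norm_smul]
  exact mul_le_mul (hK w hw) (hA' w hw x (hsub hx)) (norm_nonneg _)
    ((norm_nonneg _).trans (hK w hw))

theorem differentiableOn_green (h : T.LeftSystem φ θ) (hc : c ∈ T.I) (t : ℝ) {s : ℝ} (hs : 0 < s)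
    (hE : ∀ w ∈ Metric.closedBall (t : ℂ) s, φ w c 0 ≠ 0) (g : (T.dirichletLeft c).L2)
    (hx : x ∈ (T.dirichletLeft c).I) :
    DifferentiableOn ℂ (fun w => green T φ θ c w g x) (Metric.ball (t : ℂ) s) := by
  have hxT := dirichletLeft_I_subset hc hx
  have hcb := Metric.ball_subset_closedBall (x := (t : ℂ)) (ε := s)
  obtain ⟨A, hA, hA'⟩ := h.exists_dominating hc t hs
  obtain ⟨B, hB, hB'⟩ := h.exists_dominating_dirichletSol hc hx t hs hE
  have hle : ∀ r, volume.restrict ((T.dirichletLeft c).side r x) ≤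
      volume.restrict (T.dirichletLeft c).I := fun r => Measure.restrict_mono side_subset le_rfl
  have d1 : DifferentiableOn ℂ (fun w => ∫ y in (T.dirichletLeft c).side false x,
      dotT (φ w y) (g y)) (Metric.ball (t : ℂ) s) := by
    intro w hw
    simp only [dotT_comm _ (g _)]
    refine ((hasDerivAt_integral_dotT (hA.mono_measure (hle _)) ((Lp.memLp g).mono_measure (hle _))
      (fun w _ => (h.memLp_left hc w).1.mono_measure (hle _)) ?_ ?_
      hw).2).differentiableAt.differentiableWithinAt
    · filter_upwards [ae_restrict_mem measurableSet_side] with y hy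
      exact (h.entire_left.2.1 y (dirichletLeft_I_subset hc (side_subset hy))).differentiableOn
    · filter_upwards [ae_restrict_mem measurableSet_side] with y hy w hw
      exact hA' w (hcb hw) y (side_subset hy)
  have d2 : DifferentiableOn ℂ (fun w => ∫ y in (T.dirichletLeft c).side true x,
      dotT (dirichletSol φ θ c w y) (g y)) (Metric.ball (t : ℂ) s) := by
    intro w hw
    simp only [dotT_comm _ (g _)]
    refine ((hasDerivAt_integral_dotT hB ((Lp.memLp g).mono_measure (hle _))
      (fun w _ => (((h.isSolution_dirichletSol (z := w) c).dirichletLeft hc).dEq.continuousOn.mono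
        side_subset).aestronglyMeasurable measurableSet_side) ?_ ?_
      hw).2).differentiableAt.differentiableWithinAt
    · filter_upwards [ae_restrict_mem measurableSet_side] with y hy w hw
      exact (h.differentiableAt_dirichletSol hc (dirichletLeft_I_subset hc (side_subset hy))
        (hE w (hcb hw))).differentiableWithinAt
    · filter_upwards [ae_restrict_mem measurableSet_side] with y hy w hw
      exact hB' w (hcb hw) y hy
  exact (d2.smul (h.entire_left.2.1 x hxT).differentiableOn).add
    (d1.smul fun w hw => (h.differentiableAt_dirichletSol hc hxT
      (hE w (hcb hw))).differentiableWithinAt)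

/-- At a real point the imaginary part yields nothing. The solutions form a holomorphic `L²` family
on the disc, and `norm_le_of_resolvent_family` gives a constant independent of `g`. -/
theorem exists_mem_of_real (h : T.LeftSystem φ θ) (hc : c ∈ T.I) (t : ℝ) {s : ℝ} (hs : 0 < s)
    (hE : ∀ w ∈ Metric.closedBall (t : ℂ) s, φ w c 0 ≠ 0) {g : (T.dirichletLeft c).L2}
    (hg : g ∈ (T.dirichletLeft c).vanishLeft (dirichletLeft_nonempty hc)) :
    ∃ f, (f, g + (t : ℂ) • f) ∈ h.dirichletGraph hc ∧ ‖f‖ ≤ 4 / s * ‖g‖ := by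
  have hcb := Metric.ball_subset_closedBall (x := (t : ℂ)) (ε := s)
  obtain ⟨d, hd, hg⟩ := hg
  obtain ⟨A, hA, hA'⟩ := h.exists_dominating hc t hs
  obtain ⟨B, hB, hB'⟩ := h.exists_dominating_dirichletSol hc hd t hs hE
  obtain ⟨D, hD, hb⟩ := exists_greenOp_bound hd hA hB hg
  obtain ⟨V, V', hV⟩ := exists_hasDerivAt_Lp (f := fun w => green T φ θ c w g) hD (z₀ := t) (s := s)
    (fun w _ => (h.continuousOn_green hc w g).aestronglyMeasurable
      (T.dirichletLeft c).measurableSet_I)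
    (by
      filter_upwards [ae_restrict_mem (T.dirichletLeft c).measurableSet_I] with x hx
      exact h.differentiableOn_green hc t hs hE g hx)
    (by
      filter_upwards [hb] with x hx w hw
      exact hx _ _ (hA' w (hcb hw)) (hB' w (hcb hw)))
  have hmem : ∀ w ∈ Metric.ball (t : ℂ) s, (V w, g + w • V w) ∈ h.dirichletGraph hc :=
    fun w hw => h.mem_of_eq_green hc (hE w (hcb hw)) (hV w hw).2.1
  exact ⟨V t, hmem t (Metric.mem_ball_self hs), norm_le_of_resolvent_family (h.isClosed_graph hc)
    (h.symmetric_graph hc) hs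
    (fun w hw => (hV w hw).1.differentiableAt.differentiableWithinAt) hmem⟩

theorem inResolventSet (h : T.LeftSystem φ θ) (hc : c ∈ T.I) (hE : φ z c 0 ≠ 0) :
    (T.dirichletLeft c).InResolventSet z := by
  have hne : (T.dirichletLeft c).I.Nonempty := dirichletLeft_nonempty hc
  have key : ∃ C : ℝ, ∀ g ∈ (T.dirichletLeft c).vanishLeft hne,
      ∃ f, (f, g + z • f) ∈ h.dirichletGraph hc ∧ ‖f‖ ≤ C * ‖g‖ := by
    by_cases hz : z.im = 0
    · obtain ⟨t, rfl⟩ : ∃ t : ℝ, (t : ℂ) = z := ⟨z.re, Complex.ext rfl hz.symm⟩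
      have h1 : ∀ᶠ w in 𝓝 (t : ℂ), φ w c 0 ≠ 0 :=
        ((h.differentiable_apply hc 0).1.continuous.tendsto _).eventually_ne hE
      obtain ⟨s, hs, h2⟩ := Metric.nhds_basis_closedBall.eventually_iff.1 h1
      exact ⟨_, fun g hg => h.exists_mem_of_real hc t hs h2 hg⟩
    · exact ⟨_, fun g hg => h.exists_mem_of_im hc hz hg⟩
  obtain ⟨C, hC⟩ := key
  exact exists_resolvent (h.isClosed_graph hc) (fun f hf => h.eq_zero_of_mem hc hE hf)
    (mem_closure_vanishLeft hne) hC

/-- The restriction of the operator to the left of `c` has purely discrete spectrum. -/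
theorem purelyDiscrete (h : T.LeftSystem φ θ) (hc : c ∈ T.I) :
    (T.dirichletLeft c).PurelyDiscrete := by
  intro z hz
  have hspec : ∀ w ∈ (T.dirichletLeft c).spec, φ w c 0 = 0 := fun w hw => by
    by_contra hE
    exact hw (h.inResolventSet hc hE)
  have hd := (h.differentiable_apply hc 0).1
  refine ⟨?_, ⟨_, h.toLp_ne_zero hc z, h.eigen_mem hc (hspec z hz)⟩, ?_⟩
  -- The spectrum lies among the zeros of an entire function which is not zero at `i`, hence not
  -- identically zero.
  · rcases (hd.analyticAt z).eventually_eq_zero_or_eventually_ne_zero with h0 | h0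
    · have := AnalyticOnNhd.eqOn_zero_of_preconnected_of_eventuallyEq_zero
        (fun w _ => hd.analyticAt w) isPreconnected_univ (Set.mem_univ z) h0
      exact absurd (this (Set.mem_univ Complex.I)) (h.ne_zero_of_im hc (by simp))
    · rw [eventually_nhdsWithin_iff] at h0
      refine ⟨_, h0, Set.Subset.antisymm (fun w hw => ?_) ?_⟩
      · by_contra hne
        exact hw.1 hne (hspec w hw.2)
      · rintro _ rfl
        exact ⟨fun hne => absurd rfl hne, hz⟩
  · exact Submodule.finiteDimensional_of_le
      (Submodule.span_le.2 fun f hf => h.mem_span_of_mem hc hf)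

end LeftSystem

end DiracData

/-! ### Square integrability from bounds on compact intervals -/

namespace DiracData

variable {S : DiracData} {r : Bool} {c d x y : ℝ}

theorem memLp_side_of_bound {v : ℝ → CC2} {B : ℝ} (hd : d ∈ S.I) (hv : ContinuousOn v S.I)
    (h : ∀ x ∈ S.side r d, sgn r * ∫ y in d..x, ‖v y‖ ^ 2 ≤ B) :
    MemLp v 2 (volume.restrict (S.side r d)) := by
  have hmeas : AEStronglyMeasurable v (volume.restrict (S.side r d)) :=
    (hv.mono side_subset).aestronglyMeasurable measurableSet_side
  have hloc : ∀ x ∈ S.I, MemLp v 2 (volume.restrict (Set.uIoc d x)) := fun x hx =>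
    (memLp_uIcc_of_continuousOn hv hd hx).mono_measure
      (Measure.restrict_mono Set.uIoc_subset_uIcc le_rfl)
  rw [memLp_two_iff_integrable_sq_norm hmeas]
  have := endF_neBot (r := r) hd
  refine (aecover_side d).integrable_of_lintegral_enorm_bounded B (hmeas.norm.pow 2) ?_
  filter_upwards [eventually_side hd] with x hx
  rw [restrict_side_uIoc hd hx, ← ofReal_integral_norm_eq_lintegral_enorm
    (hloc x (side_subset hx)).integrable_norm_sq]
  refine ENNReal.ofReal_le_ofReal ?_
  have e : ∀ y, ‖‖v y‖ ^ 2‖ = ‖v y‖ ^ 2 := fun y => by simp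
  have h1 := h x hx
  rw [intervalIntegral_eq_sgn _ hx, smul_eq_mul, ← mul_assoc] at h1
  simp_rw [e]
  cases r <;> simpa [sgn] using h1

theorem sgn_mul_intervalIntegral_le {f : ℝ → CC2} (hd : d ∈ S.I)
    (hf : MemLp f 2 (volume.restrict (S.side r d))) (hx : x ∈ S.side r d) :
    sgn r * ∫ y in d..x, ‖f y‖ ^ 2 ≤ ∫ y in S.side r d, ‖f y‖ ^ 2 := by
  have h1 : ∫ y in Set.uIoc d x, ‖f y‖ ^ 2 ≤ ∫ y in S.side r d, ‖f y‖ ^ 2 :=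
    integral_mono_measure (uIoc_subset_side_ae hd hx) (Eventually.of_forall fun _ => by positivity)
      hf.integrable_norm_sq
  rw [intervalIntegral_eq_sgn _ hx, smul_eq_mul, ← mul_assoc]
  cases r <;> simpa [sgn] using h1

/-! ### The double commutation method -/

/-- A real nowhere vanishing solution which is square integrable near the left end point. -/
structure Seed (S : DiracData) (l : ℝ) (u : ℝ → CC2) : Prop where
  sol : S.IsSolution l u
  real : ∀ x ∈ S.I, conj2 (u x) = u x
  ne_zero : ∀ x ∈ S.I, u x ≠ 0
  l2 : S.L2End false u

namespace Seed

variable {l : ℝ} {u : ℝ → CC2}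

/-- The integral `∫_a^x |u|²`. -/
def mass (S : DiracData) (u : ℝ → CC2) (x : ℝ) : ℝ := ∫ y in S.side false x, ‖u y‖ ^ 2

theorem memLp (h : S.Seed l u) (hx : x ∈ S.I) : MemLp u 2 (volume.restrict (S.side false x)) :=
  h.l2.memLp h.sol.dEq.continuousOn hx

theorem dotT_self (h : S.Seed l u) (hx : x ∈ S.I) : dotT (u x) (u x) = ((‖u x‖ ^ 2 : ℝ) : ℂ) :=
  (ofReal_norm_sq_eq_dotT (h.real x hx).symm).symm

theorem intLeft_self (h : S.Seed l u) (x : ℝ) : S.intLeft u u x = (mass S u x : ℂ) := by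
  rw [mass]
  refine Eq.trans ?_ integral_ofReal
  refine setIntegral_congr_fun (measurableSet_side (S := S) (r := false)) fun y hy => ?_
  exact h.dotT_self (side_subset (S := S) (r := false) (c := x) hy)

theorem mass_pos (h : S.Seed l u) (hx : x ∈ S.I) : 0 < mass S u x := by
  rw [mass, integral_pos_iff_support_of_nonneg (fun _ => by positivity)
    (h.memLp hx).integrable_norm_sq]
  have hss : S.side false x ⊆ Function.support fun y => ‖u y‖ ^ 2 := fun y hy => by
    simpa using h.ne_zero y (side_subset hy)
  have h1 : volume.restrict (S.side false x) (S.side false x) ≤ _ := measure_mono hss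
  rw [Measure.restrict_apply_self] at h1
  refine lt_of_lt_of_le ?_ h1
  exact (S.isOpen_I.inter isOpen_Iio).measure_pos volume (exists_mem_side (r := false) hx)

theorem intLeft_ne_zero (h : S.Seed l u) (hx : x ∈ S.I) : S.intLeft u u x ≠ 0 := by
  rw [h.intLeft_self]
  exact_mod_cast (h.mass_pos hx).ne'

theorem aDeriv_intLeft {f : ℝ → CC2} (h : S.Seed l u) (hf : S.L2End false f)
    (hfc : ContinuousOn f S.I) : ADeriv S.I (S.intLeft u f) (fun x => dotT (u x) (f x)) :=
  (aDeriv_side (r := false) fun _ hd => integrable_dotT (h.memLp hd)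
    (hf.memLp hfc hd)).congr_deriv (Eventually.of_forall fun x => by simp [sgn])

theorem aDeriv_inv (h : S.Seed l u) : ADeriv S.I (fun x => (S.intLeft u u x)⁻¹)
    (fun x => -dotT (u x) (u x) / S.intLeft u u x ^ 2) :=
  (h.aDeriv_intLeft h.l2 h.sol.dEq.continuousOn).inv S.isOpen_I fun _ hx => h.intLeft_ne_zero hx

theorem uInf_eq (h : S.Seed l u) (x : ℝ) : S.uInf u x = ((mass S u x)⁻¹ : ℂ) • u x := by
  rw [uInf, h.intLeft_self]

theorem conj2_uInf (h : S.Seed l u) (hx : x ∈ S.I) : conj2 (S.uInf u x) = S.uInf u x := by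
  have e := h.real x hx
  have e0 := congrArg (fun v : CC2 => v 0) e
  have e1 := congrArg (fun v : CC2 => v 1) e
  rw [h.uInf_eq]
  apply CC2.ext
  · simpa using Or.inl e0
  · simpa using Or.inl e1

/-- A solution of the original equation, in terms of the commuted expression. -/
theorem dEq_commInf (h : S.Seed l u) {f g : ℝ → CC2} (hf : S.DEq f g) :
    (S.commInf u).DEq f (fun x => g x + (dotT (u x) (f x) / S.intLeft u u x) • rot2 (u x) +
      wronsk (u x) (f x) • S.uInf u x) := by
  refine ⟨hf.1, ?_⟩
  filter_upwards [hf.2, ae_restrict_mem S.measurableSet_I] with x e hx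
  have r0 : starRingEnd ℂ (u x 0) = u x 0 := congrArg (fun v : CC2 => v 0) (h.real x hx)
  have r1 : starRingEnd ℂ (u x 1) = u x 1 := congrArg (fun v : CC2 => v 1) (h.real x hx)
  have hc := h.intLeft_self x
  have rc : starRingEnd ℂ (S.intLeft u u x) = S.intLeft u u x := by rw [hc, Complex.conj_ofReal]
  have e1 : (((-(2 * (u x 0 * u x 1)) / S.intLeft u u x).re : ℝ) : ℂ) =
      -(2 * (u x 0 * u x 1)) / S.intLeft u u x := by
    rw [← Complex.conj_eq_iff_re]; simp [map_ofNat, r0, r1, rc]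
  have e2 : (((((u x 0) ^ 2 - (u x 1) ^ 2) / S.intLeft u u x).re : ℝ) : ℂ) =
      ((u x 0) ^ 2 - (u x 1) ^ 2) / S.intLeft u u x := by
    rw [← Complex.conj_eq_iff_re]; simp [r0, r1, rc]
  have t0 := congrArg (fun v : CC2 => v 0) e
  have t1 := congrArg (fun v : CC2 => v 1) e
  apply CC2.ext
  · simp [tau] at t0
    simp only [tau, commInf, uInf, dotT, wronsk]
    simp
    rw [e1, e2, ← t0]
    ring
  · simp [tau] at t1
    simp only [tau, commInf, uInf, dotT, wronsk]
    simp
    rw [e1, e2, ← t1]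
    ring

/-- The term from the derivative of `1/c` is cancelled by the potential added to `τ`, and `W(u,u) =
0`. -/
theorem isSolution_uInf (h : S.Seed l u) : (S.commInf u).IsSolution l (S.uInf u) := by
  refine (h.dEq_commInf (h.sol.dEq.fsmul h.aDeriv_inv)).congr (fun _ _ => rfl) fun x hx => ?_
  have := h.intLeft_ne_zero hx
  simp only [uInf, wronsk_smul_right, wronsk_self, dotT_smul_right, mul_zero, zero_smul, add_zero]
  rw [add_assoc, ← add_smul, smul_comm]
  convert add_zero _ using 2
  convert zero_smul ℂ _ using 2
  field_simp
  ring

/-- The transformation of solutions away from the spectral parameter of the seed. -/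
theorem isSolution_transform (h : S.Seed l u) {z : ℂ} {f : ℝ → CC2} (hf : S.IsSolution z f) :
    (S.commInf u).IsSolution z (fun x => (z - l) • f x + wronsk (u x) (f x) • S.uInf u x) := by
  have h1 := (h.dEq_commInf hf.dEq).smul (z - l)
  have h2 := DEq.fsmul (S := S.commInf u) (h.sol.wronsk hf) h.isSolution_uInf.dEq
  refine (h1.add h2).congr (fun _ _ => rfl) fun x hx => ?_
  simp only [uInf]
  apply CC2.ext <;> simp <;> ring

/-- The integral version of the transformation of solutions. -/
theorem dEq_sub_smul_uInf (h : S.Seed l u) {f k : ℝ → CC2} {g : ℝ → ℂ} {z : ℂ}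
    (hf : S.DEq f (fun x => z • f x + k x)) (hg : ADeriv S.I g (fun x => dotT (u x) (f x))) :
    (S.commInf u).DEq (fun x => f x - g x • S.uInf u x)
      (fun x => z • (f x - g x • S.uInf u x) + (k x + (wronsk (u x) (f x) + (z - l) * g x) •
        S.uInf u x)) := by
  refine ((h.dEq_commInf hf).sub (h.isSolution_uInf.dEq.fsmul hg)).congr (fun _ _ => rfl)
    fun x hx => ?_
  simp only [uInf]
  apply CC2.ext <;> simp <;> ring

/-- Expand `|f - g u/c|²`: the cross term is the derivative of `|g|²` over `c`, and the quadratic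
term is `-|g|²` times the derivative of `1/c`. All comparisons of square integrals below start here.
-/
theorem aDeriv_sq (h : S.Seed l u) {f : ℝ → CC2} {g : ℝ → ℂ}
    (hg : ADeriv S.I g (fun x => dotT (u x) (f x))) :
    ADeriv S.I (fun x => ((‖g x‖ ^ 2 / mass S u x : ℝ) : ℂ))
      (fun x => ((‖f x‖ ^ 2 - ‖f x - g x • S.uInf u x‖ ^ 2 : ℝ) : ℂ)) := by
  refine ((hg.star.mul hg).mul h.aDeriv_inv).congr S.isOpen_I (fun x hx => ?_) fun x hx => ?_
  · rw [h.intLeft_self]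
    push_cast
    rw [← Complex.conj_mul' (g x), div_eq_mul_inv]
  · have r0 : starRingEnd ℂ (u x 0) = u x 0 := congrArg (fun v : CC2 => v 0) (h.real x hx)
    have r1 : starRingEnd ℂ (u x 1) = u x 1 := congrArg (fun v : CC2 => v 1) (h.real x hx)
    have hc0 := h.intLeft_ne_zero hx
    have rc : starRingEnd ℂ (S.intLeft u u x) = S.intLeft u u x := by
      rw [h.intLeft_self, Complex.conj_ofReal]
    push_cast
    have e : ∀ v : CC2, ((‖v‖ : ℂ)) ^ 2 = dotT (conj2 v) v := fun v => by
      rw [dotT_comm, ← ofReal_norm_sq_eq_dotT rfl]; push_cast; rfl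
    rw [e, e]
    simp only [uInf, dotT]
    simp [r0, r1, rc]
    field_simp
    ring

theorem intervalIntegral_sq (h : S.Seed l u) {f : ℝ → CC2} {g : ℝ → ℂ}
    (hfc : ContinuousOn f S.I) (hg : ADeriv S.I g (fun x => dotT (u x) (f x)))
    (hd : d ∈ S.I) (hx : x ∈ S.I) :
    ∫ y in d..x, ‖f y - g y • S.uInf u y‖ ^ 2 =
      (∫ y in d..x, ‖f y‖ ^ 2) - (‖g x‖ ^ 2 / mass S u x - ‖g d‖ ^ 2 / mass S u d) := by
  have hsub := S.ordConnected_I.uIcc_subset hd hx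
  have i1 : IntervalIntegrable (fun y => ‖f y‖ ^ 2) volume d x :=
    ((hfc.mono hsub).norm.pow 2).intervalIntegrable
  have hu : ContinuousOn (S.uInf u) S.I := h.isSolution_uInf.dEq.continuousOn
  have i2 : IntervalIntegrable (fun y => ‖f y - g y • S.uInf u y‖ ^ 2) volume d x :=
    (((hfc.sub ((hg.continuousOn S.isOpen_I).smul hu)).mono hsub).norm.pow 2).intervalIntegrable
  have h1 := (h.aDeriv_sq hg).integral_eq_sub S.isOpen_I hd hx
  rw [intervalIntegral.integral_ofReal, intervalIntegral.integral_sub i1 i2] at h1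
  have h2 : (∫ y in d..x, ‖f y‖ ^ 2) - (∫ y in d..x, ‖f y - g y • S.uInf u y‖ ^ 2) =
      ‖g x‖ ^ 2 / mass S u x - ‖g d‖ ^ 2 / mass S u d := by exact_mod_cast h1
  linarith

/-- At the right end the boundary term at `x` enters with a negative sign and can be dropped, so any
antiderivative `g` will do. -/
theorem l2End_right_sub (h : S.Seed l u) {f : ℝ → CC2} {g : ℝ → ℂ} (hf : S.L2End true f)
    (hfc : ContinuousOn f S.I) (hg : ADeriv S.I g (fun x => dotT (u x) (f x))) :
    S.L2End true (fun x => f x - g x • S.uInf u x) := by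
  obtain ⟨d, hd, hf⟩ := hf
  have hu : ContinuousOn (S.uInf u) S.I := h.isSolution_uInf.dEq.continuousOn
  refine ⟨d, hd, memLp_side_of_bound hd (hfc.sub ((hg.continuousOn S.isOpen_I).smul hu))
    (B := (∫ y in S.side true d, ‖f y‖ ^ 2) + ‖g d‖ ^ 2 / mass S u d) fun x hx => ?_⟩
  rw [h.intervalIntegral_sq hfc hg hd (side_subset hx)]
  have h1 := sgn_mul_intervalIntegral_le hd hf hx
  have h2 : 0 ≤ ‖g x‖ ^ 2 / mass S u x := div_nonneg (by positivity) (h.mass_pos (side_subset hx)).le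
  simp only [sgn, one_mul] at h1 ⊢
  linarith

theorem norm_sq_intLeft_le (h : S.Seed l u) {f : ℝ → CC2} (hf : S.L2End false f)
    (hfc : ContinuousOn f S.I) (hx : x ∈ S.I) :
    ‖S.intLeft u f x‖ ^ 2 / mass S u x ≤ ∫ y in S.side false x, ‖f y‖ ^ 2 := by
  rw [div_le_iff₀ (h.mass_pos hx), mul_comm]
  have h1 := norm_integral_dotT_le (h.memLp hx) (hf.memLp hfc hx)
  calc ‖S.intLeft u f x‖ ^ 2 ≤ (_ * _) ^ 2 := pow_le_pow_left₀ (norm_nonneg _) h1 2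
    _ = _ := by rw [mul_pow, l2n_sq, l2n_sq]; rfl

/-- At the left end the boundary term has the wrong sign. With the integral from `a` as
antiderivative, Cauchy–Schwarz bounds it by the integral of `|f|²`, which accounts for the factor
`2` in the bound. -/
theorem l2End_left_sub (h : S.Seed l u) {f : ℝ → CC2} (hf : S.L2End false f)
    (hfc : ContinuousOn f S.I) : S.L2End false (fun x => f x - S.intLeft u f x • S.uInf u x) := by
  have hg := h.aDeriv_intLeft hf hfc
  obtain ⟨d, hd, hf'⟩ := id hf
  have hu : ContinuousOn (S.uInf u) S.I := h.isSolution_uInf.dEq.continuousOn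
  refine ⟨d, hd, memLp_side_of_bound hd (hfc.sub ((hg.continuousOn S.isOpen_I).smul hu))
    (B := 2 * ∫ y in S.side false d, ‖f y‖ ^ 2) fun x hx => ?_⟩
  rw [h.intervalIntegral_sq hfc hg hd (side_subset hx)]
  have h1 := sgn_mul_intervalIntegral_le hd hf' hx
  have h2 : 0 ≤ ‖S.intLeft u f d‖ ^ 2 / mass S u d := div_nonneg (by positivity) (h.mass_pos hd).le
  have h3 := h.norm_sq_intLeft_le hf hfc (side_subset hx)
  have h4 : ∫ y in S.side false x, ‖f y‖ ^ 2 ≤ ∫ y in S.side false d, ‖f y‖ ^ 2 :=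
    integral_mono_measure (Measure.restrict_mono (side_subset_side hx) le_rfl)
      (Eventually.of_forall fun _ => by positivity) hf'.integrable_norm_sq
  simp only [sgn] at h1 ⊢
  linarith

/-- The square identity with `f = 0` and `g = 1`. -/
theorem intervalIntegral_uInf (h : S.Seed l u) (hd : d ∈ S.I) (hx : x ∈ S.I) :
    ∫ y in d..x, ‖S.uInf u y‖ ^ 2 = (mass S u d)⁻¹ - (mass S u x)⁻¹ := by
  have h0 : ADeriv S.I (fun _ : ℝ => (1 : ℂ)) (fun x => dotT (u x) ((0 : ℝ → CC2) x)) :=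
    (ADeriv.const 1).congr_deriv (Eventually.of_forall fun x => by simp)
  have := h.intervalIntegral_sq (f := 0) continuousOn_const h0 hd hx
  simpa using this

theorem l2End_right_uInf (h : S.Seed l u) (hd : d ∈ S.I) : S.L2End true (S.uInf u) := by
  refine ⟨d, hd, memLp_side_of_bound hd h.isSolution_uInf.dEq.continuousOn
    (B := (mass S u d)⁻¹) fun x hx => ?_⟩
  rw [h.intervalIntegral_uInf hd (side_subset hx)]
  have := inv_pos.2 (h.mass_pos (side_subset hx))
  simp only [sgn, one_mul]
  linarith

theorem tendsto_mass (h : S.Seed l u) (hd : d ∈ S.I) :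
    Tendsto (mass S u) (S.endF false) (𝓝 0) :=
  tendsto_tail_zero hd (h.memLp hd).integrable_norm_sq

/-- The square integral of `u_∞` over `(x,d)` is `1/c(x) - 1/c(d)`, unbounded as `c(x) → 0` at the
left end. Thus one solution fails to be square integrable there. -/
theorem not_limitCircle (h : S.Seed l u) :
    ¬ (S.commInf u).LimitCircle false := by
  intro hlc
  obtain ⟨d, hd, hm⟩ := hlc _ _ h.isSolution_uInf
  replace hd : d ∈ S.I := hd
  replace hm : MemLp (S.uInf u) 2 (volume.restrict (S.side false d)) := hm
  have := endF_neBot (r := false) hd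
  set B := (∫ y in S.side false d, ‖S.uInf u y‖ ^ 2) + (mass S u d)⁻¹
  have hB : 0 < B := add_pos_of_nonneg_of_pos (integral_nonneg fun _ => by positivity)
    (inv_pos.2 (h.mass_pos hd))
  obtain ⟨x, h1, hx⟩ := (((h.tendsto_mass hd).eventually (gt_mem_nhds (inv_pos.2 hB))).and
    (eventually_side hd)).exists
  have h2 := sgn_mul_intervalIntegral_le hd hm hx
  rw [h.intervalIntegral_uInf hd (side_subset hx)] at h2
  have h3 := (lt_inv_comm₀ (h.mass_pos (side_subset hx)) hB).1 h1
  simp only [sgn] at h2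
  linarith

end Seed

end DiracData

/-! ### Derivatives and conjugates of Wronskians -/

theorem hasDerivAt_apply {f : ℂ → CC2} {f' : CC2} {z : ℂ} (hf : HasDerivAt f f' z) (i : Fin 2) :
    HasDerivAt (fun w => f w i) (f' i) z :=
  (EuclideanSpace.proj (𝕜 := ℂ) i).hasFDerivAt.comp_hasDerivAt z hf

theorem hasDerivAt_wronsk {f : ℂ → CC2} {f' : CC2} {z : ℂ} (hf : HasDerivAt f f' z) (v : CC2) :
    HasDerivAt (fun w => wronsk v (f w)) (wronsk v f') z :=
  ((hasDerivAt_apply hf 1).const_mul _).sub ((hasDerivAt_apply hf 0).const_mul _)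

theorem differentiable_wronsk {f : ℂ → CC2} (hf : Differentiable ℂ f) (v : CC2) :
    Differentiable ℂ fun w => wronsk v (f w) := fun z =>
  (hasDerivAt_wronsk (hf z).hasDerivAt v).differentiableAt

theorem im_eq_zero_of_conj2 {v : CC2} (h : conj2 v = v) (i : Fin 2) : (v i).im = 0 := by
  rw [← Complex.conj_eq_iff_im]
  fin_cases i
  · exact congrArg (fun v : CC2 => v 0) h
  · exact congrArg (fun v : CC2 => v 1) h

theorem conj2_eq_self {v : CC2} (h : ∀ i, (v i).im = 0) : conj2 v = v :=
  CC2.ext (Complex.conj_eq_iff_im.2 (h 0)) (Complex.conj_eq_iff_im.2 (h 1))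

theorem conj_dotT (v w : CC2) : starRingEnd ℂ (dotT v w) = dotT (conj2 v) (conj2 w) := by
  simp [dotT]

theorem conj_wronsk (v w : CC2) : starRingEnd ℂ (wronsk v w) = wronsk (conj2 v) (conj2 w) := by
  simp [wronsk]

theorem conj2_sub (v w : CC2) : conj2 (v - w) = conj2 v - conj2 w :=
  CC2.ext (by simp) (by simp)

theorem conj2_add (v w : CC2) : conj2 (v + w) = conj2 v + conj2 w :=
  CC2.ext (by simp) (by simp)

theorem conj2_smul (k : ℂ) (v : CC2) : conj2 (k • v) = starRingEnd ℂ k • conj2 v :=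
  CC2.ext (by simp) (by simp)

/-! ### The transformed fundamental system -/

namespace DiracData

variable {S : DiracData} {r : Bool} {c d x y : ℝ}

/-- A real entire fundamental system whose first member is square integrable near the left end
point and satisfies a fixed boundary condition there. -/
structure WeylSystem (S : DiracData) (Φ Θ : ℂ → ℝ → CC2) : Prop where
  entire_left : S.IsRealEntireSolution Φ
  entire : S.IsRealEntireSolution Θ
  wronsk_eq : ∀ z, ∀ x ∈ S.I, wronsk (Θ z x) (Φ z x) = 1
  l2 : ∀ z, S.L2End false (Φ z)
  tendsto_wronsk : ∀ z w, Tendsto (fun x => wronsk (Φ z x) (Φ w x)) S.atLeft (𝓝 0)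

/-- The first member of the transformed system. -/
def phiInf (S : DiracData) (Φ : ℂ → ℝ → CC2) (l : ℝ) (z : ℂ) (x : ℝ) : CC2 :=
  dslope (fun z => Φ z x - S.intLeft (Φ l) (Φ z) x • S.uInf (Φ l) x) l z

/-- The second member of the transformed system. -/
def thetaInf (S : DiracData) (Φ Θ : ℂ → ℝ → CC2) (l : ℝ) (z : ℂ) (x : ℝ) : CC2 :=
  (z - l) • Θ z x + wronsk (Φ l x) (Θ z x) • S.uInf (Φ l) x

namespace WeylSystem

variable {Φ Θ : ℂ → ℝ → CC2} {z : ℂ}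

theorem seed (h : S.WeylSystem Φ Θ) (l : ℝ) : S.Seed l (Φ l) where
  sol := h.entire_left.1 l
  real x hx := conj2_eq_self (h.entire_left.2.2 l x hx)
  ne_zero x hx h0 := by
    have := h.wronsk_eq l x hx
    simp [h0] at this
  l2 := h.l2 l

/-- Green's formula without boundary term at the left end; it links the integral and the Wronskian
form of the transformation. -/
theorem wronsk_eq_intLeft (h : S.WeylSystem Φ Θ) (w z : ℂ) (hx : x ∈ S.I) :
    wronsk (Φ w x) (Φ z x) = (w - z) * S.intLeft (Φ w) (Φ z) x :=
  (integral_dotT_left (h.entire_left.1 w) (h.entire_left.1 z) (h.l2 w) (h.l2 z) hx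
    (h.tendsto_wronsk w z)).symm

theorem memLp_deriv_hasDerivAt (h : S.WeylSystem Φ Θ) (l : ℝ) (hx : x ∈ S.I) :
    MemLp (fun y => deriv (fun z => Φ z y) l) 2 (volume.restrict (S.side false x)) ∧
    HasDerivAt (fun z => S.intLeft (Φ l) (Φ z) x)
      (S.intLeft (Φ l) (fun y => deriv (fun z => Φ z y) l) x) l := by
  obtain ⟨D, hD, hb⟩ := h.entire_left.exists_dominating_left h.l2 h.tendsto_wronsk hx l one_pos
  refine hasDerivAt_integral_dotT hD ((h.seed l).memLp hx) (z₀ := l) (s := 1)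
    (fun z _ => ((h.entire_left.1 z).dEq.continuousOn.mono
      side_subset).aestronglyMeasurable measurableSet_side) ?_ ?_ (Metric.mem_ball_self one_pos)
  · filter_upwards [ae_restrict_mem measurableSet_side] with y hy
    exact (h.entire_left.2.1 y (side_subset hy)).differentiableOn
  · filter_upwards [ae_restrict_mem measurableSet_side] with y hy w hw
    exact hb w (Metric.ball_subset_closedBall hw) y hy

/-- Away from `l` the integral is a Wronskian divided by `l - z`; at `l` one differentiates under
the dominated integral. -/
theorem differentiable_intLeft (h : S.WeylSystem Φ Θ) (l : ℝ) (hx : x ∈ S.I) :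
    Differentiable ℂ fun z => S.intLeft (Φ l) (Φ z) x := by
  intro z
  by_cases hz : z = l
  · rw [hz]
    exact (h.memLp_deriv_hasDerivAt l hx).2.differentiableAt
  · have h1 : DifferentiableAt ℂ (fun z => wronsk (Φ l x) (Φ z x) / (l - z)) z :=
      (differentiable_wronsk (h.entire_left.2.1 x hx) _ z).div (by fun_prop)
        (sub_ne_zero.2 (Ne.symm hz))
    refine h1.congr_of_eventuallyEq ?_
    filter_upwards [isOpen_ne.mem_nhds hz] with w hw
    rw [h.wronsk_eq_intLeft l w hx, mul_div_cancel_left₀ _ (sub_ne_zero.2 (Ne.symm hw))]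

theorem differentiable_num (h : S.WeylSystem Φ Θ) (l : ℝ) (hx : x ∈ S.I) :
    Differentiable ℂ fun z => Φ z x - S.intLeft (Φ l) (Φ z) x • S.uInf (Φ l) x :=
  (h.entire_left.2.1 x hx).sub ((h.differentiable_intLeft l hx).smul_const _)

/-- The numerator vanishes at `l` because `c u_∞ = u`, so `dslope` in `phiInf` is the division by `z
- l` with its singularity removed. -/
theorem num_eq_zero (h : S.WeylSystem Φ Θ) (l : ℝ) (hx : x ∈ S.I) :
    Φ l x - S.intLeft (Φ l) (Φ l) x • S.uInf (Φ l) x = 0 := by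
  rw [uInf, smul_inv_smul₀ ((h.seed l).intLeft_ne_zero hx), sub_self]

theorem phiInf_of_ne (h : S.WeylSystem Φ Θ) {l : ℝ} (hz : z ≠ l) (hx : x ∈ S.I) :
    S.phiInf Φ l z x =
      (z - l)⁻¹ • (Φ z x - S.intLeft (Φ l) (Φ z) x • S.uInf (Φ l) x) := by
  rw [phiInf, dslope_of_ne _ hz, slope_def_module, h.num_eq_zero l hx, sub_zero]

theorem phiInf_self (h : S.WeylSystem Φ Θ) (l : ℝ) (hx : x ∈ S.I) :
    S.phiInf Φ l l x = deriv (fun z => Φ z x) l -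
      S.intLeft (Φ l) (fun y => deriv (fun z => Φ z y) l) x • S.uInf (Φ l) x := by
  rw [phiInf, dslope_same]
  exact ((h.entire_left.2.1 x hx l).hasDerivAt.sub
    ((h.memLp_deriv_hasDerivAt l hx).2.smul_const _)).deriv

theorem differentiable_phiInf (h : S.WeylSystem Φ Θ) (l : ℝ) (hx : x ∈ S.I) :
    Differentiable ℂ fun z => S.phiInf Φ l z x := by
  have h1 := (Complex.differentiableOn_dslope (c := (l : ℂ)) (Filter.univ_mem)).2
    (h.differentiable_num l hx).differentiableOn
  exact differentiableOn_univ.1 h1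

/-- Differentiate `W(Φ(l),Φ(z)) = (l - z) ∫_a^x Φ(l)ᵀΦ(z)` at `z = l`. -/
theorem wronsk_deriv (h : S.WeylSystem Φ Θ) (l : ℝ) (hx : x ∈ S.I) :
    wronsk (Φ l x) (deriv (fun z => Φ z x) l) = -S.intLeft (Φ l) (Φ l) x := by
  have h1 := hasDerivAt_wronsk (h.entire_left.2.1 x hx l).hasDerivAt (Φ l x)
  have h2 := ((hasDerivAt_id (l : ℂ)).const_sub (l : ℂ)).mul (h.memLp_deriv_hasDerivAt l hx).2
  simp only [h.wronsk_eq_intLeft l _ hx] at h1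
  have := h1.unique h2
  simpa using this

/-- The `z`- and `x`-derivatives are not interchanged directly: the Wronskians of the `z`-derivative
with `Θ(l)` and `Φ(l)` are obtained by differentiating Green's formula in `z`, and variation of
constants reassembles them. -/
theorem dEq_deriv (h : S.WeylSystem Φ Θ) (l : ℝ) :
    S.DEq (fun x => deriv (fun z => Φ z x) l)
      (fun x => (l : ℂ) • deriv (fun z => Φ z x) l + Φ l x) := by
  rcases S.I.eq_empty_or_nonempty with hI | ⟨d, hd⟩
  · refine ⟨fun c hc => ?_, ?_⟩
    · rw [hI] at hc; exact hc.elim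
    · rw [hI]; simp
  have hu := (h.entire_left.1 l)
  have hθ := (h.entire.1 l)
  have key : ∀ x ∈ S.I, wronsk (Θ l x) (deriv (fun z => Φ z x) l) =
      wronsk (Θ l d) (deriv (fun z => Φ z d) l) - ∫ y in d..x, dotT (Θ l y) (Φ l y) := by
    intro x hx
    obtain ⟨D, hD, hb⟩ := h.entire_left.exists_dominating_uIoc hd hx l one_pos
    have hsub : Set.uIoc d x ⊆ S.I :=
      Set.uIoc_subset_uIcc.trans (S.ordConnected_I.uIcc_subset hd hx)
    have hK := (hasDerivAt_integral_dotT (f := Φ) (k := Θ l) hD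
      ((memLp_uIcc_of_continuousOn hθ.dEq.continuousOn hd hx).mono_measure
        (Measure.restrict_mono Set.uIoc_subset_uIcc le_rfl)) (z₀ := l) (s := 1)
      (fun z _ => ((h.entire_left.1 z).dEq.continuousOn.mono
        hsub).aestronglyMeasurable measurableSet_uIoc)
      (by
        filter_upwards [ae_restrict_mem measurableSet_uIoc] with y hy
        exact (h.entire_left.2.1 y (hsub hy)).differentiableOn)
      (by
        filter_upwards [ae_restrict_mem measurableSet_uIoc] with y hy w hw
        exact hb w (Metric.ball_subset_closedBall hw) y hy)
      (Metric.mem_ball_self one_pos)).2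
    -- The sign turns the integral over `uIoc d x` into the oriented one.
    have hK' := hK.const_smul (if d ≤ x then (1 : ℝ) else -1)
    have e : ∀ z, ((if d ≤ x then (1 : ℝ) else -1) • ∫ y in Set.uIoc d x, dotT (Θ l y) (Φ z y)) =
        ∫ y in d..x, dotT (Θ l y) (Φ z y) := fun z =>
      (intervalIntegral.intervalIntegral_eq_integral_uIoc _ _ _ _).symm
    have h1 := (hasDerivAt_wronsk (h.entire_left.2.1 x hx l).hasDerivAt (Θ l x)).sub
      (hasDerivAt_wronsk (h.entire_left.2.1 d hd l).hasDerivAt (Θ l d))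
    have h2 := ((hasDerivAt_id (l : ℂ)).const_sub (l : ℂ)).mul hK'
    have h3 : ∀ z : ℂ, wronsk (Θ l x) (Φ z x) - wronsk (Θ l d) (Φ z d) =
        (l - z) * ((if d ≤ x then (1 : ℝ) else -1) •
          ∫ y in Set.uIoc d x, dotT (Θ l y) (Φ z y)) := fun z => by
      rw [e, ← (hθ.wronsk (h.entire_left.1 z)).integral_eq_sub S.isOpen_I hd hx,
        intervalIntegral.integral_const_mul]
    have h4 := (h1.congr_of_eventuallyEq (Eventually.of_forall fun z => (h3 z).symm)).unique h2
    simp only [id, sub_self, zero_mul, add_zero, Pi.smul_apply] at h4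
    rw [e] at h4
    linear_combination h4
  have hα : ADeriv S.I (fun x => wronsk (Θ l x) (deriv (fun z => Φ z x) l))
      (fun x => -dotT (Θ l x) (Φ l x)) := by
    have hi : ∀ p ∈ S.I, ∀ q ∈ S.I, IntervalIntegrable (fun x => dotT (Θ l x) (Φ l x)) volume p q :=
      fun p hp q hq => by
        have hs := S.ordConnected_I.uIcc_subset hp hq
        rw [intervalIntegrable_iff]
        have := integrable_dotT (memLp_uIcc_of_continuousOn hθ.dEq.continuousOn hp hq)
          (memLp_uIcc_of_continuousOn hu.dEq.continuousOn hp hq)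
        exact Integrable.mono_measure this (Measure.restrict_mono Set.uIoc_subset_uIcc le_rfl)
    have := (ADeriv.const (I := S.I) (wronsk (Θ l d) (deriv (fun z => Φ z d) l))).sub
      (ADeriv.integral S.isOpen_I hi hd)
    exact this.congr S.isOpen_I (fun x hx => (key x hx).symm) fun x _ => by simp
  have hβ : ADeriv S.I (fun x => wronsk (Φ l x) (deriv (fun z => Φ z x) l))
      (fun x => -dotT (Φ l x) (Φ l x)) :=
    ((h.seed l).aDeriv_intLeft (h.l2 l) hu.dEq.continuousOn).neg.congr S.isOpen_I
      (fun x hx => (h.wronsk_deriv l hx).symm) fun x _ => rfl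
  refine (DEq.of_variation hu hθ (h.wronsk_eq l) hα hβ).congr
    (fun x hx => (eq_of_wronsk_eq_one (h.wronsk_eq l x hx) _).symm) fun x hx => ?_
  rw [← eq_of_wronsk_eq_one (h.wronsk_eq l x hx)]

theorem l2End_deriv (h : S.WeylSystem Φ Θ) (l : ℝ) (hne : S.I.Nonempty) :
    S.L2End false (fun x => deriv (fun z => Φ z x) l) :=
  hne.elim fun d hd => ⟨d, hd, (h.memLp_deriv_hasDerivAt l hd).1⟩

/-- For `z ≠ l` this is `(z - l)⁻²` times the transform of `Φ(z)`. At `l` the inhomogeneity `Φ(l)`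
of the equation for the `z`-derivative is cancelled, since `W(Φ(l), ∂Φ(l)) = -c`. -/
theorem isSolution_phiInf (h : S.WeylSystem Φ Θ) (l : ℝ) (hne : S.I.Nonempty) (z : ℂ) :
    (S.commInf (Φ l)).IsSolution z (S.phiInf Φ l z) := by
  by_cases hz : z = l
  · subst hz
    have hD := h.dEq_deriv l
    refine ((h.seed l).dEq_sub_smul_uInf hD ((h.seed l).aDeriv_intLeft (h.l2End_deriv l hne)
      hD.continuousOn)).congr (fun x hx => (h.phiInf_self l hx).symm) fun x hx => ?_
    rw [h.phiInf_self l hx, h.wronsk_deriv l hx, sub_self, zero_mul, add_zero, neg_smul,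
      ← sub_eq_add_neg, h.num_eq_zero l hx, add_zero]
  · have h1 := ((h.seed l).isSolution_transform (h.entire_left.1 z)).smul ((z - l)⁻¹ * (z - l)⁻¹)
    refine h1.congr fun x hx => ?_
    have hz' := sub_ne_zero.2 hz
    rw [h.phiInf_of_ne hz hx, h.wronsk_eq_intLeft l z hx, ← neg_sub z (l : ℂ), neg_mul, neg_smul,
      mul_smul, mul_smul, ← sub_eq_add_neg, ← smul_sub, inv_smul_smul₀ hz']

theorem l2End_phiInf (h : S.WeylSystem Φ Θ) (l : ℝ) (hne : S.I.Nonempty) (z : ℂ) :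
    S.L2End false (S.phiInf Φ l z) := by
  by_cases hz : z = l
  · subst hz
    refine ((h.seed l).l2End_left_sub (h.l2End_deriv l hne) (h.dEq_deriv l).continuousOn).congr ?_
    filter_upwards [ae_restrict_mem S.measurableSet_I] with x hx
    rw [h.phiInf_self l hx]
  · refine (((h.seed l).l2End_left_sub (h.l2 z)
      (h.entire_left.1 z).dEq.continuousOn).smul (z - l)⁻¹).congr ?_
    filter_upwards [ae_restrict_mem S.measurableSet_I] with x hx
    rw [h.phiInf_of_ne hz hx]

theorem isRealEntire_phiInf (h : S.WeylSystem Φ Θ) (l : ℝ) (hne : S.I.Nonempty) :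
    (S.commInf (Φ l)).IsRealEntireSolution (S.phiInf Φ l) := by
  refine ⟨h.isSolution_phiInf l hne, fun x hx => h.differentiable_phiInf l hx,
    fun t x hx i => ?_⟩
  have hcont : Continuous fun t : ℝ => (S.phiInf Φ l (t : ℂ) x i).im :=
    Complex.continuous_im.comp (((EuclideanSpace.proj (𝕜 := ℂ) i).continuous.comp
      (h.differentiable_phiInf l hx).continuous).comp Complex.continuous_ofReal)
  -- The explicit quotient is real for `t ≠ l`; continuity in `t` covers the exceptional point.
  refine congrFun (hcont.ext_on (dense_compl_singleton l) continuous_const fun t ht => ?_) t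
  refine im_eq_zero_of_conj2 ?_ i
  have e1 : starRingEnd ℂ (S.intLeft (Φ l) (Φ t) x) = S.intLeft (Φ l) (Φ t) x := by
    rw [intLeft, ← integral_conj]
    refine setIntegral_congr_fun (measurableSet_side (S := S) (r := false)) fun y hy => ?_
    have hy' : y ∈ S.I := hy.1
    rw [conj_dotT, conj2_eq_self (h.entire_left.2.2 l y hy'),
      conj2_eq_self (h.entire_left.2.2 t y hy')]
  rw [h.phiInf_of_ne (by exact_mod_cast ht) hx, conj2_smul, conj2_sub, conj2_smul, e1,
    (h.seed l).conj2_uInf hx, conj2_eq_self (h.entire_left.2.2 t x hx)]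
  simp

theorem isRealEntire_thetaInf (h : S.WeylSystem Φ Θ) (l : ℝ) :
    (S.commInf (Φ l)).IsRealEntireSolution (S.thetaInf Φ Θ l) := by
  refine ⟨fun z => (h.seed l).isSolution_transform (h.entire.1 z), fun x hx => ?_,
    fun t x hx i => im_eq_zero_of_conj2 ?_ i⟩
  · exact ((differentiable_id.sub_const _).smul (h.entire.2.1 x hx)).add
      ((differentiable_wronsk (h.entire.2.1 x hx) _).smul_const _)
  · rw [thetaInf, conj2_add, conj2_smul, conj2_smul, conj_wronsk, (h.seed l).conj2_uInf hx,
      conj2_eq_self (h.entire_left.2.2 l x hx), conj2_eq_self (h.entire.2.2 t x hx)]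
    simp

theorem thetaInf_self (h : S.WeylSystem Φ Θ) (l : ℝ) (hx : x ∈ S.I) :
    S.thetaInf Φ Θ l l x = -S.uInf (Φ l) x := by
  rw [thetaInf, wronsk_antisymm, h.wronsk_eq l x hx]
  simp

/-- The origin of the factor `(z - l)²` in the new Weyl function. -/
theorem transform_eq (h : S.WeylSystem Φ Θ) (l : ℝ) (z : ℂ) (hx : x ∈ S.I) :
    (z - l) • Φ z x + wronsk (Φ l x) (Φ z x) • S.uInf (Φ l) x =
      ((z - l) ^ 2) • S.phiInf Φ l z x := by
  by_cases hz : z = l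
  · subst hz; simp
  · have hz' := sub_ne_zero.2 hz
    rw [h.phiInf_of_ne hz hx, h.wronsk_eq_intLeft l z hx, sq, mul_smul (z - l) (z - l),
      smul_inv_smul₀ hz', smul_sub, ← neg_sub z (l : ℂ), neg_mul, neg_smul, mul_smul,
      ← sub_eq_add_neg]

theorem wronsk_inf_eq (h : S.WeylSystem Φ Θ) (l : ℝ) (z : ℂ) (hx : x ∈ S.I) :
    wronsk (S.thetaInf Φ Θ l z x) (S.phiInf Φ l z x) = 1 := by
  by_cases hz : z = l
  · subst hz
    have hc := (h.seed l).intLeft_ne_zero hx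
    rw [h.thetaInf_self l hx, h.phiInf_self l hx, ← neg_one_smul ℂ, uInf]
    simp only [wronsk_smul_left, wronsk_sub_right, wronsk_smul_right, wronsk_self,
      h.wronsk_deriv l hx]
    field_simp
    simp
  · have hz' : (z - l) ^ 2 ≠ 0 := pow_ne_zero 2 (sub_ne_zero.2 hz)
    refine mul_left_cancel₀ hz' ?_
    rw [← wronsk_smul_right, ← h.transform_eq l z hx, thetaInf, uInf]
    simp only [wronsk_add_left, wronsk_add_right, wronsk_smul_left, wronsk_smul_right, wronsk_self,
      h.wronsk_eq z x hx]
    rw [wronsk_antisymm (Θ z x) (Φ l x)]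
    ring

theorem leftSystem (h : S.WeylSystem Φ Θ) (l : ℝ) (hne : S.I.Nonempty) :
    (S.commInf (Φ l)).LeftSystem (S.phiInf Φ l) (S.thetaInf Φ Θ l) where
  entire_left := h.isRealEntire_phiInf l hne
  entire := h.isRealEntire_thetaInf l
  wronsk_eq z _ hx := h.wronsk_inf_eq l z hx
  l2 := h.l2End_phiInf l hne
  limitPoint := (h.seed l).not_limitCircle

end WeylSystem

end DiracData

/-! ### Weyl solutions at the right end -/

namespace DiracData

variable {S : DiracData} {r : Bool} {c d x y : ℝ}

theorem IsSolution.isWeylRight {z : ℂ} {f : ℝ → CC2} (hf : S.IsSolution z f)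
    (h0 : ∃ x ∈ S.I, f x ≠ 0) (h2 : S.L2End true f) (hb : S.BCRight f) : S.IsWeylRight z f :=
  ⟨hf, h0, hf.1, h2, (h2.smul z).congr (by filter_upwards [hf.2] with x hx using hx.symm), hb⟩

theorem BCRight.congr_smul {f g : ℝ → CC2} (hf : S.BCRight f) (k : ℂ)
    (h : ∀ x ∈ S.I, g x = k • f x) (hd : d ∈ S.I) : S.BCRight g := fun hlc => by
  have h1 := (hf hlc).const_mul k
  rw [mul_zero] at h1
  refine h1.congr' ?_
  filter_upwards [eventually_side (S := S) (r := true) hd] with x hx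
  rw [h x (side_subset hx), wronsk_smul_right]

theorem IsWeylRight.congr_smul {z k : ℂ} {f g : ℝ → CC2} (hf : S.IsWeylRight z f) (hk : k ≠ 0)
    (h : ∀ x ∈ S.I, g x = k • f x) : S.IsWeylRight z g := by
  obtain ⟨h1, ⟨d, hd, h0⟩, -, h2, -, h3⟩ := hf
  refine ((h1.smul k).congr fun x hx => (h x hx).symm).isWeylRight
    ⟨d, hd, by rw [h d hd]; exact smul_ne_zero hk h0⟩ ?_ (h3.congr_smul k h hd)
  refine (L2End.smul (r := true) h2 k).congr ?_
  filter_upwards [ae_restrict_mem S.measurableSet_I] with x hx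
  rw [h x hx]

/-- The Weyl solution normalized by a fundamental system. -/
theorem IsSingularWeylFunction.isWeylRight {Φ Θ : ℂ → ℝ → CC2} {M : ℂ → ℂ}
    (hM : S.IsSingularWeylFunction Θ Φ M) {z : ℂ} {u : ℝ → CC2} (hΦ : S.IsSolution z (Φ z))
    (hΘ : S.IsSolution z (Θ z)) (hW : ∀ x ∈ S.I, wronsk (Θ z x) (Φ z x) = 1)
    (hu : S.IsWeylRight z u) (hne : ∀ x ∈ S.I, wronsk (Φ z x) (u x) ≠ 0) :
    S.IsWeylRight z (fun x => Θ z x + M z • Φ z x) := by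
  obtain ⟨d, hd, -⟩ := hu.2.1
  -- Since `u = W(Θ,u) Φ - W(Φ,u) Θ`, division by `-W(Φ,u)` normalises the coefficient of `Θ` to
  -- one.
  refine hu.congr_smul (k := -(wronsk (Φ z d) (u d))⁻¹) (neg_ne_zero.2 (inv_ne_zero (hne d hd)))
    fun x hx => ?_
  rw [hM z u hu d hd (hne d hd), hΦ.eq_lin_comb hΘ hW hu.1 hd x hx]
  have := hne d hd
  apply CC2.ext <;> simp <;> field_simp <;> ring

namespace Seed

variable {l : ℝ} {u : ℝ → CC2} {z : ℂ}

theorem mass_mono (h : S.Seed l u) (hy : y ∈ S.I) (hxy : x ≤ y) :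
    mass S u x ≤ mass S u y := by
  have hs : S.side false x ⊆ S.side false y := fun _ ht => ⟨ht.1, lt_of_lt_of_le ht.2 hxy⟩
  exact integral_mono_measure (Measure.restrict_mono hs le_rfl) (Eventually.of_forall fun _ => by positivity) (h.memLp hy).integrable_norm_sq

theorem intervalIntegral_eq_mass (h : S.Seed l u) (hd : d ∈ S.I) (hx : x ∈ S.I) :
    ∫ y in d..x, ‖u y‖ ^ 2 = mass S u x - mass S u d := by
  have := setIntegral_side_sub (r := false) (k := fun y => ‖u y‖ ^ 2)
    (fun d hd => (h.memLp hd).integrable_norm_sq) hd hx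
  simp only [sgn, neg_smul, one_smul, sub_neg_eq_add] at this
  simp only [mass]
  linarith

theorem mass_bounded (h : S.Seed l u) (h2 : S.L2End true u) :
    ∃ B, ∀ x ∈ S.I, mass S u x ≤ B := by
  obtain ⟨d, hd, h2⟩ := h2
  refine ⟨mass S u d + ∫ y in S.side true d, ‖u y‖ ^ 2, fun x hx => ?_⟩
  have h0 : 0 ≤ ∫ y in S.side true d, ‖u y‖ ^ 2 := integral_nonneg fun _ => by positivity
  rcases le_or_gt x d with hxd | hxd
  · linarith [h.mass_mono hd hxd]
  · have := sgn_mul_intervalIntegral_le (r := true) hd h2 ⟨hx, hxd⟩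
    rw [h.intervalIntegral_eq_mass hd hx] at this
    simp only [sgn, one_mul] at this
    linarith

theorem tendsto_mass_atTop (h : S.Seed l u) (h2 : ¬ S.L2End true u) (hd : d ∈ S.I) :
    Tendsto (mass S u) S.atRight atTop := by
  rw [tendsto_atTop]
  intro B
  by_contra hcon
  refine h2 ⟨d, hd, memLp_side_of_bound hd h.sol.dEq.continuousOn (B := B) fun x hx => ?_⟩
  rw [h.intervalIntegral_eq_mass hd (side_subset hx)]
  have h1 := h.mass_pos hd
  simp only [sgn, one_mul]
  by_contra hB
  refine hcon ?_
  filter_upwards [eventually_side (S := S) (r := true) (side_subset hx)] with y hy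
  linarith [h.mass_mono (side_subset hy) hy.2.le]

/-- The boundary term at the right end vanishes in the limit. -/
theorem tendsto_wronsk_div (h : S.Seed l u) {f : ℝ → CC2} (hf : S.IsSolution z f)
    (hf2 : S.L2End true f)
    (hu : S.L2End true u → Tendsto (fun x => wronsk (u x) (f x)) S.atRight (𝓝 0)) :
    Tendsto (fun x => (S.intLeft u u x)⁻¹ * wronsk (u x) (f x)) S.atRight (𝓝 0) := by
  obtain ⟨d, hd, hfd⟩ := hf2
  -- If `u` is square integrable near `b`, the Wronskian tends to zero and `1/c` is bounded.
  -- Otherwise `c → ∞`, while Cauchy–Schwarz gives `W(u,f) = O(1 + √c)`.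
  by_cases h2 : S.L2End true u
  · have h1 := (hu h2).norm.const_mul (mass S u d)⁻¹
    rw [norm_zero, mul_zero] at h1
    refine squeeze_zero_norm' ?_ h1
    filter_upwards [eventually_side (S := S) (r := true) hd] with x hx
    have hm := h.mass_pos hd
    rw [norm_mul, norm_inv, h.intLeft_self, Complex.norm_real, Real.norm_eq_abs,
      abs_of_pos (h.mass_pos (side_subset hx))]
    have := h.mass_mono (side_subset hx) hx.2.le
    gcongr
  · have ht := h.tendsto_mass_atTop h2 hd
    have t1 := (tendsto_inv_atTop_zero.comp ht).const_mul ‖wronsk (u d) (f d)‖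
    have t2 := (tendsto_inv_atTop_zero.comp ((Real.tendsto_sqrt_atTop).comp ht)).const_mul
      (‖(l : ℂ) - z‖ * l2n (volume.restrict (S.side true d)) f)
    have t3 := t1.add t2
    simp only [mul_zero, add_zero] at t3
    refine squeeze_zero_norm' ?_ t3
    filter_upwards [eventually_side (S := S) (r := true) hd] with x hx
    have hxI := side_subset hx
    have hm := h.mass_pos hxI
    have e1 := (h.sol.wronsk hf).integral_eq_sub S.isOpen_I hd hxI
    rw [intervalIntegral.integral_const_mul] at e1
    have e2 : wronsk (u x) (f x) = wronsk (u d) (f d) + (l - z) * ∫ y in d..x, dotT (u y) (f y) := by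
      linear_combination -e1
    have hsub : volume.restrict (Set.uIoc d x) ≤ volume.restrict (S.side true d) :=
      uIoc_subset_side_ae hd hx
    have hu' : MemLp u 2 (volume.restrict (Set.uIoc d x)) :=
      (memLp_uIcc_of_continuousOn h.sol.dEq.continuousOn hd hxI).mono_measure
        (Measure.restrict_mono Set.uIoc_subset_uIcc le_rfl)
    have e3 : ‖∫ y in d..x, dotT (u y) (f y)‖ ≤
        √(mass S u x) * l2n (volume.restrict (S.side true d)) f := by
      rw [intervalIntegral.norm_intervalIntegral_eq]
      refine (norm_integral_dotT_le hu' (hfd.mono_measure hsub)).trans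
        (mul_le_mul ?_ (l2n_mono hfd hsub) l2n_nonneg (Real.sqrt_nonneg _))
      refine Real.sqrt_le_sqrt ?_
      have := h.intervalIntegral_eq_mass hd hxI
      rw [intervalIntegral_eq_sgn _ hx] at this
      simp only [sgn, one_smul] at this
      linarith [h.mass_pos hd]
    have e4 : ‖wronsk (u x) (f x)‖ ≤ ‖wronsk (u d) (f d)‖ + ‖(l : ℂ) - z‖ *
        (√(mass S u x) * l2n (volume.restrict (S.side true d)) f) := by
      rw [e2]
      refine (norm_add_le _ _).trans (add_le_add_right ?_ _)
      rw [norm_mul]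
      exact mul_le_mul_of_nonneg_left e3 (norm_nonneg _)
    rw [norm_mul, norm_inv, h.intLeft_self, Complex.norm_real, Real.norm_eq_abs, abs_of_pos hm]
    refine (mul_le_mul_of_nonneg_left e4 (inv_nonneg.2 hm.le)).trans (le_of_eq ?_)
    have hs := Real.sq_sqrt hm.le
    have hs0 : 0 < √(mass S u x) := Real.sqrt_pos.2 hm
    simp only [Function.comp_apply]
    rw [← hs]
    field_simp
    rw [Real.sqrt_sq hs0.le]
    ring

/-- For `z ≠ l` the transform is `(z - l)(f - g u_∞)` with the antiderivative `g = W(u,f)/(l - z)`;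
at `l` it is a constant multiple of `u_∞`. -/
theorem l2End_transform (h : S.Seed l u) {f : ℝ → CC2} (hf : S.IsSolution z f)
    (hf2 : S.L2End true f) :
    S.L2End true (fun x => (z - l) • f x + wronsk (u x) (f x) • S.uInf u x) := by
  obtain ⟨d, hd, hfd⟩ := id hf2
  by_cases hz : z = l
  · subst hz
    refine ((h.l2End_right_uInf hd).smul (wronsk (u d) (f d))).congr ?_
    filter_upwards [ae_restrict_mem S.measurableSet_I] with x hx
    rw [sub_self, zero_smul, zero_add, h.sol.wronsk_const hf hd hx]
  · have hz' : (l : ℂ) - z ≠ 0 := sub_ne_zero.2 (Ne.symm hz)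
    have hg : ADeriv S.I (fun x => (l - z)⁻¹ * wronsk (u x) (f x)) (fun x => dotT (u x) (f x)) :=
      ((h.sol.wronsk hf).const_mul _).congr_deriv (Eventually.of_forall fun x => by
        simp only; rw [inv_mul_cancel_left₀ hz'])
    refine ((h.l2End_right_sub hf2 hf.dEq.continuousOn hg).smul (z - l)).congr
      (Eventually.of_forall fun x => ?_)
    simp only
    rw [smul_sub, smul_smul, ← mul_assoc, ← neg_sub (l : ℂ) z, neg_mul, mul_inv_cancel₀ hz']
    simp

theorem wronsk_uInf_transform (f : ℝ → CC2) (x : ℝ) :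
    wronsk (S.uInf u x) ((z - l) • f x + wronsk (u x) (f x) • S.uInf u x) =
      (z - l) * ((S.intLeft u u x)⁻¹ * wronsk (u x) (f x)) := by
  simp [uInf]

/-- In the limit circle case this is the boundary condition; otherwise it follows from the limit
circle criterion, as `u_∞` lies in the maximal domain near `b`. -/
theorem tendsto_wronsk_uInf (h : S.Seed l u) {w : ℝ → CC2} (hw : (S.commInf u).InDomRight w)
    (hd : d ∈ S.I) : Tendsto (fun x => wronsk (S.uInf u x) (w x)) S.atRight (𝓝 0) := by
  by_contra hcon
  exact hcon (hw.2.2.2 (limitCircle_of_wronsk (S := S.commInf u) (r := true)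
    (IsSolution.inMax (S := S.commInf u) h.isSolution_uInf (h.l2End_right_uInf hd)) hw.inMax hcon))

theorem integral_sq_uInf_le (h : S.Seed l u) (hx : x ∈ S.I) :
    ∫ y in S.side true x, ‖S.uInf u y‖ ^ 2 ≤ (mass S u x)⁻¹ := by
  have hm := ((h.l2End_right_uInf hx).memLp h.isSolution_uInf.dEq.continuousOn hx).integrable_norm_sq
  have := endF_neBot (r := true) hx
  have ht := tendsto_intervalIntegral_end hx hm
  simp only [sgn, one_smul] at ht
  refine le_of_tendsto ht ?_
  filter_upwards [eventually_side (S := S) (r := true) hx] with y hy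
  rw [h.intervalIntegral_uInf hx (side_subset hy)]
  linarith [inv_pos.2 (h.mass_pos (side_subset hy))]

/-- Green's formula between `x` and `b`, then Cauchy–Schwarz with `∫_x^b |u_∞|² ≤ 1/c(x)`. -/
theorem norm_wronsk_uInf_sq_le (h : S.Seed l u) {w : ℝ → CC2}
    (hw : (S.commInf u).IsSolution z w) (hw2 : S.L2End true w)
    (h0 : Tendsto (fun x => wronsk (S.uInf u x) (w x)) S.atRight (𝓝 0)) (hx : x ∈ S.I) :
    ‖wronsk (S.uInf u x) (w x)‖ ^ 2 ≤
      ‖(l : ℂ) - z‖ ^ 2 * ((mass S u x)⁻¹ * ∫ y in S.side true x, ‖w y‖ ^ 2) := by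
  have mu := (h.l2End_right_uInf hx).memLp h.isSolution_uInf.dEq.continuousOn hx
  have mw := hw2.memLp hw.dEq.continuousOn hx
  have e : ∀ y, dotT ((l : ℂ) • S.uInf u y) (w y) - dotT (S.uInf u y) (z • w y) =
      (l - z) * dotT (S.uInf u y) (w y) := fun y => by
    rw [dotT_smul_left, dotT_smul_right]; ring
  have hg := green_side (S := S.commInf u) (r := true) h.isSolution_uInf.dEq hw.dEq hx
    (by
      simp only [e]
      exact (integrable_dotT mu mw).const_mul _) h0
  simp only [e] at hg
  rw [integral_const_mul] at hg
  simp only [sgn, one_smul] at hg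
  rw [← norm_neg, ← hg, norm_mul, mul_pow]
  refine mul_le_mul_of_nonneg_left ?_ (by positivity)
  refine (pow_le_pow_left₀ (norm_nonneg _) (norm_integral_dotT_le mu mw) 2).trans ?_
  rw [mul_pow, l2n_sq, l2n_sq]
  exact mul_le_mul_of_nonneg_right (h.integral_sq_uInf_le hx)
    (integral_nonneg fun _ => by positivity)

/-- Square integrability near the right end is reflected by the transformation. -/
theorem l2End_of_transform (h : S.Seed l u) (hz : z ≠ l) {f : ℝ → CC2} (hf : S.IsSolution z f)
    (hw2 : S.L2End true (fun x => (z - l) • f x + wronsk (u x) (f x) • S.uInf u x))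
    (h0 : Tendsto (fun x => (S.intLeft u u x)⁻¹ * wronsk (u x) (f x)) S.atRight (𝓝 0)) :
    S.L2End true f := by
  obtain ⟨d, hd, hwd⟩ := id hw2
  have hz' : (l : ℂ) - z ≠ 0 := sub_ne_zero.2 (Ne.symm hz)
  have hzl : (z : ℂ) - l ≠ 0 := sub_ne_zero.2 hz
  have hn : 0 < ‖(l : ℂ) - z‖ := norm_pos_iff.2 hz'
  have hne : ‖z - (l : ℂ)‖ = ‖(l : ℂ) - z‖ := norm_sub_rev _ _
  set w := fun x => (z - l) • f x + wronsk (u x) (f x) • S.uInf u x with hw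
  have hws : (S.commInf u).IsSolution z w := h.isSolution_transform hf
  set g : ℝ → ℂ := fun x => (l - z)⁻¹ * wronsk (u x) (f x) with hgdef
  have hg : ADeriv S.I g (fun x => dotT (u x) (f x)) :=
    ((h.sol.wronsk hf).const_mul _).congr_deriv (Eventually.of_forall fun x => by
      simp only; rw [inv_mul_cancel_left₀ hz'])
  have hwg : ∀ x, f x - g x • S.uInf u x = (z - l)⁻¹ • w x := fun x => by
    rw [hw, hgdef]
    simp only
    rw [smul_add, inv_smul_smul₀ hzl, smul_smul, ← neg_sub z (l : ℂ), inv_neg, neg_mul, neg_smul,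
      sub_neg_eq_add]
  have hĝ : ∀ x, wronsk (S.uInf u x) (w x) =
      (z - l) * ((S.intLeft u u x)⁻¹ * wronsk (u x) (f x)) := fun x => wronsk_uInf_transform f x
  have hĝ0 : Tendsto (fun x => wronsk (S.uInf u x) (w x)) S.atRight (𝓝 0) := by
    simp only [hĝ]
    simpa using h0.const_mul (z - (l : ℂ))
  set K := ∫ y in S.side true d, ‖w y‖ ^ 2
  set N := ‖(l : ℂ) - z‖
  refine ⟨d, hd, memLp_side_of_bound hd hf.dEq.continuousOn
    (B := (N ^ 2)⁻¹ * K + (N ^ 2)⁻¹ * K) fun x hx => ?_⟩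
  have hxI := side_subset hx
  have hm := h.mass_pos hxI
  have h1 := h.intervalIntegral_sq hf.dEq.continuousOn hg hd hxI
  have h2 : ∫ y in d..x, ‖f y - g y • S.uInf u y‖ ^ 2 = (N ^ 2)⁻¹ * ∫ y in d..x, ‖w y‖ ^ 2 := by
    rw [← intervalIntegral.integral_const_mul]
    refine intervalIntegral.integral_congr fun y _ => ?_
    rw [hwg, norm_smul, norm_inv, hne, mul_pow, inv_pow]
  have h3 := sgn_mul_intervalIntegral_le hd hwd hx
  have h4 := h.norm_wronsk_uInf_sq_le hws hw2 hĝ0 hxI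
  have h5 : ∫ y in S.side true x, ‖w y‖ ^ 2 ≤ K :=
    integral_mono_measure (Measure.restrict_mono (side_subset_side hx) le_rfl)
      (Eventually.of_forall fun _ => by positivity) hwd.integrable_norm_sq
  -- Solved for `|f|²`, the square identity carries the boundary term `|g|²/c` with the wrong sign.
  -- It is recovered from `|W(u_∞,w)| = |l - z|² |g|/c` and the bound `h4` on that Wronskian.
  have h6 : ‖g x‖ ^ 2 / mass S u x ≤ (N ^ 2)⁻¹ * K := by
    have e1 : ‖wronsk (S.uInf u x) (w x)‖ = N ^ 2 * (mass S u x)⁻¹ * ‖g x‖ := by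
      rw [hĝ, hgdef]
      simp only
      rw [norm_mul, norm_mul, norm_mul, norm_inv, norm_inv, h.intLeft_self, Complex.norm_real,
        Real.norm_eq_abs, abs_of_pos hm, hne]
      field_simp
      exact mul_comm _ _
    rw [e1] at h4
    have h7 : N ^ 2 * ((mass S u x)⁻¹ * ∫ y in S.side true x, ‖w y‖ ^ 2) ≤
        N ^ 2 * ((mass S u x)⁻¹ * K) := by gcongr
    have h8 := h4.trans h7
    have hN2 : 0 < N ^ 2 := by positivity
    rw [inv_mul_eq_div, div_le_div_iff₀ hm hN2]
    have h9 := mul_le_mul_of_nonneg_left h8 (show 0 ≤ (N ^ 2)⁻¹ * mass S u x * mass S u x by positivity)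
    have e2 : (N ^ 2)⁻¹ * mass S u x * mass S u x * (N ^ 2 * (mass S u x)⁻¹ * ‖g x‖) ^ 2 =
        ‖g x‖ ^ 2 * N ^ 2 := by field_simp
    have e3 : (N ^ 2)⁻¹ * mass S u x * mass S u x * (N ^ 2 * ((mass S u x)⁻¹ * K)) =
        K * mass S u x := by field_simp
    rw [e2, e3] at h9
    exact h9
  have h7 : 0 ≤ ‖g d‖ ^ 2 / mass S u d := div_nonneg (by positivity) (h.mass_pos hd).le
  simp only [sgn, one_mul] at h3 ⊢
  rw [h2] at h1
  have h8 : (N ^ 2)⁻¹ * ∫ y in d..x, ‖w y‖ ^ 2 ≤ (N ^ 2)⁻¹ * K := by gcongr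
  linarith

end Seed

end DiracData

/-! ### Transfer of Weyl solutions and of the singular Weyl function -/

namespace DiracData

variable {S : DiracData} {r : Bool} {c d x y : ℝ}

theorem memLp_of_l2End {f : ℝ → CC2} (hfc : ContinuousOn f S.I) (h1 : S.L2End false f)
    (h2 : S.L2End true f) (hd : d ∈ S.I) : MemLp f 2 (volume.restrict S.I) := by
  refine (memLp_union (h1.memLp hfc hd) (memLp_union (memLp_uIcc_of_continuousOn hfc hd hd)
    (h2.memLp hfc hd))).mono_measure (Measure.restrict_mono (fun x hx => ?_) le_rfl)
  rcases lt_trichotomy x d with h | h | h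
  · exact Or.inl ⟨hx, h⟩
  · exact Or.inr (Or.inl (by simp [h]))
  · exact Or.inr (Or.inr ⟨hx, h⟩)

namespace WeylSystem

variable {Φ Θ : ℂ → ℝ → CC2} {z : ℂ} {l : ℝ}

theorem of_isWeylLeft (hS : S.IsStandard) (hΦ : S.IsRealEntireSolution Φ)
    (hΦa : ∀ z, S.IsWeylLeft z (Φ z)) (hΘ : S.IsRealEntireSolution Θ)
    (hW : ∀ z, ∀ x ∈ S.I, wronsk (Θ z x) (Φ z x) = 1) : S.WeylSystem Φ Θ where
  entire_left := hΦ
  entire := hΘ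
  wronsk_eq := hW
  l2 z := (hΦa z).2.2.2.1
  tendsto_wronsk z w := hS.tendsto_wronsk_left (hΦ.1 0) (hΘ.1 0) (hW 0) (hΦa z).2.2 (hΦa w).2.2

/-- If the seed is an eigenfunction, it satisfies the boundary condition at the right end. -/
theorem inDomRight_of_isEigenvalue (h : S.WeylSystem Φ Θ) (hS : S.IsStandard)
    (hΦa : ∀ z, S.IsWeylLeft z (Φ z)) (hd : d ∈ S.I)
    (hl : MemLp (Φ l) 2 (volume.restrict S.I) → S.IsEigenvalue l) (h2 : S.L2End true (Φ l)) :
    S.InDomRight (Φ l) := by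
  have hu := h.entire_left.1 l
  obtain ⟨f, hf0, F, hAC, hbl, hbr, h3, h4⟩ :=
    hl (memLp_of_l2End hu.dEq.continuousOn (h.l2 l) h2 hd)
  have hF : S.IsSolution l F := by
    refine ⟨hAC, ?_⟩
    filter_upwards [h3, h4, Lp.coeFn_smul (l : ℂ) f] with x e1 e2 e3
    rw [← e1, ← e2, e3, Pi.smul_apply]
  have hFm : MemLp F 2 (volume.restrict S.I) := (memLp_congr_ae h3).1 (Lp.memLp f)
  have hFm' : MemLp (S.tau F) 2 (volume.restrict S.I) :=
    (memLp_congr_ae h4).1 (Lp.memLp ((l : ℂ) • f))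
  have hw := hS.tendsto_wronsk_left (h.entire_left.1 0) (h.entire.1 0) (h.wronsk_eq 0)
    (hΦa l).2.2 ⟨hAC, l2End_of_memLp (r := false) hFm hd, l2End_of_memLp (r := false) hFm' hd, hbl⟩
  -- The eigenfunction and `Φ(l)` both lie in the domain near `a`, so their constant Wronskian is
  -- zero. They are proportional, and `Φ(l)` inherits the boundary condition at `b`.
  have hw0 : wronsk (Φ l d) (F d) = 0 := by
    have := endF_neBot (r := false) hd
    refine tendsto_nhds_unique (f := fun x => wronsk (Φ l x) (F x)) (l := S.endF false)
      (tendsto_const_nhds.congr' ?_) hw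
    filter_upwards [eventually_side (r := false) hd] with x hx
    exact hu.wronsk_const hF hd (side_subset hx)
  have hFe : ∀ x ∈ S.I, F x = wronsk (Θ l d) (F d) • Φ l x := fun x hx => by
    rw [hu.eq_lin_comb (h.entire.1 l) (h.wronsk_eq l) hF hd x hx, hw0]
    simp
  have hk : wronsk (Θ l d) (F d) ≠ 0 := by
    intro hk
    refine hf0 ((Lp.eq_zero_iff_ae_eq_zero).2 ?_)
    filter_upwards [h3, ae_restrict_mem S.measurableSet_I] with x e1 hx
    rw [e1, hFe x hx, hk, zero_smul]; rfl
  refine (hu.isWeylRight ⟨d, hd, (h.seed l).ne_zero d hd⟩ h2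
    (hbr.congr_smul (wronsk (Θ l d) (F d))⁻¹ (fun x hx => ?_) hd)).2.2
  rw [hFe x hx, inv_smul_smul₀ hk]

theorem transform_add (h : S.WeylSystem Φ Θ) (l : ℝ) (z α β : ℂ) (hx : x ∈ S.I) :
    (z - l) • (α • Θ z x + β • Φ z x) +
        wronsk (Φ l x) (α • Θ z x + β • Φ z x) • S.uInf (Φ l) x =
      α • S.thetaInf Φ Θ l z x + ((z - l) ^ 2 * β) • S.phiInf Φ l z x := by
  have e := h.transform_eq l z hx
  rw [mul_comm _ β, mul_smul, ← e, thetaInf]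
  apply CC2.ext <;> simp <;> ring

theorem isWeylRight_transform (h : S.WeylSystem Φ Θ) (hS : S.IsStandard)
    (hdom : S.L2End true (Φ l) → S.InDomRight (Φ l)) {f : ℝ → CC2} (hf : S.IsWeylRight z f)
    (hne : ∃ x ∈ S.I, (z - l) • f x + wronsk (Φ l x) (f x) • S.uInf (Φ l) x ≠ 0) :
    (S.commInf (Φ l)).IsWeylRight z
      (fun x => (z - l) • f x + wronsk (Φ l x) (f x) • S.uInf (Φ l) x) := by
  refine IsSolution.isWeylRight ((h.seed l).isSolution_transform hf.1) hne
    ((h.seed l).l2End_transform hf.1 hf.2.2.2.1) fun _ => ?_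
  have h1 := ((h.seed l).tendsto_wronsk_div hf.1 hf.2.2.2.1 fun h2 =>
    hS.tendsto_wronsk_right (h.entire_left.1 0) (h.entire.1 0) (h.wronsk_eq 0) (hdom h2)
      hf.2.2).const_mul (z - (l : ℂ))
  rw [mul_zero] at h1
  exact h1.congr fun x => (Seed.wronsk_uInf_transform f x).symm

theorem isWeylRight_of_transform (h : S.WeylSystem Φ Θ) (hS : S.IsStandard)
    (hdom : S.L2End true (Φ l) → S.InDomRight (Φ l)) (hz : z ≠ l) {f : ℝ → CC2}
    (hf : S.IsSolution z f) (hne : ∃ x ∈ S.I, f x ≠ 0)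
    (hw : (S.commInf (Φ l)).InDomRight
      (fun x => (z - l) • f x + wronsk (Φ l x) (f x) • S.uInf (Φ l) x)) :
    S.IsWeylRight z f := by
  obtain ⟨d, hd, -⟩ := id hne
  have hs := h.seed l
  have hzl : z - (l : ℂ) ≠ 0 := sub_ne_zero.2 hz
  have h0 : Tendsto (fun x => (S.intLeft (Φ l) (Φ l) x)⁻¹ * wronsk (Φ l x) (f x)) S.atRight
      (𝓝 0) := by
    have h1 := (hs.tendsto_wronsk_uInf hw hd).const_mul (z - (l : ℂ))⁻¹
    rw [mul_zero] at h1
    refine h1.congr fun x => ?_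
    rw [Seed.wronsk_uInf_transform, inv_mul_cancel_left₀ hzl]
  have hf2 := hs.l2End_of_transform hz hf hw.2.1 h0
  refine hf.isWeylRight hne hf2 fun hlc => ?_
  have hu2 : S.L2End true (Φ l) := hlc _ _ hs.sol
  have hdu := hdom hu2
  obtain ⟨B, hB⟩ := hs.mass_bounded hu2
  have huf : Tendsto (fun x => wronsk (Φ l x) (f x)) S.atRight (𝓝 0) := by
    have h1 := h0.norm.const_mul B
    rw [norm_zero, mul_zero] at h1
    refine squeeze_zero_norm' ?_ h1
    filter_upwards [eventually_side (S := S) (r := true) hd] with x hx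
    have hm := hs.mass_pos (side_subset hx)
    have hb := hB x (side_subset hx)
    rw [norm_mul, norm_inv, hs.intLeft_self, Complex.norm_real, Real.norm_eq_abs, abs_of_pos hm,
      ← mul_assoc]
    refine le_mul_of_one_le_left (norm_nonneg _) ?_
    rw [← div_eq_mul_inv]
    exact (one_le_div hm).2 hb
  have hR := hS.bc_right hlc
  -- In the limit circle case `Φ(l)` satisfies the boundary condition at `b`, so it can serve as
  -- generator for the pair formed by the original generator and `f`.
  refine tendsto_wronsk_zero (r := true) (u := Φ l) (hR.1.inMax (hlc _ _ hR.1)) (hf.inMax hf2)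
    (fun hlc => exists_partner hs.sol (h.entire.1 l) (h.wronsk_eq l) hs.sol
      ⟨d, hd, hs.ne_zero d hd⟩ hlc) (fun hlc => ?_) fun _ => huf
  have h1 := (hdu.2.2.2 hlc).neg
  rw [neg_zero] at h1
  exact h1.congr fun x => (wronsk_antisymm _ _).symm

theorem isSingularWeylFunction (h : S.WeylSystem Φ Θ) (hS : S.IsStandard)
    (hdom : S.L2End true (Φ l) → S.InDomRight (Φ l)) {M : ℂ → ℂ}
    (hM : S.IsSingularWeylFunction Θ Φ M) :
    (S.commInf (Φ l)).IsSingularWeylFunction (S.thetaInf Φ Θ l) (S.phiInf Φ l)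
      (fun z => (z - l) ^ 2 * M z) := by
  intro z w hw d hd hB
  replace hd : d ∈ S.I := hd
  have hs := h.seed l
  have hφi := h.isSolution_phiInf l ⟨d, hd⟩ z
  have hθi := (h.isRealEntire_thetaInf l).1 z
  by_cases hz : z = l
  · subst hz
    -- At the exceptional point the second solution is `-u_∞`, whose constant Wronskian with a Weyl
    -- solution at `b` has limit zero; the numerator of the quotient vanishes.
    have h0 : wronsk (S.uInf (Φ l) d) (w d) = 0 := by
      have := endF_neBot (r := true) hd
      refine tendsto_nhds_unique (f := fun x => wronsk (S.uInf (Φ l) x) (w x)) (l := S.endF true)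
        (tendsto_const_nhds.congr' ?_) (hs.tendsto_wronsk_uInf hw.2.2 hd)
      filter_upwards [eventually_side (r := true) hd] with x hx
      exact IsSolution.wronsk_const (S := S.commInf (Φ l)) hs.isSolution_uInf hw.1 hd
        (side_subset (S := S) hx)
    rw [h.thetaInf_self l hd, ← neg_one_smul ℂ (S.uInf (Φ l) d), wronsk_smul_left, h0]
    simp
  · have hzl : z - (l : ℂ) ≠ 0 := sub_ne_zero.2 hz
    set A := wronsk (S.thetaInf Φ Θ l z d) (w d)
    set B := wronsk (S.phiInf Φ l z d) (w d)
    have hwe : ∀ x ∈ S.I, w x = A • S.phiInf Φ l z x - B • S.thetaInf Φ Θ l z x :=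
      hφi.eq_lin_comb hθi (fun x hx => h.wronsk_inf_eq l z hx) hw.1 hd
    -- The preimage of `w`: the transformation keeps the coefficient of `Θ` and multiplies that of
    -- `Φ` by `(z - l)²`, so the latter is divided out beforehand.
    set f : ℝ → CC2 := fun x => (-B) • Θ z x + (((z - l) ^ 2)⁻¹ * A) • Φ z x
    have hf : S.IsSolution z f := ((h.entire.1 z).smul _).add ((h.entire_left.1 z).smul _)
    have hfw : ∀ x ∈ S.I, w x = (z - l) • f x + wronsk (Φ l x) (f x) • S.uInf (Φ l) x :=
      fun x hx => by
        rw [h.transform_add l z _ _ hx, hwe x hx, mul_inv_cancel_left₀ (pow_ne_zero 2 hzl),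
          neg_smul, sub_eq_add_neg, add_comm]
    have hφf : wronsk (Φ z d) (f d) = B := by
      simp only [f, wronsk_add_right, wronsk_smul_right, wronsk_self]
      rw [wronsk_antisymm (Φ z d) (Θ z d), h.wronsk_eq z d hd]
      ring
    have hθf : wronsk (Θ z d) (f d) = ((z - l) ^ 2)⁻¹ * A := by
      simp only [f, wronsk_add_right, wronsk_smul_right, wronsk_self, h.wronsk_eq z d hd]
      ring
    have hTf := hw.congr_smul one_ne_zero (g := fun x => (z - l) • f x +
      wronsk (Φ l x) (f x) • S.uInf (Φ l) x) fun x hx => by rw [one_smul, hfw x hx]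
    have hfW := h.isWeylRight_of_transform hS hdom hz hf
      ⟨d, hd, fun h0 => hB (by rw [← hφf, h0, wronsk_zero_right])⟩ hTf.2.2
    have := hM z f hfW d hd (by rwa [hφf])
    simp only
    rw [this, hφf, hθf]
    field_simp

end WeylSystem

end DiracData

/-! ### The main theorem -/

theorem mainTheorem5 (S : DiracData) (hS : S.IsStandard)
    (hdisc : ∃ c ∈ S.I, (S.dirichletLeft c).PurelyDiscrete)
    (Φ Θ : ℂ → ℝ → CC2)
    (hΦ : S.IsRealEntireSolution Φ) (hΦa : ∀ z, S.IsWeylLeft z (Φ z))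
    (hΘ : S.IsRealEntireSolution Θ)
    (hW : ∀ z, ∀ x ∈ S.I, wronsk (Θ z x) (Φ z x) = 1)
    (M : ℂ → ℂ) (hM : S.IsSingularWeylFunction Θ Φ M)
    (l : ℝ)
    (hl : MemLp (Φ l) 2 (volume.restrict S.I) → S.IsEigenvalue l) :
    ∃ Φi Θi : ℂ → ℝ → CC2,
      -- the formulas for the new system
      (∀ z : ℂ, z ≠ l → ∀ x ∈ S.I,
        Φi z x = (z - l)⁻¹ • (Φ z x - S.intLeft (Φ l) (Φ z) x • S.uInf (Φ l) x)) ∧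
      (∀ z : ℂ, ∀ x ∈ S.I,
        Θi z x = (z - l) • Θ z x + wronsk (Φ l x) (Θ z x) • S.uInf (Φ l) x) ∧
      -- it is a real entire system of solutions with Wronskian one
      (S.commInf (Φ l)).IsRealEntireSolution Φi ∧
      (S.commInf (Φ l)).IsRealEntireSolution Θi ∧
      (∀ z, ∀ x ∈ S.I, wronsk (Θi z x) (Φi z x) = 1) ∧
      -- the values at the exceptional point
      (∀ x ∈ S.I,
        IntegrableOn (fun y => dotT (Φ l y) (deriv (fun z => Φ z y) l)) {y ∈ S.I | y < x} ∧
        Φi l x = deriv (fun z => Φ z x) l -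
          S.intLeft (Φ l) (fun y => deriv (fun z => Φ z y) l) x • S.uInf (Φ l) x) ∧
      (∀ x ∈ S.I, Θi l x = -S.uInf (Φ l) x) ∧
      -- the commuted operator again has purely discrete spectrum near the left end point
      (∀ c ∈ S.I, ((S.commInf (Φ l)).dirichletLeft c).PurelyDiscrete) ∧
      -- the Weyl solutions
      (∀ z, (S.commInf (Φ l)).IsWeylLeft z (Φi z)) ∧
      (∀ z : ℂ, ∀ x ∈ S.I,
        (z - l) • (Θ z x + M z • Φ z x) +
            wronsk (Φ l x) (Θ z x + M z • Φ z x) • S.uInf (Φ l) x =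
          Θi z x + ((z - l) ^ 2 * M z) • Φi z x) ∧
      (∀ (z : ℂ) (u : ℝ → CC2), S.IsWeylRight z u →
        (∀ x ∈ S.I, wronsk (Φ z x) (u x) ≠ 0) →
        (S.commInf (Φ l)).IsWeylRight z (fun x => Θi z x + ((z - l) ^ 2 * M z) • Φi z x)) ∧
      -- the singular Weyl function
      (S.commInf (Φ l)).IsSingularWeylFunction Θi Φi (fun z => (z - l) ^ 2 * M z) := by
  obtain ⟨c₀, hc₀, -⟩ := hdisc
  have hne : S.I.Nonempty := ⟨c₀, hc₀⟩
  have h := DiracData.WeylSystem.of_isWeylLeft hS hΦ hΦa hΘ hW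
  have hdom := h.inDomRight_of_isEigenvalue hS hΦa hc₀ hl
  have hψ : ∀ z : ℂ, ∀ x ∈ S.I, (z - l) • (Θ z x + M z • Φ z x) +
      wronsk (Φ l x) (Θ z x + M z • Φ z x) • S.uInf (Φ l) x =
        S.thetaInf Φ Θ l z x + ((z - l) ^ 2 * M z) • S.phiInf Φ l z x := fun z x hx => by
    simpa using h.transform_add l z 1 (M z) hx
  refine ⟨S.phiInf Φ l, S.thetaInf Φ Θ l, fun z hz x hx => h.phiInf_of_ne hz hx,
    fun _ _ _ => rfl, h.isRealEntire_phiInf l hne, h.isRealEntire_thetaInf l,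
    fun z x hx => h.wronsk_inf_eq l z hx, fun x hx => ⟨?_, h.phiInf_self l hx⟩,
    fun x hx => h.thetaInf_self l hx, fun c hc => (h.leftSystem l hne).purelyDiscrete hc,
    fun z => ?_, hψ, fun z u hu hWu => ?_, h.isSingularWeylFunction hS hdom hM⟩
  · exact integrable_dotT ((h.seed l).memLp hx) (h.memLp_deriv_hasDerivAt l hx).1
  · have hs := h.isSolution_phiInf l hne z
    have h2 := h.l2End_phiInf l hne z
    -- The boundary condition at the left end is void, since that end is limit point for the new
    -- expression.
    refine ⟨hs, ⟨c₀, hc₀, fun h0 => ?_⟩, hs.1, h2, ?_, fun hlc =>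
      absurd hlc (h.seed l).not_limitCircle⟩
    · have := h.wronsk_inf_eq l z hc₀
      simp [h0] at this
    · exact DiracData.L2End.congr (S := S.commInf (Φ l)) (r := false)
        (DiracData.L2End.smul (S := S.commInf (Φ l)) (r := false) h2 z)
        (by filter_upwards [hs.2] with x hx using hx.symm)
  · have hw := hM.isWeylRight (hΦ.1 z) (hΘ.1 z) (hW z) hu hWu
    refine (h.isWeylRight_transform hS hdom hw ⟨c₀, hc₀, fun h0 => ?_⟩).congr_smul one_ne_zero
      fun x hx => by rw [one_smul, hψ z x hx]
    rw [hψ z c₀ hc₀] at h0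
    -- Non-triviality: the Wronskian of this combination with the new `Φ` equals one.
    have h1 := congrArg (fun v => wronsk v (S.phiInf Φ l z c₀)) h0
    simp [h.wronsk_inf_eq l z hc₀] at h1

end
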